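/- Let $M$ be a lattice of rank $d$, $N$ its dual lattice, and let $\mathbf\Sigma$ and $\check{\mathbf\Sigma}$ be simplicial stacky fans in $M_{\mathbb R}$ and $N_{\mathbb R}$: finite nonempty fans $\Sigma,\check\Sigma$ of simplicial rational cones, with a positive integer $\beta_\rho$ attached to each ray; $\rho$ also denotes the primitive generator of the ray. For a cone $c$ put $c[1]=\{\beta_\rho\rho:\rho \text{ a ray of } c\}$ and $\Delta_c=\mathrm{Conv}(c[1]\cup\{0\})$; let $\mathbf\Sigma[1]$ be the union of the sets $c[1]$. Suppose that $(\mathbf\Sigma,\check{\mathbf\Sigma})$ is a Clarke dual pair, that is: both fans are quasiprojective (they admit a strictly convex fan-linear function on the support with integral values at the lattice points of the support), $\langle m,n\rangle\ge 0$ for all $m\in\mathrm{Supp}(\Sigma)$, $n\in\mathrm{Supp}(\check\Sigma)$, and both are convex ($\bigcup_{c\in\Sigma}\Delta_c$ and $\bigcup_{\check c\in\check\Sigma}\Delta_{\check c}$ are convex sets). Let $\varphi$ and $\check\varphi$ be strictly convex fan-linear functions for $\mathbf\Sigma$ and $\check{\mathbf\Sigma}$, integral on $\mathbf\Sigma[1]$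 and $\check{\mathbf\Sigma}[1]$. Put $A=\check{\mathbf\Sigma}[1]\cup\{0\}$, $\Delta=\mathrm{Conv}(A)$, and let $\mathrm{SD}(w_{\check\varphi})$ be the regular subdivision of $\Delta$ given by the tropical polynomial $u\mapsto\min_{n\in A}(\langle u,n\rangle+\check\varphi(n))$ on $M_{\mathbb R}$. Let $\mathsf T(\mathbf\Sigma,w_{\check\varphi})_0$ be the poset of pairs $(c,\tau)$ with $c\in\Sigma$, $\tau\in\mathrm{SD}(w_{\check\varphi})$, $0\in\tau$ and $c\subseteq\mathrm{nc}(f_\tau)$, the inner normal cone of the minimal face $f_\tau$ of $\Delta$ containing $\tau$; here $(c,\tau)\preceq(c',\tau')$ iff $c'\subseteq c$ and $\tau'\subseteq\tau$. A sheaf on such a poset is a functor from it to complex vector spaces, and $H^n$ denotes the sheaf cohomology for the topology whose open sets are the upper sets. For a set of linearly independent vectors $v_1,\dots,v_r$ of a lattice let $\mathrm{Box}$ (resp. $\mathrm{Box}^\circ$) be the set of lattice points $g=\sum a_iv_i$ with all $a_i\in[0,1)$ (resp. $(0,1)$), and let $\iota(g)=\sum a_i$. For $\mathrm{Box}(c)$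 take the vectors $c[1]$, for $\mathrm{Box}(\tau)$ the nonzero vertices of $\tau$. Let $\mathbf B^\ell_c$ and $\mathbf B^\ell_\tau$ be the complex vector spaces with bases the elements of $\mathrm{Box}(c)$ and $\mathrm{Box}(\tau)$ with $\iota=\ell$. Let $L(\tau)\subseteq N_{\mathbb C}$ be the span of $\tau$, $\mathrm{Vol}(L(\tau))$ a generator of $\wedge^{\dim\tau}L(\tau)$, and $c^\perp\subseteq N_{\mathbb C}$ the annihilator of $c$. For $\lambda,\mu\in\mathbb Q$ define sheaves on $\mathsf T(\mathbf\Sigma,w_{\check\varphi})_0$ by $$\mathbf J^{\lambda,\mu}(c,\tau)=\mathbf B^{\mu}_\tau\otimes\big(\wedge^{\lambda+\mu-\dim\tau}c^\perp\wedge\mathrm{Vol}(L(\tau))\big),$$ $$\mathbf J^{\lambda,\mu}_{\mathrm{orb}}(c,\tau)=\bigoplus_{k-m+\ell=\lambda,\ \ell+m=\mu}\mathbf B_c^\ell\otimes\mathbf B_\tau^m\otimes\big(\wedge^{k-\dim\tau}c^\perp\wedge\mathrm{Vol}(L(\tau))\big),$$ the last factor being a subspace of $\wedge^\bullet N_{\mathbb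 C}$ (zero unless its exterior degree is a nonnegative integer). The transition maps are the projections that kill the box elements outside the smaller box, tensored with the inclusions of subspaces of $\wedge^\bullet N_{\mathbb C}$. For $c\in\Sigma$ let $\mathsf T_{0,c}$ be the set of cells $(c',\tau)$ with $c\subseteq c'$, let $\mathbf J_c$ be the restriction of $\mathbf J$ to it, and put $$H^{\lambda,\mu}(\mathsf T_{0,c},\mathbf J_c)=\bigoplus_n H^n(\mathsf T_{0,c},\mathbf J_c^{\lambda,\mu-n}),$$ $$H^{\lambda,\mu}_{\mathrm{orb}}(\mathsf T(\mathbf\Sigma,w_{\check\varphi})_0)=\bigoplus_{c\in\Sigma}\bigoplus_{g\in\mathrm{Box}^\circ(c)}H^{\lambda-\iota(g),\mu-\iota(g)}(\mathsf T_{0,c},\mathbf J_c).$$ Define $\mathsf T(\check{\mathbf\Sigma},w_\varphi)_0$, its sheaves $\check{\mathbf J}$, $\check{\mathbf J}_{\mathrm{orb}}$ and its Hodge spaces in the same way, exchanging the roles of $(M,\mathbf\Sigma,\varphi)$ and $(N,\check{\mathbf\Sigma},\check\varphi)$. Then for all $\lambda,\mu\in\mathbb Q$ there are canonical isomorphisms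 $$H^{\lambda,\mu}_{\mathrm{orb}}(\mathsf T(\mathbf\Sigma,w_{\check\varphi})_0)\cong H^{d-\lambda,\mu}_{\mathrm{orb}}(\mathsf T(\check{\mathbf\Sigma},w_\varphi)_0).$$ More precisely: the cells of the two posets are the pairs $(c,\Delta_{\check c})$ and $(\check c,\Delta_c)$, respectively, and $(c,\Delta_{\check c})\mapsto(\check c,\Delta_c)$ is an isomorphism of posets; contraction with a fixed nonzero element of $\wedge^dM_{\mathbb C}$, together with the exchange of the two box factors, is an isomorphism of sheaves $\mathbf J^{\lambda,\mu}_{\mathrm{orb}}\cong\check{\mathbf J}^{d-\lambda,\mu}_{\mathrm{orb}}$ over it; and for all $\lambda,\mu$ there is a unique linear isomorphism $H^{\lambda,\mu}_{\mathrm{orb}}(\mathsf T(\mathbf\Sigma,w_{\check\varphi})_0)\cong H^{d-\lambda,\mu}_{\mathrm{orb}}(\mathsf T(\check{\mathbf\Sigma},w_\varphi)_0)$ that is compatible with the maps induced in cohomology by these isomorphisms of sheaves, when $H^{\lambda,\mu}_{\mathrm{orb}}$ is identified with $\bigoplus_nH^n(\mathbf J_{\mathrm{orb}}^{\lambda,\mu-n})$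 by restriction to the strata $\mathsf T_{0,c}$ and projection to the components of the elements $g\in\mathrm{Box}^\circ(c)$. -/

import Mathlib

open CategoryTheory TensorProduct

namespace ClarkeDuality

noncomputable section

/-! ## Lattices and pairings -/

section Lattices

variable (L : Type) [AddCommGroup L]

/-- The canonical map `L → L_ℝ = ℝ ⊗ L`. -/
def toReal : L →ₗ[ℤ] ℝ ⊗[ℤ] L := TensorProduct.mk ℤ ℝ L 1

/-- The canonical map `L_ℝ → L_ℂ`. -/
def realToComplex : ℝ ⊗[ℤ] L →ₗ[ℝ] ℂ ⊗[ℤ] L :=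
  TensorProduct.AlgebraTensorModule.map (Algebra.linearMap ℝ ℂ) (LinearMap.id (R := ℤ) (M := L))

variable {L} {X Y : Type} [AddCommGroup X] [AddCommGroup Y]

/-- The extension of scalars `X_K × Y_K → K` of an integral pairing `X × Y → ℤ`. -/
def pairing (K : Type) [Field K] (p : X →ₗ[ℤ] Y →ₗ[ℤ] ℤ) :
    K ⊗[ℤ] X →ₗ[K] K ⊗[ℤ] Y →ₗ[K] K :=
  LinearMap.liftBaseChange K
    ((LinearMap.liftBaseChangeEquiv (R := ℤ) (M := Y) (N := K) K).toLinearMap.restrictScalars ℤ ∘ₗ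
      LinearMap.compRight ℤ (Algebra.linearMap ℤ K) ∘ₗ p)

lemma pairing_tmul (K : Type) [Field K] (p : X →ₗ[ℤ] Y →ₗ[ℤ] ℤ) (a b : K) (x : X) (y : Y) :
    pairing K p (a ⊗ₜ x) (b ⊗ₜ y) = a * b * (p x y : ℤ) := by
  simp [pairing, mul_assoc]

end Lattices

/-! ## Simplicial stacky fans -/

section Fans

variable {L : Type} [AddCommGroup L]

/-- A primitive lattice vector. -/
def IsPrimitive (v : L) : Prop := ∀ (k : ℤ) (w : L), v = k • w → IsUnit k

/-- The cone in `L_ℝ` generated by a set of lattice vectors. -/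
def coneOver (s : Set L) : PointedCone ℝ (ℝ ⊗[ℤ] L) := PointedCone.hull ℝ (toReal L '' s)

variable (L) in
/-- A (finite, nonempty) simplicial stacky fan in `L_ℝ`.  A simplicial cone is recorded by the set
of primitive integral generators of its rays; its faces correspond to the subsets of this set.
A positive integer `β ρ` is attached to each ray generator (the values of `β` at other vectors
play no role). -/
structure StackyFan where
  /-- the cones, as sets of primitive ray generators -/
  cones : Set (Finset L)
  finite : cones.Finite
  zero_mem : ∅ ∈ cones
  primitive : ∀ c ∈ cones, ∀ ρ ∈ c, IsPrimitive ρ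
  linearIndependent : ∀ c ∈ cones, LinearIndependent ℤ (fun ρ : c => (ρ : L))
  face_mem : ∀ c ∈ cones, ∀ c' ⊆ c, c' ∈ cones
  inter_eq : ∀ c ∈ cones, ∀ c' ∈ cones,
    (coneOver (c : Set L) : Set (ℝ ⊗[ℤ] L)) ∩ coneOver (c' : Set L) =
      coneOver ((c : Set L) ∩ (c' : Set L))
  /-- the stacky structure -/
  β : L → ℕ+

namespace StackyFan

variable (S : StackyFan L)

/-- The scaled ray generators `c[1] = {β_ρ ρ}` of a cone of the stacky fan. -/
def gens (c : Finset L) : Set L := (fun ρ => (S.β ρ : ℕ) • ρ) '' (c : Set L)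

/-- The set `𝚺[1]` of all scaled ray generators. -/
def rays : Set L := ⋃ c ∈ S.cones, S.gens c

/-- The support of the fan. -/
def support : Set (ℝ ⊗[ℤ] L) := ⋃ c ∈ S.cones, (coneOver (c : Set L) : Set (ℝ ⊗[ℤ] L))

/-- The simplex `Δ_c = Conv(c[1] ∪ {0})`. -/
def simplex (c : Finset L) : Set (ℝ ⊗[ℤ] L) :=
  convexHull ℝ (insert 0 (toReal L '' S.gens c))

/-- The stacky fan is convex: the union of the simplices `Δ_c` is a convex set
(hence a convex polytope). -/
def IsConvex : Prop := Convex ℝ (⋃ c ∈ S.cones, S.simplex c)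

/-- `φ` is a strictly convex fan-linear function on the support: for each maximal cone `c` there is
a linear function that agrees with `φ` on `c` and is strictly smaller than `φ` on the rest of the
support.  (So `φ` is linear on every cone, and it is the upper envelope of these linear
functions.) -/
def StrictlyConvex (φ : ℝ ⊗[ℤ] L → ℝ) : Prop :=
  ∀ c, Maximal (· ∈ S.cones) c → ∃ l : Module.Dual ℝ (ℝ ⊗[ℤ] L), ∀ v ∈ S.support,
    l v ≤ φ v ∧ (l v = φ v ↔ v ∈ coneOver (c : Set L))

/-- The fan is quasiprojective: there is a strictly convex fan-linear function with integral
values at the lattice points of the support. -/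
def IsQuasiprojective : Prop :=
  ∃ φ : ℝ ⊗[ℤ] L → ℝ, S.StrictlyConvex φ ∧
    ∀ m : L, toReal L m ∈ S.support → ∃ k : ℤ, φ (toReal L m) = k

end StackyFan

/-- Clarke dual pairs of stacky fans, with respect to a pairing of the lattices. -/
structure IsClarkeDual {M N : Type} [AddCommGroup M] [AddCommGroup N]
    (p : M →ₗ[ℤ] N →ₗ[ℤ] ℤ) (S : StackyFan M) (S' : StackyFan N) : Prop where
  quasiprojective_left : S.IsQuasiprojective
  quasiprojective_right : S'.IsQuasiprojective
  nonneg : ∀ m ∈ S.support, ∀ n ∈ S'.support, 0 ≤ pairing ℝ p m n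
  convex_left : S.IsConvex
  convex_right : S'.IsConvex

end Fans

/-! ## Box points and their ages -/

section Boxes

variable {L : Type} [AddCommGroup L]

/-- The elements of `Box(s)` together with their ages: the pairs `(g, ι(g))`, where `g = ∑ a_v v`
(`v ∈ s`, `a_v ∈ [0,1)`) is a lattice point and `ι(g) = ∑ a_v` is its age.  The coefficients are rational, which is automatic when `s` consists of
linearly independent lattice vectors. -/
def box (s : Set (ℝ ⊗[ℤ] L)) : Set (L × ℚ) :=
  {g | ∃ a : ℝ ⊗[ℤ] L →₀ ℚ, (a.support : Set (ℝ ⊗[ℤ] L)) ⊆ s ∧ (∀ v, 0 ≤ a v ∧ a v < 1) ∧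
    (a.sum fun v t => (t : ℝ) • v) = toReal L g.1 ∧ (a.sum fun _ t => t) = g.2}

/-- The same with all coefficients in the open interval `(0,1)`. -/
def boxInterior (s : Set (ℝ ⊗[ℤ] L)) : Set (L × ℚ) :=
  {g | ∃ a : ℝ ⊗[ℤ] L →₀ ℚ, (a.support : Set (ℝ ⊗[ℤ] L)) = s ∧ (∀ v, 0 ≤ a v ∧ a v < 1) ∧
    (a.sum fun v t => (t : ℝ) • v) = toReal L g.1 ∧ (a.sum fun _ t => t) = g.2}

lemma box_mono {s t : Set (ℝ ⊗[ℤ] L)} (h : s ⊆ t) : box s ⊆ box t := by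
  rintro g ⟨a, h1, h2⟩
  exact ⟨a, h1.trans h, h2⟩

lemma boxInterior_subset_box (s : Set (ℝ ⊗[ℤ] L)) : boxInterior s ⊆ box s := by
  rintro g ⟨a, h1, h2⟩
  exact ⟨a, h1.subset, h2⟩

/-- The twisted sectors of the toric stack of a stacky fan: a cone `c` together with an element `g`
of `Box°(c)` (recorded with its age). -/
structure StackyFan.Sector (S : StackyFan L) where
  cone : Finset L
  cone_mem : cone ∈ S.cones
  elt : L × ℚ
  elt_mem : elt ∈ boxInterior (toReal L '' S.gens cone)

/-- The age of a twisted sector. -/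
def StackyFan.Sector.age {S : StackyFan L} (s : S.Sector) : ℚ := s.elt.2

end Boxes

/-! ## Regular subdivisions and tropical complexes -/

section Tropical

variable {X Y : Type} [AddCommGroup X] [AddCommGroup Y]

/-- The set of monomials `m ∈ A` at which the tropical polynomial `min_m (⟨u, m⟩ + ν m)` attains its
value at the point `u ∈ X_ℝ`. -/
def minimizers (p : X →ₗ[ℤ] Y →ₗ[ℤ] ℤ) (A : Set Y) (ν : Y → ℝ) (u : ℝ ⊗[ℤ] X) : Set Y :=
  {m ∈ A | ∀ k ∈ A, pairing ℝ p u (toReal Y m) + ν m ≤ pairing ℝ p u (toReal Y k) + ν k}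

/-- The regular subdivision of `Conv A` dual to the polyhedral decomposition of `X_ℝ` given by the
tropical polynomial: its cells are the convex hulls of the sets of minimizers. -/
def subdivision (p : X →ₗ[ℤ] Y →ₗ[ℤ] ℤ) (A : Set Y) (ν : Y → ℝ) : Set (Set (ℝ ⊗[ℤ] Y)) :=
  {τ | ∃ u : ℝ ⊗[ℤ] X, τ = convexHull ℝ (toReal Y '' minimizers p A ν u)}

/-- Faces of a polytope. -/
def IsFace {V : Type} [AddCommGroup V] [Module ℝ V] (Δ f : Set V) : Prop :=
  ∃ l : Module.Dual ℝ V, f = {v ∈ Δ | ∀ w ∈ Δ, l v ≤ l w}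

/-- The minimal face of `Δ` that contains `τ`. -/
def minimalFace {V : Type} [AddCommGroup V] [Module ℝ V] (Δ τ : Set V) : Set V :=
  ⋂₀ {f | IsFace Δ f ∧ τ ⊆ f}

/-- The (inward) normal cone of a face `f` of `Δ ⊆ Y_ℝ`. -/
def normalCone (p : X →ₗ[ℤ] Y →ₗ[ℤ] ℤ) (Δ f : Set (ℝ ⊗[ℤ] Y)) : Set (ℝ ⊗[ℤ] X) :=
  {u | ∀ v ∈ f, ∀ w ∈ Δ, pairing ℝ p u v ≤ pairing ℝ p u w}

/-- The cells of the tropical complex `𝖳(𝚺, w)₀`: pairs `(c, τ)` of a cone `c` of the fan and a cell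
`τ` of the regular subdivision with `0 ∈ τ`, such that `c` is contained in the normal cone of the
minimal face of the Newton polytope that contains `τ`. -/
@[ext]
structure TropCell (p : X →ₗ[ℤ] Y →ₗ[ℤ] ℤ) (S : StackyFan X) (A : Set Y) (ν : Y → ℝ) where
  cone : Finset X
  cone_mem : cone ∈ S.cones
  simplex : Set (ℝ ⊗[ℤ] Y)
  simplex_mem : simplex ∈ subdivision p A ν
  zero_mem : 0 ∈ simplex
  cone_subset : (coneOver (cone : Set X) : Set (ℝ ⊗[ℤ] X)) ⊆
    normalCone p (convexHull ℝ (toReal Y '' A)) (minimalFace (convexHull ℝ (toReal Y '' A)) simplex)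

variable {p : X →ₗ[ℤ] Y →ₗ[ℤ] ℤ} {S : StackyFan X} {A : Set Y} {ν : Y → ℝ}

/-- The face order: `(c, τ) ≼ (c', τ')` if and only if `c' ⊆ c` and `τ' ⊆ τ`. -/
instance : PartialOrder (TropCell p S A ν) where
  le x y := y.cone ⊆ x.cone ∧ y.simplex ⊆ x.simplex
  le_refl _ := ⟨subset_rfl, subset_rfl⟩
  le_trans _ _ _ h h' := ⟨h'.1.trans h.1, h'.2.trans h.2⟩
  le_antisymm _ _ h h' := TropCell.ext (h'.1.antisymm h.1) (h'.2.antisymm h.2)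

/-- The generators of the stacky cone over the simplex `τ`: the nonzero vertices of `τ`. -/
def TropCell.vertices (x : TropCell p S A ν) : Set (ℝ ⊗[ℤ] Y) := x.simplex.extremePoints ℝ \ {0}

/-- The generators of the cone `c` of a cell `(c, τ)`, scaled by the stacky structure. -/
def TropCell.gens (x : TropCell p S A ν) : Set (ℝ ⊗[ℤ] X) := toReal X '' S.gens x.cone

lemma mem_convexHull_inter {V : Type} [AddCommGroup V] [Module ℝ V] (s : Set V)
    (l : Module.Dual ℝ V) (r : ℝ) (hs : ∀ v ∈ s, r ≤ l v) (v : V) (hv : v ∈ convexHull ℝ s)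
    (h : l v = r) : v ∈ convexHull ℝ {w ∈ s | l w = r} := by
  have key : convexHull ℝ s ⊆ {w | r ≤ l w ∧ (l w = r → w ∈ convexHull ℝ {w ∈ s | l w = r})} := by
    refine convexHull_min (fun w hw => ⟨hs w hw, fun h => subset_convexHull ℝ _ ⟨hw, h⟩⟩) ?_
    intro w hw w' hw' a b ha hb hab
    simp only [Set.mem_ofPred_eq, map_add, map_smul, smul_eq_mul] at *
    have h0 : r = a * r + b * r := by rw [← add_mul, hab, one_mul]
    have h1 := mul_le_mul_of_nonneg_left hw.1 ha
    have h2 := mul_le_mul_of_nonneg_left hw'.1 hb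
    refine ⟨by linarith, fun he => ?_⟩
    rcases ha.eq_or_lt with rfl | ha'
    · obtain rfl : b = 1 := by linarith
      simp only [zero_mul, one_mul, zero_add, zero_smul, one_smul] at *
      exact hw'.2 he
    rcases hb.eq_or_lt with rfl | hb'
    · obtain rfl : a = 1 := by linarith
      simp only [zero_mul, one_mul, add_zero, zero_smul, one_smul] at *
      exact hw.2 he
    have h3 : l w = r := mul_left_cancel₀ ha'.ne' (by linarith)
    have h4 : l w' = r := mul_left_cancel₀ hb'.ne' (by linarith)
    exact convex_convexHull ℝ _ (hw.2 h3) (hw'.2 h4) ha hb hab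
  exact (key hv).2 h

lemma extremePoints_subset_of_mem_subdivision {τ τ' : Set (ℝ ⊗[ℤ] Y)}
    (hτ : τ ∈ subdivision p A ν) (hτ' : τ' ∈ subdivision p A ν) (h : τ' ⊆ τ) :
    τ'.extremePoints ℝ ⊆ τ.extremePoints ℝ := by
  obtain ⟨u, hu⟩ := hτ
  obtain ⟨u', hu'⟩ := hτ'
  intro z hz
  have hz' : z ∈ τ' := hz.1
  obtain ⟨m', hm'⟩ : (minimizers p A ν u').Nonempty := by
    rw [hu'] at hz'
    simpa using (convexHull_nonempty_iff (𝕜 := ℝ)).1 ⟨z, hz'⟩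
  obtain ⟨m, hm⟩ : (minimizers p A ν u).Nonempty := by
    have := h hz'
    rw [hu] at this
    simpa using (convexHull_nonempty_iff (𝕜 := ℝ)).1 ⟨z, this⟩
  -- the difference of the two supporting affine functions
  set l : Module.Dual ℝ (ℝ ⊗[ℤ] Y) := pairing ℝ p u' - pairing ℝ p u with hl
  set r : ℝ := (pairing ℝ p u' (toReal Y m') + ν m') - (pairing ℝ p u (toReal Y m) + ν m) with hr
  have h1 : ∀ v ∈ toReal Y '' minimizers p A ν u, r ≤ l v := by
    rintro _ ⟨k, hk, rfl⟩
    have e1 := hm.2 k hk.1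
    have e2 := hk.2 m hm.1
    have e3 := hm'.2 k hk.1
    simp only [hl, hr, LinearMap.sub_apply]
    linarith
  have h2 : ∀ v ∈ toReal Y '' minimizers p A ν u', l v ≤ r := by
    rintro _ ⟨k, hk, rfl⟩
    have e1 := hm'.2 k hk.1
    have e2 := hk.2 m' hm'.1
    have e3 := hm.2 k hk.1
    simp only [hl, hr, LinearMap.sub_apply]
    linarith
  have h1' : ∀ v ∈ τ, r ≤ l v := by
    rw [hu]
    exact fun v hv => convexHull_min h1 (convex_halfSpace_ge l.isLinear r) hv
  have h2' : ∀ v ∈ τ', l v ≤ r := by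
    rw [hu']
    exact fun v hv => convexHull_min h2 (convex_halfSpace_le l.isLinear r) hv
  have h3 : ∀ v ∈ τ, l v = r → v ∈ τ' := by
    intro v hv he
    rw [hu] at hv
    have := mem_convexHull_inter _ l r h1 v hv he
    rw [hu']
    refine convexHull_mono ?_ this
    rintro _ ⟨⟨k, hk, rfl⟩, hke⟩
    refine ⟨k, ⟨hk.1, fun k' hk' => ?_⟩, rfl⟩
    have e1 := hm.2 k hk.1
    have e2 := hk.2 m hm.1
    have e3 := hm'.2 k' hk'
    simp only [hl, hr, LinearMap.sub_apply] at hke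
    linarith
  refine IsExtreme.extremePoints_subset_extremePoints (𝕜 := ℝ) ?_ hz
  refine ⟨h, ?_⟩
  intro v hv w hw y hy hyo
  obtain ⟨a, b, ha, hb, hab, rfl⟩ := hyo
  have e1 := h1' v hv
  have e2 := h1' w hw
  have e3 := h2' _ hy
  simp only [map_add, map_smul, smul_eq_mul] at e3
  have h0 : r = a * r + b * r := by rw [← add_mul, hab, one_mul]
  have f1 := mul_le_mul_of_nonneg_left e1 ha.le
  have f2 := mul_le_mul_of_nonneg_left e2 hb.le
  exact h3 v hv (mul_left_cancel₀ ha.ne' (by linarith))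

lemma TropCell.vertices_subset {x y : TropCell p S A ν} (h : x ≤ y) : y.vertices ⊆ x.vertices :=
  fun _ hv =>
    ⟨extremePoints_subset_of_mem_subdivision x.simplex_mem y.simplex_mem h.2 hv.1, hv.2⟩

lemma TropCell.gens_subset {x y : TropCell p S A ν} (h : x ≤ y) : y.gens ⊆ x.gens :=
  Set.image_mono (Set.image_mono (by exact_mod_cast h.1))

end Tropical

/-! ## Subspaces of exterior algebras -/

section Exterior

variable {V : Type} [AddCommGroup V] [Module ℂ V]

/-- The subspace `⋀ⁿ W` of the exterior algebra of `V`, for a subspace `W ⊆ V`. -/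
def wedgePow (W : Submodule ℂ V) (n : ℕ) : Submodule ℂ (ExteriorAlgebra ℂ V) :=
  W.map (ExteriorAlgebra.ι ℂ) ^ n

lemma wedgePow_mono {W W' : Submodule ℂ V} (h : W ≤ W') (n : ℕ) : wedgePow W n ≤ wedgePow W' n :=
  pow_le_pow_left' (Submodule.map_mono h) n

lemma wedgePow_eq_bot (W : Submodule ℂ V) [Module.Finite ℂ W] {n : ℕ}
    (h : Module.finrank ℂ W < n) : wedgePow W n = ⊥ := by
  have h1 : wedgePow W n =
      (LinearMap.range (ExteriorAlgebra.ι ℂ (M := W)) ^ n).map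
        (ExteriorAlgebra.map W.subtype).toLinearMap := by
    rw [Submodule.map_pow, wedgePow, LinearMap.range_eq_map, ← Submodule.map_comp]
    congr 1
    ext x
    simp
  have h2 : LinearMap.range (ExteriorAlgebra.ι ℂ (M := W)) ^ n = ⊥ := by
    change ⋀[ℂ]^n W = ⊥
    rw [← ExteriorAlgebra.ιMulti_span_fixedDegree,
      Submodule.span_eq_bot]
    rintro _ ⟨v, rfl⟩
    refine AlternatingMap.map_linearDependent _ v fun hv => ?_
    have := hv.fintype_card_le_finrank
    simp at this
    omega
  rw [h1, h2, Submodule.map_bot]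

lemma wedge_comm_le (W W' : Submodule ℂ V) :
    W.map (ExteriorAlgebra.ι ℂ) * W'.map (ExteriorAlgebra.ι ℂ) ≤
      W'.map (ExteriorAlgebra.ι ℂ) * W.map (ExteriorAlgebra.ι ℂ) := by
  rw [Submodule.mul_le]
  rintro _ ⟨v, hv, rfl⟩ _ ⟨w, hw, rfl⟩
  rw [show ExteriorAlgebra.ι ℂ v * ExteriorAlgebra.ι ℂ w =
    -(ExteriorAlgebra.ι ℂ w * ExteriorAlgebra.ι ℂ v) from
    eq_neg_of_add_eq_zero_left (ExteriorAlgebra.ι_add_mul_swap v w)]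
  exact Submodule.neg_mem _ (Submodule.mul_mem_mul ⟨w, hw, rfl⟩ ⟨v, hv, rfl⟩)

lemma wedgePow_sup_le (W W' : Submodule ℂ V) (n : ℕ) :
    wedgePow (W ⊔ W') n ≤ ⨆ i : Fin (n + 1), wedgePow W i * wedgePow W' (n - i) := by
  have hc : W'.map (ExteriorAlgebra.ι ℂ) * W.map (ExteriorAlgebra.ι ℂ) =
      W.map (ExteriorAlgebra.ι ℂ) * W'.map (ExteriorAlgebra.ι ℂ) :=
    (wedge_comm_le _ _).antisymm (wedge_comm_le _ _)
  have hc' : ∀ i, W'.map (ExteriorAlgebra.ι ℂ) * wedgePow W i =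
      wedgePow W i * W'.map (ExteriorAlgebra.ι ℂ) := fun i =>
    (Commute.pow_right (show Commute _ _ from hc) i)
  induction n with
  | zero => simp [wedgePow]
  | succ n ih =>
    have : wedgePow (W ⊔ W') (n + 1) =
        (W.map (ExteriorAlgebra.ι ℂ) ⊔ W'.map (ExteriorAlgebra.ι ℂ)) * wedgePow (W ⊔ W') n := by
      rw [wedgePow, pow_succ', ← wedgePow, Submodule.map_sup]
    rw [this]
    refine (mul_le_mul_right ih _).trans ?_
    rw [Submodule.mul_iSup, iSup_le_iff]
    intro i
    rw [Submodule.sup_mul, sup_le_iff]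
    constructor
    · refine le_trans ?_ (le_iSup _ i.succ)
      rw [← mul_assoc, wedgePow, ← pow_succ']
      simp [wedgePow]
    · refine le_trans ?_ (le_iSup _ i.castSucc)
      rw [← mul_assoc, hc', mul_assoc, wedgePow, wedgePow, ← pow_succ']
      have : n - (i : ℕ) + 1 = n + 1 - i := by omega
      simp [wedgePow, this]

lemma wedgePow_top_le {U U' : Submodule ℂ V} [Module.Finite ℂ U] (h : U' ≤ U) :
    wedgePow U (Module.finrank ℂ U) ≤
      wedgePow U (Module.finrank ℂ U - Module.finrank ℂ U') *
        wedgePow U' (Module.finrank ℂ U') := by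
  have : Module.Finite ℂ U' := Submodule.finiteDimensional_of_le h
  obtain ⟨C, hC⟩ := exists_isCompl (U'.submoduleOf U)
  set D : Submodule ℂ V := C.map U.subtype
  have hD : D ≤ U := Submodule.map_subtype_le _ _
  have : Module.Finite ℂ D := Submodule.finiteDimensional_of_le hD
  have hsup : D ⊔ U' = U := by
    have := congrArg (Submodule.map U.subtype) hC.symm.sup_eq_top
    rwa [Submodule.map_sup, Submodule.submoduleOf, Submodule.map_comap_subtype, inf_eq_right.2 h,
      Submodule.map_top, Submodule.range_subtype] at this
  have hrank : Module.finrank ℂ U' + Module.finrank ℂ D = Module.finrank ℂ U := by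
    rw [← Submodule.finrank_add_eq_of_isCompl hC]
    congr 1
    · exact (LinearEquiv.finrank_eq (Submodule.submoduleOfEquivOfLe h)).symm
    · exact (Submodule.equivMapOfInjective _ U.subtype_injective C).finrank_eq.symm
  have key := wedgePow_sup_le D U' (Module.finrank ℂ U)
  rw [hsup] at key
  refine key.trans (iSup_le fun i => ?_)
  rcases lt_trichotomy (Module.finrank ℂ D) (i : ℕ) with hi | hi | hi
  · rw [wedgePow_eq_bot D hi, Submodule.bot_mul]; exact bot_le
  · rw [← hi]
    have e1 : Module.finrank ℂ U - Module.finrank ℂ U' = Module.finrank ℂ D := by omega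
    have e2 : Module.finrank ℂ U - Module.finrank ℂ D = Module.finrank ℂ U' := by omega
    rw [e1, e2]
    exact mul_le_mul_left (wedgePow_mono hD _) _
  · rw [wedgePow_eq_bot U', Submodule.mul_bot]
    · exact bot_le
    · omega

end Exterior

/-! ## Sheaves on finite posets and their cohomology

A sheaf on a poset `P` with the Alexandrov topology (the open sets are the upper sets, for instance
the open stars `{y | x ≤ y}`) is the same as a functor on `P`.  Its cohomology groups, the derived
functors of the global sections, are the groups `Ext^n(ℂ, F)` out of the constant sheaf. -/

section Cohomology

variable (P : Type) [PartialOrder P]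

/-- The category of sheaves of complex vector spaces on a poset. -/
abbrev PosetSheaf := P ⥤ ModuleCat.{0} ℂ

instance : HasSeparator (PosetSheaf P) :=
  HasSeparator.of_equivalence ((opOpEquivalence P).symm.congrLeft (E := ModuleCat.{0} ℂ)).symm

instance : AB5OfSize.{0, 0} (PosetSheaf P) := ⟨fun _ _ _ => inferInstance⟩

instance : IsGrothendieckAbelian.{0} (PosetSheaf P) where

instance : HasExt.{0} (PosetSheaf P) := IsGrothendieckAbelian.hasExt (PosetSheaf P)

/-- The constant sheaf. -/
def constSheaf : PosetSheaf P := (Functor.const P).obj (ModuleCat.of ℂ ℂ)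

variable {P}

/-- The cohomology of a sheaf on a poset. -/
abbrev H (F : PosetSheaf P) (n : ℕ) : Type := Abelian.Ext (constSheaf P) F n

/-- The map on cohomology induced by a morphism of sheaves. -/
def H.map {F G : PosetSheaf P} (f : F ⟶ G) {n : ℕ} (x : H F n) : H G n :=
  x.comp (Abelian.Ext.mk₀ f) (add_zero n)

variable {Q : Type} [PartialOrder Q]

/-- The inverse image of a sheaf along a monotone map. -/
abbrev pullback (i : Q →o P) (F : PosetSheaf P) : PosetSheaf Q := i.monotone.functor ⋙ F

/-- The map on cohomology induced by the inverse image. -/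
def H.pullback (i : Q →o P) {F : PosetSheaf P} {n : ℕ} (x : H F n) :
    H (ClarkeDuality.pullback i F) n :=
  x.mapExactFunctor ((Functor.whiskeringLeft Q P (ModuleCat.{0} ℂ)).obj i.monotone.functor)

/-- For a set `S` of indices and subspaces `E i ⊆ W`, the direct sum of the spaces `E i` with
`i ∈ S`, realized as the space of finitely supported families. -/
def maskedSum {I W : Type} [AddCommGroup W] [Module ℂ W] (S : Set I) (E : I → Submodule ℂ W) :
    Submodule ℂ (I →₀ W) where
  carrier := {f | ∀ i, f i ∈ E i ∧ (i ∉ S → f i = 0)}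
  add_mem' hf hg i :=
    ⟨(E i).add_mem (hf i).1 (hg i).1, fun h => by simp [(hf i).2 h, (hg i).2 h]⟩
  zero_mem' i := ⟨(E i).zero_mem, fun _ => rfl⟩
  smul_mem' a f hf i := ⟨(E i).smul_mem a (hf i).1, fun h => by simp [(hf i).2 h]⟩

open Classical in
/-- The map that kills the summands with index outside of `T ⊆ S`, and is the inclusion
`E i ⊆ F i` on the other ones. -/
def maskedMap {I W : Type} [AddCommGroup W] [Module ℂ W] {S T : Set I} {E F : I → Submodule ℂ W}
    (h : ∀ i, E i ≤ F i) : maskedSum S E →ₗ[ℂ] maskedSum T F where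
  toFun f := ⟨f.1.filter (· ∈ T), fun i => by
    by_cases hi : i ∈ T
    · simpa [hi] using h i (f.2 i).1
    · simp [hi]⟩
  map_add' f g := Subtype.ext Finsupp.filter_add
  map_smul' a f := Subtype.ext Finsupp.filter_smul

lemma maskedMap_of_mem {I W : Type} [AddCommGroup W] [Module ℂ W] {S T : Set I}
    {E F : I → Submodule ℂ W} (h : ∀ i, E i ≤ F i) (f : maskedSum S E) {i : I} (hi : i ∈ T) :
    (maskedMap h f : maskedSum T F).1 i = f.1 i := by
  simp [maskedMap, hi]

lemma maskedMap_of_notMem {I W : Type} [AddCommGroup W] [Module ℂ W] {S T : Set I}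
    {E F : I → Submodule ℂ W} (h : ∀ i, E i ≤ F i) (f : maskedSum S E) {i : I} (hi : i ∉ T) :
    (maskedMap h f : maskedSum T F).1 i = 0 := by
  simp [maskedMap, hi]

/-- The sheaf `x ↦ ⨁ (i ∈ S x), E x i`, for sets `S x` decreasing in `x` and subspaces `E x i`
increasing in `x`. -/
def maskedSheaf {I W : Type} [AddCommGroup W] [Module ℂ W] (S : P → Set I)
    (E : P → I → Submodule ℂ W) (hS : ∀ x y, x ≤ y → S y ⊆ S x)
    (hE : ∀ x y, x ≤ y → ∀ i, E x i ≤ E y i) : PosetSheaf P where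
  obj x := ModuleCat.of ℂ (maskedSum (S x) (E x))
  map {x y} h := ModuleCat.ofHom (maskedMap (hE x y (leOfHom h)))
  map_id x := by
    refine ModuleCat.hom_ext (LinearMap.ext fun f => ?_)
    refine Subtype.ext (Finsupp.ext fun i => ?_)
    by_cases hi : i ∈ S x
    · simp [maskedMap, hi]
    · simp [maskedMap, hi, (f.2 i).2 hi]
  map_comp {x y z} h h' := by
    refine ModuleCat.hom_ext (LinearMap.ext fun f => ?_)
    refine Subtype.ext (Finsupp.ext fun i => ?_)
    by_cases hi : i ∈ S z
    · simp [maskedMap, hi, hS y z (leOfHom h') hi]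
    · simp [maskedMap, hi]

/-- The map that takes the components of a family with indices in the image of an injective map
`j` of index sets. -/
def maskedProjMap {I I' W : Type} [AddCommGroup W] [Module ℂ W] {S : Set I} {S' : Set I'}
    {E : I → Submodule ℂ W} {E' : I' → Submodule ℂ W} (j : I' → I) (hj : j.Injective)
    (h : ∀ i, i ∈ S' ↔ j i ∈ S) (h' : ∀ i ∈ S', E (j i) ≤ E' i) :
    maskedSum S E →ₗ[ℂ] maskedSum S' E' where
  toFun f := ⟨f.1.comapDomain j hj.injOn, fun i => by
    by_cases hi : i ∈ S'
    · exact ⟨h' i hi (f.2 (j i)).1, fun hi' => absurd hi hi'⟩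
    · have h0 : f.1 (j i) = 0 := (f.2 (j i)).2 fun hi' => hi ((h i).2 hi')
      simp [h0]⟩
  map_add' _ _ := Subtype.ext (Finsupp.ext fun _ => rfl)
  map_smul' _ _ := Subtype.ext (Finsupp.ext fun _ => rfl)

/-- The same as a morphism of sheaves, after an inverse image along `k`. -/
def maskedProj (k : Q →o P) {I I' W : Type} [AddCommGroup W] [Module ℂ W] {S : P → Set I}
    {S' : P → Set I'} {E : P → I → Submodule ℂ W} {E' : P → I' → Submodule ℂ W}
    {hS : ∀ x y, x ≤ y → S y ⊆ S x} {hE : ∀ x y, x ≤ y → ∀ i, E x i ≤ E y i}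
    {hS' : ∀ x y, x ≤ y → S' y ⊆ S' x} {hE' : ∀ x y, x ≤ y → ∀ i, E' x i ≤ E' y i}
    (j : I' → I) (hj : j.Injective) (h : ∀ x i, i ∈ S' (k x) ↔ j i ∈ S (k x))
    (h' : ∀ x, ∀ i ∈ S' (k x), E (k x) (j i) ≤ E' (k x) i) :
    pullback k (maskedSheaf S E hS hE) ⟶ pullback k (maskedSheaf S' E' hS' hE') where
  app x := ModuleCat.ofHom (maskedProjMap (S := S (k x)) (S' := S' (k x)) j hj (h x) (h' x))
  naturality x y l := by
    have hl : k x ≤ k y := k.monotone (leOfHom l)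
    refine ModuleCat.hom_ext (LinearMap.ext fun (f : maskedSum (S (k x)) (E (k x))) =>
      Subtype.ext (Finsupp.ext fun i => ?_))
    by_cases hi : i ∈ S' (k y)
    · exact (maskedMap_of_mem (hE _ _ hl) f ((h y i).1 hi)).trans
        (maskedMap_of_mem (S := S' (k x)) (hE' _ _ hl)
          (maskedProjMap (S := S (k x)) j hj (h x) (h' x) f) hi).symm
    · exact (maskedMap_of_notMem (hE _ _ hl) f (mt (h y i).2 hi)).trans
        (maskedMap_of_notMem (S := S' (k x)) (hE' _ _ hl)
          (maskedProjMap (S := S (k x)) j hj (h x) (h' x) f) hi).symm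

end Cohomology

/-! ## The tropical Jacobian sheaves -/

section Jacobian

variable {X Y : Type} [AddCommGroup X] [AddCommGroup Y]
  (p : X →ₗ[ℤ] Y →ₗ[ℤ] ℤ) (S : StackyFan X) (A : Set Y) (ν : Y → ℝ)

variable {p S A ν} in
/-- The subspace `c^⊥ ⊆ Y_ℂ` for a cell `(c, τ)`. -/
def TropCell.perp (x : TropCell p S A ν) : Submodule ℂ (ℂ ⊗[ℤ] Y) :=
  ⨅ ρ ∈ x.cone, LinearMap.ker (pairing ℂ p (1 ⊗ₜ ρ))

variable {p S A ν} in
/-- The subspace `L(τ) ⊆ Y_ℂ` spanned by `τ` (recall that `0 ∈ τ`) for a cell `(c, τ)`. -/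
def TropCell.lin (x : TropCell p S A ν) : Submodule ℂ (ℂ ⊗[ℤ] Y) :=
  Submodule.span ℂ (realToComplex Y '' x.simplex)

variable {p S A ν} in
/-- The space `⋀^(k - dim τ) c^⊥ ∧ Vol(L(τ))` for a cell `(c, τ)`, as a subspace of the exterior
algebra of `Y_ℂ`; here `Vol(L(τ))` is a generator of the line `⋀^(dim τ) L(τ)`.  The index `k` is a
rational number, and the space is zero unless `k - dim τ` is a nonnegative integer. -/
def TropCell.forms (x : TropCell p S A ν) (k : ℚ) :
    Submodule ℂ (ExteriorAlgebra ℂ (ℂ ⊗[ℤ] Y)) :=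
  ⨆ (j : ℕ) (_ : (j : ℚ) + Module.finrank ℂ x.lin = k),
    wedgePow x.perp j * wedgePow x.lin (Module.finrank ℂ x.lin)

lemma pairing_realToComplex (ρ : X) (v : ℝ ⊗[ℤ] Y) :
    pairing ℂ p (1 ⊗ₜ ρ) (realToComplex Y v) = ((pairing ℝ p (toReal X ρ) v : ℝ) : ℂ) := by
  induction v with
  | zero => simp
  | add v w hv hw => simp [hv, hw]
  | tmul a y =>
    rw [show toReal X ρ = 1 ⊗ₜ ρ from rfl, pairing_tmul]
    simp [realToComplex, pairing_tmul]

variable {p S A ν}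

lemma TropCell.lin_le_perp (x : TropCell p S A ν) : x.lin ≤ x.perp := by
  rw [TropCell.lin, Submodule.span_le]
  rintro _ ⟨v, hv, rfl⟩
  simp only [TropCell.perp, SetLike.mem_coe, Submodule.mem_iInf, LinearMap.mem_ker]
  intro ρ hρ
  rw [pairing_realToComplex]
  have h1 : x.simplex ⊆ minimalFace (convexHull ℝ (toReal Y '' A)) x.simplex :=
    Set.subset_sInter fun f hf => hf.2
  have h2 : x.simplex ⊆ convexHull ℝ (toReal Y '' A) := by
    obtain ⟨u, hu⟩ := x.simplex_mem
    rw [hu]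
    exact convexHull_mono (Set.image_mono fun m hm => hm.1)
  have h3 := x.cone_subset (Submodule.subset_span ⟨ρ, hρ, rfl⟩ :
    toReal X ρ ∈ coneOver (x.cone : Set X))
  have h4 := h3 v (h1 hv) 0 (h2 x.zero_mem)
  have h5 := h3 0 (h1 x.zero_mem) v (h2 hv)
  rw [map_zero] at h4 h5
  rw [le_antisymm h4 h5, Complex.ofReal_zero]

lemma TropCell.perp_mono {x y : TropCell p S A ν} (h : x ≤ y) : x.perp ≤ y.perp :=
  biInf_mono fun _ hρ => h.1 hρ

lemma TropCell.lin_anti {x y : TropCell p S A ν} (h : x ≤ y) : y.lin ≤ x.lin :=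
  Submodule.span_mono (Set.image_mono h.2)

lemma TropCell.forms_mono [Module.Finite ℤ Y] {x y : TropCell p S A ν} (h : x ≤ y) (k : ℚ) :
    x.forms k ≤ y.forms k := by
  refine iSup₂_le fun j hj => ?_
  have hle : Module.finrank ℂ y.lin ≤ Module.finrank ℂ x.lin :=
    Submodule.finrank_mono (lin_anti h)
  refine le_trans ?_ (le_iSup₂ (j + (Module.finrank ℂ x.lin - Module.finrank ℂ y.lin)) ?_)
  · calc wedgePow x.perp j * wedgePow x.lin (Module.finrank ℂ x.lin)
        ≤ wedgePow y.perp j *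
          (wedgePow y.perp (Module.finrank ℂ x.lin - Module.finrank ℂ y.lin) *
            wedgePow y.lin (Module.finrank ℂ y.lin)) := by
          refine mul_le_mul' (wedgePow_mono (perp_mono h) _) ((wedgePow_top_le (lin_anti h)).trans ?_)
          exact mul_le_mul_left (wedgePow_mono (x.lin_le_perp.trans (perp_mono h)) _) _
      _ = _ := by rw [← mul_assoc]; simp only [wedgePow, pow_add]
  · rw [← hj]
    push_cast [Nat.cast_sub hle]
    ring

variable (p S A ν) [Module.Finite ℤ Y]

/-- The bigraded piece `J^{λ,μ}(c, τ) = B_τ^μ ⊗ (⋀^(λ + μ - dim τ) c^⊥ ∧ Vol(L(τ)))` of the tropical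
Jacobian sheaf, where `B_τ^μ` has as a basis the elements of `Box(τ)` of age `μ`. -/
def J (lam mu : ℚ) : PosetSheaf (TropCell p S A ν) :=
  maskedSheaf (fun x => {b | b ∈ box x.vertices ∧ b.2 = mu}) (fun x _ => x.forms (lam + mu))
    (fun _ _ h _ hb => ⟨box_mono (TropCell.vertices_subset h) hb.1, hb.2⟩)
    (fun _ _ h _ => TropCell.forms_mono h _)

/-- The bigraded piece
`J_orb^{λ,μ}(c, τ) = ⨁ (k - m + ℓ = λ, ℓ + m = μ), B_c^ℓ ⊗ B_τ^m ⊗ (⋀^(k - dim τ) c^⊥ ∧ Vol(L(τ)))`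
of the orbifold tropical Jacobian sheaf. -/
def Jorb (lam mu : ℚ) : PosetSheaf (TropCell p S A ν) :=
  maskedSheaf (I := (X × ℚ) × (Y × ℚ))
    (fun x => {g | g.1 ∈ box x.gens ∧ g.2 ∈ box x.vertices ∧ g.1.2 + g.2.2 = mu})
    (fun x g => x.forms (lam + g.2.2 - g.1.2))
    (fun _ _ h _ hg => ⟨box_mono (TropCell.gens_subset h) hg.1,
      box_mono (TropCell.vertices_subset h) hg.2.1, hg.2.2⟩)
    (fun _ _ h _ => TropCell.forms_mono h _)

/-- The closed stratum `𝖳(𝚺, w)_{0,c}` of a cone `c`: the cells `(c', τ)` with `c ⊆ c'`. -/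
abbrev Stratum (c : Finset X) := {x : TropCell p S A ν // c ⊆ x.cone}

/-- The inclusion of a stratum. -/
def Stratum.incl (c : Finset X) : Stratum p S A ν c →o TropCell p S A ν := OrderHom.Subtype.val _

/-- The tropical Hodge space `H^{λ,μ}(𝖳(𝚺, w)_{0,c}) = ⨁ n, H^n(𝖳(𝚺, w)_{0,c}, J_c^{λ,μ-n})` of a
stratum. -/
abbrev HodgeStratum (c : Finset X) (lam mu : ℚ) : Type :=
  DirectSum ℕ fun n => H (pullback (Stratum.incl p S A ν c) (J p S A ν lam (mu - n))) n

/-- The orbifold tropical Hodge space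
`H_orb^{λ,μ} = ⨁ c, ⨁ (g ∈ Box°(c)), H^{λ-ι(g),μ-ι(g)}(𝖳(𝚺, w)_{0,c})`. -/
abbrev OrbHodge (lam mu : ℚ) : Type :=
  DirectSum S.Sector fun s => HodgeStratum p S A ν s.cone (lam - s.age) (mu - s.age)

/-- The projection from the restriction of `J_orb` to the stratum of a twisted sector `(c, g)` to the
sheaf `J_c` (with the degrees shifted by the age), which takes the `g`-component. -/
def sectorProj (s : S.Sector) (lam mu mu' : ℚ) (h' : mu' + s.age = mu) :
    pullback (Stratum.incl p S A ν s.cone) (Jorb p S A ν lam mu) ⟶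
      pullback (Stratum.incl p S A ν s.cone) (J p S A ν (lam - s.age) mu') :=
  maskedProj (Stratum.incl p S A ν s.cone) (Prod.mk s.elt) (Prod.mk_right_injective s.elt)
    (fun x b => by
      have hg : s.elt ∈ box x.1.gens :=
        box_mono (Set.image_mono (Set.image_mono (by exact_mod_cast x.2)))
          (boxInterior_subset_box _ s.elt_mem)
      have hb : b.2 = mu' ↔ s.elt.2 + b.2 = mu := by
        rw [← h', StackyFan.Sector.age, add_comm, add_left_inj]
      exact ⟨fun hb' => ⟨hg, hb'.1, hb.1 hb'.2⟩, fun hb' => ⟨hb'.2.1, hb.2 hb'.2.2⟩⟩)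
    (fun x b hb => by
      have e : lam + b.2 - s.elt.2 = lam - s.age + mu' := by
        rw [hb.2, StackyFan.Sector.age]; ring
      exact (congrArg x.1.forms e).le)

variable {p S A ν} in
/-- The identification of the orbifold tropical Hodge space `H_orb^{λ,μ}` with
`⨁ n, H^n(𝖳(𝚺, w)₀, J_orb^{λ,μ-n})`: the element `z` of the former corresponds to the family `x`
if its component in each twisted sector `(c, g)` and each degree `n` is the image of `x n` under
restriction to the stratum of `c` and projection to the `g`-component. -/
def Corresponds {lam mu : ℚ} (z : OrbHodge p S A ν lam mu)
    (x : ∀ n : ℕ, H (Jorb p S A ν lam (mu - n)) n) : Prop :=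
  ∀ (s : S.Sector) (n : ℕ),
    (z s) n = H.map (sectorProj p S A ν s lam (mu - n) (mu - s.age - n) (by ring))
      (H.pullback (Stratum.incl p S A ν s.cone) (x n))

end Jacobian

/-! ## Clarke duality -/

section Duality

variable {X Y : Type} [AddCommGroup X] [AddCommGroup Y]

/-- The poset `𝖳(𝚺, w_ψ)₀`, where the tropicalization of `w_ψ` is `min_m (⟨u, m⟩ + ψ m)`, with `m`
ranging over `0` and the scaled ray generators of the second fan. -/
abbrev Trop (p : X →ₗ[ℤ] Y →ₗ[ℤ] ℤ) (S : StackyFan X) (S' : StackyFan Y)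
    (ψ : ℝ ⊗[ℤ] Y → ℝ) : Type :=
  TropCell p S (insert 0 S'.rays) fun m => ψ (toReal Y m)

/-- The orbifold tropical Jacobian sheaf `J_orb^{λ,μ}` on `𝖳(𝚺, w_ψ)₀`. -/
abbrev TropJorb (p : X →ₗ[ℤ] Y →ₗ[ℤ] ℤ) (S : StackyFan X) (S' : StackyFan Y)
    (ψ : ℝ ⊗[ℤ] Y → ℝ) [Module.Finite ℤ Y] (lam mu : ℚ) : PosetSheaf (Trop p S S' ψ) :=
  Jorb p S (insert 0 S'.rays) (fun m => ψ (toReal Y m)) lam mu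

/-- The orbifold tropical Hodge space `H_orb^{λ,μ}(𝖳(𝚺, w_ψ)₀)`. -/
abbrev TropOrbHodge (p : X →ₗ[ℤ] Y →ₗ[ℤ] ℤ) (S : StackyFan X) (S' : StackyFan Y)
    (ψ : ℝ ⊗[ℤ] Y → ℝ) [Module.Finite ℤ Y] (lam mu : ℚ) : Type :=
  OrbHodge p S (insert 0 S'.rays) (fun m => ψ (toReal Y m)) lam mu

/-- The action of the exterior algebra of `Y_ℂ` on the one of `X_ℂ` by contraction. -/
def contraction (p : X →ₗ[ℤ] Y →ₗ[ℤ] ℤ) :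
    ExteriorAlgebra ℂ (ℂ ⊗[ℤ] Y) →ₐ[ℂ] Module.End ℂ (ExteriorAlgebra ℂ (ℂ ⊗[ℤ] X)) :=
  ExteriorAlgebra.lift ℂ ⟨CliffordAlgebra.contractLeft ∘ₗ (pairing ℂ p).flip, fun _ =>
    LinearMap.ext fun w => CliffordAlgebra.contractLeft_contractLeft _ w⟩

/-- Contraction with the volume form `vol`, together with the exchange of the two box factors. -/
def contractSwap (p : X →ₗ[ℤ] Y →ₗ[ℤ] ℤ) (vol : ExteriorAlgebra ℂ (ℂ ⊗[ℤ] X)) :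
    ((X × ℚ) × (Y × ℚ) →₀ ExteriorAlgebra ℂ (ℂ ⊗[ℤ] Y)) →ₗ[ℂ]
      ((Y × ℚ) × (X × ℚ) →₀ ExteriorAlgebra ℂ (ℂ ⊗[ℤ] X)) :=
  Finsupp.lmapDomain _ ℂ Prod.swap ∘ₗ
    Finsupp.mapRange.linearMap (LinearMap.applyₗ vol ∘ₗ (contraction p).toLinearMap)

end Duality

end

end ClarkeDuality

open ClarkeDuality

/-!
The two sides are related cell by cell.  A cell of the regular subdivision that contains the origin
is a simplex `Δ_c'` with `c'` in the second fan.  Indeed, the minimum that defines the cell is `0`,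
and the mean of the minimizers lies in some cone by convexity; a comparison with the linear function
that supports the strictly convex function along this cone shows that all the minimizers lie in it
(`exists_eq_simplex`).  Conversely, every `Δ_c'` is a cell (`simplex_mem_subdivision`).  The condition
on the normal cone says that `c` and `c'` are orthogonal, so the cells are the pairs of orthogonal
cones, a description that is symmetric in the two fans.  This gives the isomorphism of posets
`dualIso`.

On the sections over a cell, contraction with a volume form takes `⋀ʲ c^⊥ ∧ Vol(c')` into
`⋀ʲ' c'^⊥ ∧ Vol(c)`, because the volume form itself factors through `⋀ c'^⊥ ∧ Vol(c)`
(`contraction_vol_mem`).  It is injective on forms of a fixed degree, since it turns interior products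
into exterior products (`ι_mul_contraction_vol`) and every nonzero form has an iterated interior
product that is a nonzero scalar.  As the same holds in the other direction, dimensions show that it
is an isomorphism (`exists_contraction_eq`), and this yields the isomorphism of sheaves
`dualSheafIso`.

For the Hodge spaces, `Box(c)` is the disjoint union of the sets `Box°` of the faces of `c`.  Hence
the orbifold Jacobian sheaf is the direct sum, over the finitely many twisted sectors, of extensions
by zero of sheaves on closed strata.  Extension by zero is exact and right adjoint to restriction, so
it preserves cohomology (`extAdjMap_bijective`).  Therefore the cohomology of the orbifold Jacobian
sheaf is the product of the contributions of the sectors (`sector_bijective`).  This determines the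
isomorphism of Hodge spaces, and shows that it exists (`existsUnique_orbHodge_equiv`).
-/

namespace ClarkeDuality

/-! ### Cohomology and adjoint pairs of exact functors -/

section ExtAdjunction

open Abelian Limits

universe w w' v v' u u'

variable {C : Type u} [Category.{v} C] [Abelian C] [HasExt.{w} C]
  {D : Type u'} [Category.{v'} D] [Abelian D] [HasExt.{w'} D]
  {L : C ⥤ D} {R : D ⥤ C} [L.Additive] [PreservesFiniteLimits L] [PreservesFiniteColimits L]

/-- The adjunction map `Ext^n(X, R Y) → Ext^n(L X, Y)` for a left adjoint exact functor `L`. -/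
noncomputable def extAdjMap (adj : L ⊣ R) (X : C) (Y : D) (n : ℕ) :
    Ext X (R.obj Y) n →+ Ext (L.obj X) Y n :=
  ((Ext.mk₀ (adj.counit.app Y)).postcomp (L.obj X) (add_zero n)).comp (L.mapExtAddHom X (R.obj Y) n)

lemma extAdjMap_apply (adj : L ⊣ R) {X : C} {Y : D} {n : ℕ} (x : Ext X (R.obj Y) n) :
    extAdjMap adj X Y n x =
      (x.mapExactFunctor L).comp (Ext.mk₀ (adj.counit.app Y)) (add_zero n) := rfl

lemma extAdjMap_comp_mk₀ (adj : L ⊣ R) {X : C} {Y Y' : D} {n : ℕ} (x : Ext X (R.obj Y) n)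
    (f : Y ⟶ Y') :
    extAdjMap adj X Y' n (x.comp (Ext.mk₀ (R.map f)) (add_zero n)) =
      (extAdjMap adj X Y n x).comp (Ext.mk₀ f) (add_zero n) := by
  simp only [extAdjMap_apply, Ext.mapExactFunctor_comp, Ext.mapExactFunctor_mk₀]
  rw [Ext.comp_assoc_of_third_deg_zero, Ext.comp_assoc_of_third_deg_zero, Ext.mk₀_comp_mk₀,
    Ext.mk₀_comp_mk₀]
  simp

lemma extAdjMap_comp_extClass [R.Additive] [PreservesFiniteLimits R] [PreservesFiniteColimits R]
    (adj : L ⊣ R) {X : C} {S : ShortComplex D} (hS : S.ShortExact) {n n' : ℕ} (hn : n + 1 = n')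
    (x : Ext X (S.map R).X₃ n) :
    extAdjMap adj X S.X₁ n' (x.comp (hS.map_of_exact R).extClass hn) =
      (extAdjMap adj X S.X₃ n x).comp hS.extClass hn := by
  let c : (S.map R).map L ⟶ S :=
    { τ₁ := adj.counit.app S.X₁, τ₂ := adj.counit.app S.X₂, τ₃ := adj.counit.app S.X₃
      comm₁₂ := (adj.counit.naturality S.f).symm
      comm₂₃ := (adj.counit.naturality S.g).symm }
  have h := ShortComplex.ShortExact.extClass_naturality
    ((hS.map_of_exact R).map_of_exact L) hS c
  have h1 : (x.comp (hS.map_of_exact R).extClass hn).mapExactFunctor L =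
      (x.mapExactFunctor L).comp ((hS.map_of_exact R).map_of_exact L).extClass hn :=
    (Ext.mapExactFunctor_comp L x (hS.map_of_exact R).extClass hn).trans
      (congrArg (fun z => (x.mapExactFunctor L).comp z hn)
        (Ext.mapExactFunctor_extClass L (hS.map_of_exact R)))
  have h2 := congrArg (fun z => (x.mapExactFunctor L).comp z hn) h
  refine (congrArg (fun z => Ext.comp z (Ext.mk₀ c.τ₁) (add_zero n')) h1).trans ?_
  refine (Ext.comp_assoc_of_third_deg_zero _ _ _ _).trans (h2.trans ?_)
  exact (Ext.comp_assoc_of_second_deg_zero (x.mapExactFunctor L) (Ext.mk₀ c.τ₃) hS.extClass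
    hn).symm

attribute [local instance] Ext.subsingleton_of_injective in
/-- Exact adjoint functors `L ⊣ R` induce isomorphisms `Ext^n(X, R Y) ≅ Ext^n(L X, Y)`, by dimension
shifting along an injective presentation of `Y`, which `R` preserves. -/
lemma extAdjMap_bijective [R.Additive] [PreservesFiniteLimits R] [PreservesFiniteColimits R]
    [EnoughInjectives D] (adj : L ⊣ R) (X : C) (Y : D) (n : ℕ) :
    Function.Bijective (extAdjMap adj X Y n) := by
  induction n generalizing Y with
  | zero =>
    have h : (extAdjMap adj X Y 0 : Ext X (R.obj Y) 0 → Ext (L.obj X) Y 0) =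
        Ext.homEquiv₀.symm ∘ (adj.homEquiv X Y).symm ∘ Ext.homEquiv₀ := by
      funext x
      obtain ⟨f, rfl⟩ := (Ext.mk₀_bijective _ _).2 x
      rw [extAdjMap_apply, Ext.mapExactFunctor_mk₀, Ext.mk₀_comp_mk₀]
      simp [Ext.homEquiv₀, Adjunction.homEquiv_counit]
    rw [h]
    exact (Equiv.bijective _).comp ((Equiv.bijective _).comp (Equiv.bijective _))
  | succ n hn =>
    let I : InjectivePresentation Y := Classical.arbitrary _
    let S := ShortComplex.mk _ _ (cokernel.condition I.f)
    have : Injective S.X₂ := I.injective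
    have : Injective (S.map R).X₂ := Injective.injective_of_adjoint adj _
    have hS : S.ShortExact := { exact := ShortComplex.exact_cokernel I.f }
    exact AddMonoidHom.bijective_of_surjective_of_bijective_of_right_exact _ _ _ _
      (extAdjMap adj X S.X₂ n) (extAdjMap adj X S.X₃ n) (extAdjMap adj X S.X₁ (n + 1))
      (by ext x; exact (extAdjMap_comp_mk₀ adj x S.g).symm)
      (by ext x; exact (extAdjMap_comp_extClass adj hS rfl x).symm)
      ((ShortComplex.ab_exact_iff_function_exact _).mp
        (Ext.covariant_sequence_exact₃' X (hS.map_of_exact R) n (n + 1) rfl))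
      ((ShortComplex.ab_exact_iff_function_exact _).mp
        (Ext.covariant_sequence_exact₃' (L.obj X) hS n (n + 1) rfl))
      (hn _).surjective (hn _)
      (fun x₁ ↦ Ext.covariant_sequence_exact₁ _ (hS.map_of_exact R) x₁ (by subsingleton) rfl)
      (fun y₁ ↦ Ext.covariant_sequence_exact₁ _ hS y₁ (by subsingleton) rfl)

lemma extAdjMap_comp_homEquiv (adj : L ⊣ R) {X X' : C} {Y : D} {n : ℕ} (x : Ext X X' n)
    (f : L.obj X' ⟶ Y) :
    extAdjMap adj X Y n (x.comp (Ext.mk₀ (adj.homEquiv X' Y f)) (add_zero n)) =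
      (x.mapExactFunctor L).comp (Ext.mk₀ f) (add_zero n) := by
  have h : L.map (adj.homEquiv X' Y f) ≫ adj.counit.app Y = f :=
    (adj.homEquiv_counit X' Y _).symm.trans ((adj.homEquiv X' Y).symm_apply_apply f)
  rw [extAdjMap_apply, Ext.mapExactFunctor_comp, Ext.mapExactFunctor_mk₀,
    Ext.comp_assoc_of_third_deg_zero, Ext.mk₀_comp_mk₀, h]

/-- If `F` is the direct sum of finitely many objects `K s`, then `Ext^n(X, F)` is the product of
the groups `Ext^n(X, K s)`. -/
lemma ext_bijective_of_biproduct {ι : Type*} [Fintype ι] [DecidableEq ι] {X F : C} {K : ι → C}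
    (p : ∀ s, F ⟶ K s) (j : ∀ s, K s ⟶ F) (hjp : ∀ s, j s ≫ p s = 𝟙 _)
    (hjp' : ∀ s t, s ≠ t → j s ≫ p t = 0) (hpj : ∑ s, p s ≫ j s = 𝟙 F) (n : ℕ) :
    Function.Bijective fun (x : Ext X F n) (s : ι) => x.comp (Ext.mk₀ (p s)) (add_zero n) := by
  constructor
  · intro x y hxy
    have key : ∀ z : Ext X F n,
        z = ∑ s, (z.comp (Ext.mk₀ (p s)) (add_zero n)).comp (Ext.mk₀ (j s)) (add_zero n) := by
      intro z
      calc z = z.comp (Ext.mk₀ (∑ s, p s ≫ j s)) (add_zero n) := by rw [hpj, Ext.comp_mk₀_id]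
        _ = _ := by
          rw [← Ext.addEquiv₀_symm_apply, map_sum, Ext.comp_sum]
          refine Finset.sum_congr rfl fun s _ => ?_
          rw [Ext.addEquiv₀_symm_apply, Ext.comp_assoc_of_third_deg_zero, Ext.mk₀_comp_mk₀]
    rw [key x, key y]
    exact Finset.sum_congr rfl fun s _ =>
      congrArg (fun z => Ext.comp z (Ext.mk₀ (j s)) (add_zero n)) (congrFun hxy s)
  · intro y
    refine ⟨∑ s, (y s).comp (Ext.mk₀ (j s)) (add_zero n), funext fun t => ?_⟩
    beta_reduce
    rw [Ext.sum_comp, Finset.sum_eq_single t]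
    · rw [Ext.comp_assoc_of_third_deg_zero, Ext.mk₀_comp_mk₀, hjp, Ext.comp_mk₀_id]
    · intro s _ hs
      rw [Ext.comp_assoc_of_third_deg_zero, Ext.mk₀_comp_mk₀, hjp' s t hs, Ext.mk₀_zero,
        Ext.comp_zero]
    · exact fun h => absurd (Finset.mem_univ t) h

/-- A left adjoint exact functor whose unit is an isomorphism at `X'` induces isomorphisms
`Ext^n(X, X') ≅ Ext^n(L X, L X')`. -/
lemma mapExactFunctor_bijective_of_isIso_unit [R.Additive] [PreservesFiniteLimits R]
    [PreservesFiniteColimits R] [EnoughInjectives D] (adj : L ⊣ R) (X X' : C)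
    [IsIso (adj.unit.app X')] (n : ℕ) :
    Function.Bijective fun x : Ext X X' n => x.mapExactFunctor L := by
  have h : (fun x : Ext X X' n => x.mapExactFunctor L) = extAdjMap adj X (L.obj X') n ∘
      fun x => x.comp (Ext.mk₀ (adj.unit.app X')) (add_zero n) := by
    funext x
    have := extAdjMap_comp_homEquiv adj x (𝟙 (L.obj X'))
    rw [Adjunction.homEquiv_id, Ext.comp_mk₀_id] at this
    exact this.symm
  rw [h]
  refine (extAdjMap_bijective adj X _ n).comp ⟨fun x y hxy => ?_, fun y => ?_⟩
  · have := congrArg (fun z => Ext.comp z (Ext.mk₀ (inv (adj.unit.app X'))) (add_zero n)) hxy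
    simpa [Ext.comp_assoc_of_third_deg_zero] using this
  · exact ⟨y.comp (Ext.mk₀ (inv (adj.unit.app X'))) (add_zero n), by simp⟩

end ExtAdjunction

/-! ### Sheaves on posets: extension by zero and closed strata -/

section ExtendZero

open Abelian Limits

variable {P : Type} [PartialOrder P] {Z : P → Prop}

/-- The extension by zero of a sheaf on a closed subset (that is, a lower set) `Z` of a poset.  Its
sections over `x` are the functions on the proofs of `Z x`: this product has one factor if `x` lies
in `Z`, and it is zero otherwise.  This encoding avoids a case distinction in the transition maps. -/
noncomputable def extendZeroObj (hZ : ∀ x y, x ≤ y → Z y → Z x) (G : PosetSheaf {x // Z x}) :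
    PosetSheaf P where
  obj x := ModuleCat.of ℂ (∀ h : PLift (Z x), G.obj ⟨x, h.down⟩)
  map {x y} f := ModuleCat.ofHom (LinearMap.pi fun h : PLift (Z y) =>
    (G.map (homOfLE (leOfHom f) :
      (⟨x, hZ x y (leOfHom f) h.down⟩ : {x // Z x}) ⟶ ⟨y, h.down⟩)).hom ∘ₗ
        LinearMap.proj (PLift.up (hZ x y (leOfHom f) h.down)))
  map_id x := by
    refine ModuleCat.hom_ext (LinearMap.ext fun v => funext fun h => ?_)
    exact congrArg (fun k => ModuleCat.Hom.hom k (v h)) (G.map_id ⟨x, h.down⟩)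
  map_comp {x y z} f g := by
    refine ModuleCat.hom_ext (LinearMap.ext fun v => funext fun h => ?_)
    exact congrArg (fun k => ModuleCat.Hom.hom k (v _)) (G.map_comp
      (homOfLE (leOfHom f) :
        (⟨x, hZ x z (leOfHom (f ≫ g)) h.down⟩ : {x // Z x}) ⟶ ⟨y, hZ y z (leOfHom g) h.down⟩)
      (homOfLE (leOfHom g) :
        (⟨y, hZ y z (leOfHom g) h.down⟩ : {x // Z x}) ⟶ ⟨z, h.down⟩))

/-- Extension by zero along the inclusion of a closed subset, as a functor: the direct image. -/
noncomputable def extendZero (hZ : ∀ x y, x ≤ y → Z y → Z x) :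
    PosetSheaf {x // Z x} ⥤ PosetSheaf P where
  obj G := extendZeroObj hZ G
  map {G G'} α :=
    { app x := ModuleCat.ofHom (LinearMap.pi fun h : PLift (Z x) =>
        (α.app ⟨x, h.down⟩).hom ∘ₗ LinearMap.proj h)
      naturality x y f := by
        refine ModuleCat.hom_ext (LinearMap.ext fun v => funext fun h => ?_)
        exact congrArg (fun k => ModuleCat.Hom.hom k (v _)) (α.naturality
          (homOfLE (leOfHom f) :
            (⟨x, hZ x y (leOfHom f) h.down⟩ : {x // Z x}) ⟶ ⟨y, h.down⟩)) }

/-- The inverse image functor along a monotone map. -/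
noncomputable abbrev pullbackFunctor {Q : Type} [PartialOrder Q] (i : Q →o P) :
    PosetSheaf P ⥤ PosetSheaf Q :=
  (Functor.whiskeringLeft Q P (ModuleCat.{0} ℂ)).obj i.monotone.functor

variable (hZ : ∀ x y, x ≤ y → Z y → Z x)

/-- Maps from a sheaf to an extension by zero are the maps from its restriction. -/
noncomputable def extendZeroHomEquiv (F : PosetSheaf P) (G : PosetSheaf {x // Z x}) :
    (pullback (OrderHom.Subtype.val Z) F ⟶ G) ≃ (F ⟶ (extendZero hZ).obj G) where
  toFun f :=
    { app x := (ModuleCat.ofHom (LinearMap.pi fun h : PLift (Z x) => (f.app ⟨x, h.down⟩).hom) :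
        F.obj x ⟶ ModuleCat.of ℂ (∀ h : PLift (Z x), G.obj ⟨x, h.down⟩))
      naturality x y g := by
        refine ModuleCat.hom_ext (LinearMap.ext fun v => funext fun h => ?_)
        exact congrArg (fun k => ModuleCat.Hom.hom k v) (f.naturality
          (homOfLE (leOfHom g) :
            (⟨x, hZ x y (leOfHom g) h.down⟩ : {x // Z x}) ⟶ ⟨y, h.down⟩)) }
  invFun g :=
    { app q := (ModuleCat.ofHom (LinearMap.proj (PLift.up q.2)) :
        ModuleCat.of ℂ (∀ h : PLift (Z q.1), G.obj ⟨q.1, h.down⟩) ⟶ G.obj q).hom.comp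
          (g.app q.1).hom |> ModuleCat.ofHom
      naturality q r k := by
        refine ModuleCat.hom_ext (LinearMap.ext fun v => ?_)
        exact congrFun (congrArg (fun k => ModuleCat.Hom.hom k v)
          (g.naturality (homOfLE (leOfHom k) : q.1 ⟶ r.1))) (PLift.up r.2) }
  left_inv _ := rfl
  right_inv _ := rfl

/-- Extension by zero from a closed subset is right adjoint to the restriction. -/
noncomputable def extendZeroAdj :
    pullbackFunctor (OrderHom.Subtype.val Z) ⊣ extendZero hZ :=
  Adjunction.mkOfHomEquiv
    { homEquiv := extendZeroHomEquiv hZ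
      homEquiv_naturality_left_symm := fun _ _ => rfl
      homEquiv_naturality_right := fun _ _ => rfl }

instance : (extendZero hZ).Additive where
  map_add := rfl

instance : PreservesFiniteLimits (extendZero hZ) := by
  have := (extendZeroAdj hZ).rightAdjoint_preservesLimits
  infer_instance

instance : PreservesFiniteColimits (extendZero hZ) := by
  suffices h : ∀ S : ShortComplex (PosetSheaf {x // Z x}), S.ShortExact →
      (S.map (extendZero hZ)).ShortExact by
    have := (extendZero hZ).exact_tfae.out 0 3
    exact (this.1 h).2
  intro S hS
  have hl := (extendZero hZ).preservesFiniteLimits_tfae.out 3 0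
  replace hl := hl.1 inferInstance S hS
  -- only the surjectivity is left, as a right adjoint is left exact
  have := hS.epi_g
  have : Epi (S.map (extendZero hZ)).g := by
    rw [NatTrans.epi_iff_epi_app]
    intro x
    rw [ModuleCat.epi_iff_surjective]
    intro v
    have hS' : ∀ h : PLift (Z x), Function.Surjective (S.g.app ⟨x, h.down⟩) := fun h =>
      (ModuleCat.epi_iff_surjective _).1 inferInstance
    choose w hw using fun h => hS' h ((show ∀ h : PLift (Z x), S.X₃.obj ⟨x, h.down⟩ from v) h)
    exact ⟨w, funext hw⟩
  exact { exact := hl.1, mono_f := hl.2, epi_g := this }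

/-- Suppose that the sections of a sheaf `F` are the products of the sections of sheaves `G s` on
finitely many closed strata.  Then the cohomology of `F` is the product of the cohomologies of the
sheaves `G s`. -/
lemma cohomology_bijective_of_strata {ι : Type} [Finite ι] (Z : ι → P → Prop)
    (hZ : ∀ s x y, x ≤ y → Z s y → Z s x) (F : PosetSheaf P) (G : ∀ s, PosetSheaf {x // Z s x})
    (π : ∀ s, pullback (OrderHom.Subtype.val (Z s)) F ⟶ G s)
    (hinj : ∀ x (v : F.obj x), (∀ s (h : Z s x), (π s).app ⟨x, h⟩ v = 0) → v = 0)
    (hsurj : ∀ x (w : ∀ s (h : Z s x), (G s).obj ⟨x, h⟩),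
      ∃ v : F.obj x, ∀ s (h : Z s x), (π s).app ⟨x, h⟩ v = w s h) (n : ℕ) :
    Function.Bijective fun (x : H F n) s =>
      H.map (π s) (H.pullback (OrderHom.Subtype.val (Z s)) x) := by
  classical
  have := Fintype.ofFinite ι
  -- `F` is the direct sum of the extensions by zero of the sheaves `G s`
  let K (s : ι) : PosetSheaf P := extendZeroObj (hZ s) (G s)
  let p (s : ι) : F ⟶ K s := extendZeroHomEquiv (hZ s) _ _ (π s)
  let E (x : P) : F.obj x ≃ₗ[ℂ] ∀ s, (K s).obj x :=
    LinearEquiv.ofBijective (LinearMap.pi fun s => ((p s).app x).hom) (by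
      constructor
      · rw [injective_iff_map_eq_zero]
        intro v hv
        exact hinj x v fun s h => congrFun (congrFun hv s) ⟨h⟩
      · intro w
        obtain ⟨v, hv⟩ := hsurj x fun s h => (w s : ∀ h : PLift (Z s x), (G s).obj ⟨x, h.down⟩) ⟨h⟩
        exact ⟨v, funext fun s => funext fun h => hv s h.down⟩)
  have hE (x : P) (v : F.obj x) (s : ι) : E x v s = (p s).app x v := rfl
  have hE' (x : P) (w : ∀ s, (K s).obj x) (s : ι) : (p s).app x ((E x).symm w) = w s := by
    rw [← hE, LinearEquiv.apply_symm_apply]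
  let j (s : ι) : K s ⟶ F :=
    { app x := ModuleCat.ofHom
        ((E x).symm.toLinearMap ∘ₗ LinearMap.single ℂ (fun s => (K s).obj x) s)
      naturality x y f := by
        refine ModuleCat.hom_ext (LinearMap.ext fun v => (E y).injective (funext fun t => ?_))
        have h1 : E y (F.map f ((E x).symm (Pi.single s v))) t =
            (K t).map f ((p t).app x ((E x).symm (Pi.single s v))) :=
          congrArg (fun k => ModuleCat.Hom.hom k ((E x).symm (Pi.single s v))) ((p t).naturality f)
        have h2 : E y ((E y).symm (Pi.single s ((K s).map f v))) t =
            (K t).map f (Pi.single (M := fun s => (K s).obj x) s v t) := by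
          rw [LinearEquiv.apply_symm_apply]
          by_cases h : t = s
          · subst h; simp
          · simp [h]
        exact h2.trans (h1.trans (congrArg _ (hE' x _ t))).symm }
  have hj (s : ι) (x : P) (v : (K s).obj x) (t : ι) :
      (p t).app x ((j s).app x v) = Pi.single (M := fun s => (K s).obj x) s v t := hE' x _ t
  have hjp (s : ι) : j s ≫ p s = 𝟙 _ := by
    refine NatTrans.ext (funext fun x => ModuleCat.hom_ext (LinearMap.ext fun v => ?_))
    exact (hj s x v s).trans (Pi.single_eq_same (M := fun s => (K s).obj x) s v)
  have hjp' (s t : ι) (hst : s ≠ t) : j s ≫ p t = 0 := by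
    refine NatTrans.ext (funext fun x => ModuleCat.hom_ext (LinearMap.ext fun v => ?_))
    exact (hj s x v t).trans (Pi.single_eq_of_ne (M := fun s => (K s).obj x) hst.symm v)
  have hpj : ∑ s, p s ≫ j s = 𝟙 F := by
    refine NatTrans.ext (funext fun x => ModuleCat.hom_ext (LinearMap.ext fun v => ?_))
    refine (E x).injective (funext fun t => ?_)
    have h : (∑ s, p s ≫ j s) ≫ p t = p t := by
      rw [Preadditive.sum_comp, Finset.sum_eq_single t]
      · rw [Category.assoc, hjp, Category.comp_id]
      · intro s _ hs
        rw [Category.assoc, hjp' s t hs, comp_zero]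
      · exact fun h => absurd (Finset.mem_univ t) h
    exact congrArg (fun k => ModuleCat.Hom.hom (NatTrans.app k x) v) h
  have key := ext_bijective_of_biproduct (X := constSheaf P) p j hjp hjp' hpj n
  have key2 : ∀ s, Function.Bijective (extAdjMap (extendZeroAdj (hZ s)) (constSheaf P) (G s) n) :=
    fun s => extAdjMap_bijective _ _ _ _
  -- projecting to a summand and passing to the stratum is restricting and applying `π s`
  convert! (Function.Bijective.piMap key2).comp key using 1
  funext x s
  exact (extAdjMap_comp_homEquiv (extendZeroAdj (hZ s)) x (π s)).symm

/-- The inverse image along an isomorphism of posets is an isomorphism on cohomology. -/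
lemma H.pullback_bijective {Q : Type} [PartialOrder Q] (e : Q ≃o P) (F : PosetSheaf P) (n : ℕ) :
    Function.Bijective (H.pullback (e : Q →o P) : H F n → _) := by
  let E : PosetSheaf P ≌ PosetSheaf Q := e.equivalence.symm.congrLeft
  let adj : pullbackFunctor (e : Q →o P) ⊣ pullbackFunctor (e.symm : P →o Q) := E.toAdjunction
  have : IsIso (adj.unit.app F) := inferInstanceAs (IsIso (E.unit.app F))
  exact mapExactFunctor_bijective_of_isIso_unit adj (constSheaf P) F n

end ExtendZero

/-! ### Contraction with a volume form -/

section Exterior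

open ExteriorAlgebra CliffordAlgebra

variable {V : Type} [AddCommGroup V] [Module ℂ V]

/-- The interior product with a linear form. -/
noncomputable abbrev interior (f : Module.Dual ℂ V) :
    ExteriorAlgebra ℂ V →ₗ[ℂ] ExteriorAlgebra ℂ V :=
  contractLeft (Q := (0 : QuadraticForm ℂ V)) f

lemma interior_ι_mul (f : Module.Dual ℂ V) (v : V) (x : ExteriorAlgebra ℂ V) :
    interior f (ExteriorAlgebra.ι ℂ v * x) = f v • x - ExteriorAlgebra.ι ℂ v * interior f x :=
  contractLeft_ι_mul f v x

lemma wedgePow_zero (W : Submodule ℂ V) : wedgePow W 0 = 1 := pow_zero _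

lemma wedgePow_succ_mul (W : Submodule ℂ V) (n : ℕ) (Z : Submodule ℂ (ExteriorAlgebra ℂ V)) :
    wedgePow W (n + 1) * Z = W.map (ExteriorAlgebra.ι ℂ) * (wedgePow W n * Z) := by
  rw [wedgePow, pow_succ', mul_assoc, wedgePow]

lemma wedgePow_top (n : ℕ) : wedgePow (⊤ : Submodule ℂ V) n = ⋀[ℂ]^n V := by
  rw [wedgePow, Submodule.map_top]

/-- Interior products are antiderivations: if `f` annihilates `Z`, then it takes `⋀ⁿ W ∧ Z` into
`⋀ⁿ⁻¹ W ∧ Z`. -/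
lemma interior_mem (f : Module.Dual ℂ V) (W : Submodule ℂ V)
    (Z : Submodule ℂ (ExteriorAlgebra ℂ V)) (hZ : ∀ z ∈ Z, interior f z = 0) (n : ℕ)
    {x : ExteriorAlgebra ℂ V} (hx : x ∈ wedgePow W n * Z) :
    interior f x ∈ wedgePow W (n - 1) * Z ∧ (n = 0 → interior f x = 0) := by
  induction n generalizing x with
  | zero =>
    rw [wedgePow_zero, one_mul] at hx
    simp [hZ x hx]
  | succ n ih =>
    refine ⟨?_, fun h => absurd h n.succ_ne_zero⟩
    rw [wedgePow_succ_mul] at hx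
    rw [Nat.add_sub_cancel]
    induction hx using Submodule.mul_induction_on' with
    | mem_mul_mem v hv y hy =>
      obtain ⟨w, hw, rfl⟩ := hv
      rw [interior_ι_mul]
      refine Submodule.sub_mem _ (Submodule.smul_mem _ _ hy) ?_
      obtain ⟨h1, h2⟩ := ih hy
      rcases n with - | n
      · rw [h2 rfl, mul_zero]; exact zero_mem _
      · rw [wedgePow_succ_mul]
        exact Submodule.mul_mem_mul ⟨w, hw, rfl⟩ h1
    | add y _ z _ hy hz => rw [map_add]; exact add_mem hy hz

/-- If `f` annihilates `W` and `Z`, then it annihilates `⋀ⁿ W ∧ Z`. -/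
lemma interior_eq_zero (f : Module.Dual ℂ V) (W : Submodule ℂ V) (hW : ∀ w ∈ W, f w = 0)
    (Z : Submodule ℂ (ExteriorAlgebra ℂ V)) (hZ : ∀ z ∈ Z, interior f z = 0) (n : ℕ)
    {x : ExteriorAlgebra ℂ V} (hx : x ∈ wedgePow W n * Z) : interior f x = 0 := by
  induction n generalizing x with
  | zero =>
    rw [wedgePow_zero, one_mul] at hx
    exact hZ x hx
  | succ n ih =>
    rw [wedgePow_succ_mul] at hx
    induction hx using Submodule.mul_induction_on' with
    | mem_mul_mem v hv y hy =>
      obtain ⟨w, hw, rfl⟩ := hv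
      rw [interior_ι_mul, hW w hw, ih hy, zero_smul, mul_zero, sub_zero]
    | add y _ z _ hy hz => rw [map_add, hy, hz, add_zero]

lemma interior_mem_exteriorPower (f : Module.Dual ℂ V) {n : ℕ} {x : ExteriorAlgebra ℂ V}
    (hx : x ∈ ⋀[ℂ]^(n + 1) V) : interior f x ∈ ⋀[ℂ]^n V := by
  rw [← wedgePow_top] at hx ⊢
  have h := (interior_mem f ⊤ 1 (fun z hz => ?_) (n + 1) (x := x) (by rwa [mul_one])).1
  · rwa [mul_one] at h
  · obtain ⟨r, rfl⟩ := Submodule.mem_one.1 hz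
    exact contractLeft_algebraMap _ _ r

/-- Euler's formula: on forms of degree `k`, the sum of the operators `e_i ∧ (f_i ⌟ ·)`, for dual
bases `e_i` and `f_i`, is multiplication by `k`. -/
lemma sum_ι_mul_interior {ι : Type*} [Fintype ι] (b : Module.Basis ι ℂ V) {k : ℕ}
    {x : ExteriorAlgebra ℂ V} (hx : x ∈ ⋀[ℂ]^k V) :
    ∑ i, ExteriorAlgebra.ι ℂ (b i) * interior (b.coord i) x = (k : ℂ) • x := by
  rw [← wedgePow_top] at hx
  induction k generalizing x with
  | zero =>
    rw [wedgePow_zero] at hx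
    obtain ⟨r, rfl⟩ := Submodule.mem_one.1 hx
    have : ∀ i, interior (b.coord i) (algebraMap ℂ _ r) = 0 := fun i =>
      contractLeft_algebraMap _ _ r
    simp [this]
  | succ k ih =>
    rw [← mul_one (wedgePow _ _), wedgePow_succ_mul, mul_one] at hx
    induction hx using Submodule.mul_induction_on' with
    | mem_mul_mem v hv y hy =>
      obtain ⟨w, -, rfl⟩ := hv
      have h1 : ∀ i, ExteriorAlgebra.ι ℂ (b i) * interior (b.coord i) (ExteriorAlgebra.ι ℂ w * y) =
          ExteriorAlgebra.ι ℂ (b.coord i w • b i) * y +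
            ExteriorAlgebra.ι ℂ w * (ExteriorAlgebra.ι ℂ (b i) * interior (b.coord i) y) := by
        intro i
        have h2 : ExteriorAlgebra.ι ℂ (b i) * ExteriorAlgebra.ι ℂ w =
            -(ExteriorAlgebra.ι ℂ w * ExteriorAlgebra.ι ℂ (b i)) :=
          eq_neg_of_add_eq_zero_left (ExteriorAlgebra.ι_add_mul_swap _ _)
        rw [interior_ι_mul, mul_sub, ← mul_assoc, h2, map_smul, mul_smul_comm, smul_mul_assoc,
          neg_mul, sub_neg_eq_add, mul_assoc]
      simp only [h1]
      rw [Finset.sum_add_distrib, ← Finset.sum_mul, ← map_sum, ← Finset.mul_sum, ih hy]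
      simp only [Module.Basis.coord_apply, b.sum_repr]
      rw [mul_smul_comm, Nat.cast_succ, add_smul, one_smul, add_comm]
    | add y _ z _ hy hz =>
      simp only [map_add, mul_add, Finset.sum_add_distrib, smul_add]
      rw [hy, hz]

/-- By Euler's formula, a form of positive degree with vanishing interior products is zero. -/
lemma exists_interior_ne_zero [Module.Finite ℂ V] {k : ℕ} {x : ExteriorAlgebra ℂ V}
    (hx : x ∈ ⋀[ℂ]^(k + 1) V) (h0 : x ≠ 0) : ∃ f, interior f x ≠ 0 := by
  by_contra! h
  have h1 := sum_ι_mul_interior (Module.finBasis ℂ V) hx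
  simp only [h, mul_zero, Finset.sum_const_zero] at h1
  exact (smul_ne_zero (Nat.cast_ne_zero.2 k.succ_ne_zero) h0) h1.symm

end Exterior

section Contraction

variable {X Y : Type} [AddCommGroup X] [AddCommGroup Y] (p : X →ₗ[ℤ] Y →ₗ[ℤ] ℤ)

lemma pairing_flip (K : Type) [Field K] : pairing K p.flip = (pairing K p).flip := by
  refine LinearMap.ext fun y => LinearMap.ext fun x => ?_
  rw [LinearMap.flip_apply]
  induction y with
  | zero => simp
  | add y y' h h' => rw [map_add, map_add, LinearMap.add_apply, h, h']
  | tmul a y =>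
    induction x with
    | zero => simp
    | add x x' h h' => rw [map_add, map_add, LinearMap.add_apply, h, h']
    | tmul b x => rw [pairing_tmul, pairing_tmul, LinearMap.flip_apply, mul_comm a b]

lemma pairing_surjective [Module.Free ℤ Y] [Module.Finite ℤ Y] [p.IsPerfPair] (K : Type)
    [Field K] : Function.Surjective (pairing K p) := by
  intro f
  let b := Module.Free.chooseBasis ℤ Y
  choose x hx using fun i => (LinearMap.IsPerfPair.bijective_left p).2 (b.coord i)
  refine ⟨∑ i, f (1 ⊗ₜ b i) ⊗ₜ x i, (b.baseChange K).ext fun j => ?_⟩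
  rw [map_sum, LinearMap.sum_apply, Module.Basis.baseChange_apply, Finset.sum_eq_single j]
  · rw [pairing_tmul, hx]; simp
  · intro i _ hij
    rw [pairing_tmul, hx]
    simp [hij.symm]
  · exact fun h => absurd (Finset.mem_univ j) h

lemma pairing_bijective [Module.Free ℤ X] [Module.Finite ℤ X] [Module.Free ℤ Y]
    [Module.Finite ℤ Y] [p.IsPerfPair] (K : Type) [Field K] :
    Function.Bijective (pairing K p) := by
  refine ⟨?_, pairing_surjective p K⟩
  rw [← LinearMap.ker_eq_bot, LinearMap.ker_eq_bot']
  intro m hm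
  rw [← Module.forall_dual_apply_eq_zero_iff K]
  intro f
  obtain ⟨n, rfl⟩ := pairing_surjective p.flip K f
  rw [pairing_flip, LinearMap.flip_apply, hm, LinearMap.zero_apply]

lemma contraction_ι (v : ℂ ⊗[ℤ] Y) (w : ExteriorAlgebra ℂ (ℂ ⊗[ℤ] X)) :
    contraction p (ExteriorAlgebra.ι ℂ v) w = interior ((pairing ℂ p).flip v) w := by
  simp [contraction]

/-- Contraction with forms in `⋀ʲ U` takes `⋀ⁿ W ∧ Z` into `⋀ⁿ⁻ʲ W ∧ Z` if `U` annihilates `Z`. -/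
lemma contraction_mem (U : Submodule ℂ (ℂ ⊗[ℤ] Y)) (W : Submodule ℂ (ℂ ⊗[ℤ] X))
    (Z : Submodule ℂ (ExteriorAlgebra ℂ (ℂ ⊗[ℤ] X)))
    (hZ : ∀ u ∈ U, ∀ z ∈ Z, interior ((pairing ℂ p).flip u) z = 0) (j n : ℕ)
    {ω : ExteriorAlgebra ℂ (ℂ ⊗[ℤ] Y)} (hω : ω ∈ wedgePow U j)
    {x : ExteriorAlgebra ℂ (ℂ ⊗[ℤ] X)} (hx : x ∈ wedgePow W n * Z) :
    contraction p ω x ∈ wedgePow W (n - j) * Z ∧ (n < j → contraction p ω x = 0) := by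
  induction j generalizing ω with
  | zero =>
    rw [wedgePow_zero] at hω
    obtain ⟨r, rfl⟩ := Submodule.mem_one.1 hω
    rw [AlgHom.commutes, Module.algebraMap_end_apply]
    exact ⟨Submodule.smul_mem _ _ hx, fun h => absurd h n.not_lt_zero⟩
  | succ j ih =>
    rw [← mul_one (wedgePow _ _), wedgePow_succ_mul, mul_one] at hω
    induction hω using Submodule.mul_induction_on' with
    | mem_mul_mem v hv y hy =>
      obtain ⟨u, hu, rfl⟩ := hv
      rw [map_mul, Module.End.mul_apply, contraction_ι]
      obtain ⟨h1, h2⟩ := ih hy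
      obtain ⟨h3, h4⟩ := interior_mem _ W Z (hZ u hu) _ h1
      refine ⟨by rwa [Nat.sub_sub] at h3, fun h => ?_⟩
      rcases Nat.lt_succ_iff_lt_or_eq.1 h with h | h
      · rw [h2 h, map_zero]
      · exact h4 (by omega)
    | add y _ z _ hy hz =>
      rw [map_add, LinearMap.add_apply]
      exact ⟨add_mem hy.1 hz.1, fun h => by rw [hy.2 h, hz.2 h, add_zero]⟩

/-- The key computation for the duality.  Let `U ⊆ Y_ℂ` and `U' ⊆ W' ⊆ X_ℂ` be subspaces such that
`W'` is annihilated by `U`, and `U'` by `W`.  As a volume form on `X_ℂ` factors through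
`⋀ W' ∧ ⋀^top U'`, contracting it with an element of `⋀ʲ W ∧ ⋀^top U` first removes a complement
of `W'`, and then `j` of the factors in `W'`. -/
lemma contraction_vol_mem [Module.Finite ℤ X] (U W : Submodule ℂ (ℂ ⊗[ℤ] Y))
    (U' W' : Submodule ℂ (ℂ ⊗[ℤ] X)) (hUW : U ≤ W) (hUW' : U' ≤ W')
    (hU : ∀ u ∈ U, ∀ w ∈ W', pairing ℂ p w u = 0) (hU' : ∀ u ∈ U', ∀ w ∈ W, pairing ℂ p u w = 0)
    (hr : Module.finrank ℂ U + Module.finrank ℂ W' = Module.finrank ℂ (ℂ ⊗[ℤ] X))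
    {vol : ExteriorAlgebra ℂ (ℂ ⊗[ℤ] X)}
    (hvol : vol ∈ ⋀[ℂ]^(Module.finrank ℂ (ℂ ⊗[ℤ] X)) (ℂ ⊗[ℤ] X)) (j : ℕ)
    {ω : ExteriorAlgebra ℂ (ℂ ⊗[ℤ] Y)} (hω : ω ∈ wedgePow W j * wedgePow U (Module.finrank ℂ U)) :
    contraction p ω vol ∈ wedgePow W' (Module.finrank ℂ W' - Module.finrank ℂ U' - j) *
        wedgePow U' (Module.finrank ℂ U') ∧
      (Module.finrank ℂ W' - Module.finrank ℂ U' < j → contraction p ω vol = 0) := by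
  have hone : ∀ f : Module.Dual ℂ (ℂ ⊗[ℤ] X), ∀ z ∈ (1 : Submodule ℂ (ExteriorAlgebra ℂ _)),
      interior f z = 0 := by
    intro f z hz
    obtain ⟨r, rfl⟩ := Submodule.mem_one.1 hz
    exact CliffordAlgebra.contractLeft_algebraMap _ _ r
  have hZ1 : ∀ w ∈ W, ∀ z ∈ wedgePow U' (Module.finrank ℂ U'),
      interior ((pairing ℂ p).flip w) z = 0 := fun w hw z hz =>
    interior_eq_zero _ U' (fun u hu => hU' u hu w hw) 1 (hone _) _ (by rwa [mul_one])
  have hZ2 : ∀ u ∈ U, ∀ z ∈ wedgePow W' (Module.finrank ℂ W' - Module.finrank ℂ U') *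
      wedgePow U' (Module.finrank ℂ U'), interior ((pairing ℂ p).flip u) z = 0 := fun u hu z hz =>
    interior_eq_zero _ W' (fun w hw => hU u hu w hw) _ (hZ1 u (hUW hu)) _ hz
  have hvol' : vol ∈ wedgePow (⊤ : Submodule ℂ (ℂ ⊗[ℤ] X)) (Module.finrank ℂ U) *
      (wedgePow W' (Module.finrank ℂ W' - Module.finrank ℂ U') *
        wedgePow U' (Module.finrank ℂ U')) := by
    have h1 := wedgePow_top_le (U := (⊤ : Submodule ℂ (ℂ ⊗[ℤ] X))) (le_top : W' ≤ ⊤)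
    rw [finrank_top, wedgePow_top, ← hr, Nat.add_sub_cancel, hr] at h1
    exact mul_le_mul' le_rfl (wedgePow_top_le hUW') (h1 hvol)
  induction hω using Submodule.mul_induction_on' with
  | mem_mul_mem α hα β hβ =>
    rw [map_mul, Module.End.mul_apply]
    have h1 := (contraction_mem p U ⊤ _ hZ2 _ _ hβ hvol').1
    rw [Nat.sub_self, wedgePow_zero, one_mul] at h1
    exact contraction_mem p W W' _ hZ1 _ _ hα h1
  | add y _ z _ hy hz =>
    rw [map_add, LinearMap.add_apply]
    exact ⟨add_mem hy.1 hz.1, fun h => by rw [hy.2 h, hz.2 h, add_zero]⟩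

/-- Contraction of a volume form turns interior products into exterior products. -/
lemma ι_mul_contraction_vol {vol : ExteriorAlgebra ℂ (ℂ ⊗[ℤ] X)} (m : ℂ ⊗[ℤ] X)
    (hvol : ExteriorAlgebra.ι ℂ m * vol = 0) (ω : ExteriorAlgebra ℂ (ℂ ⊗[ℤ] Y)) :
    ExteriorAlgebra.ι ℂ m * contraction p ω vol =
      contraction p (interior (pairing ℂ p m) ω) vol := by
  induction ω using CliffordAlgebra.left_induction with
  | algebraMap r =>
    rw [interior, CliffordAlgebra.contractLeft_algebraMap, map_zero, LinearMap.zero_apply]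
    rw [show contraction p (algebraMap ℂ (CliffordAlgebra _) r) = algebraMap ℂ _ r from
      AlgHom.commutes _ r, Module.algebraMap_end_apply, mul_smul_comm, hvol, smul_zero]
  | add x y hx hy =>
    rw [map_add, LinearMap.add_apply, mul_add, hx, hy, map_add, map_add, LinearMap.add_apply]
  | ι_mul ω n ih =>
    have e1 : contraction p (ExteriorAlgebra.ι ℂ n * ω) vol =
        interior ((pairing ℂ p).flip n) (contraction p ω vol) := by
      rw [map_mul, Module.End.mul_apply, contraction_ι]
    have e2 := interior_ι_mul ((pairing ℂ p).flip n) m (contraction p ω vol)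
    have e3 : contraction p (interior (pairing ℂ p m) (ExteriorAlgebra.ι ℂ n * ω)) vol =
        pairing ℂ p m n • contraction p ω vol -
          interior ((pairing ℂ p).flip n) (contraction p (interior (pairing ℂ p m) ω) vol) := by
      rw [interior_ι_mul, map_sub, map_smul, map_mul, LinearMap.sub_apply, LinearMap.smul_apply,
        Module.End.mul_apply, contraction_ι]
    change ExteriorAlgebra.ι ℂ m * contraction p (ExteriorAlgebra.ι ℂ n * ω) vol =
      contraction p (interior (pairing ℂ p m) (ExteriorAlgebra.ι ℂ n * ω)) vol
    rw [e1, e3, ← ih, e2, LinearMap.flip_apply, sub_sub_cancel]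

/-- Contraction with a nonzero volume form is injective on forms of a fixed degree: a nonzero form
has an iterated interior product that is a nonzero scalar. -/
lemma eq_zero_of_contraction_vol_eq_zero [Module.Free ℤ Y] [Module.Finite ℤ Y] [Module.Finite ℤ X]
    [p.IsPerfPair] {vol : ExteriorAlgebra ℂ (ℂ ⊗[ℤ] X)}
    (hvol : vol ∈ ⋀[ℂ]^(Module.finrank ℂ (ℂ ⊗[ℤ] X)) (ℂ ⊗[ℤ] X)) (hvol0 : vol ≠ 0) (k : ℕ)
    {ω : ExteriorAlgebra ℂ (ℂ ⊗[ℤ] Y)} (hω : ω ∈ ⋀[ℂ]^k (ℂ ⊗[ℤ] Y))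
    (h : contraction p ω vol = 0) : ω = 0 := by
  induction k generalizing ω with
  | zero =>
    rw [← wedgePow_top, wedgePow_zero] at hω
    obtain ⟨r, rfl⟩ := Submodule.mem_one.1 hω
    rw [AlgHom.commutes, Module.algebraMap_end_apply] at h
    rw [(smul_eq_zero.1 h).resolve_right hvol0, map_zero]
  | succ k ih =>
    by_contra h0
    obtain ⟨f, hf⟩ := exists_interior_ne_zero hω h0
    obtain ⟨m, rfl⟩ := pairing_surjective p ℂ f
    refine hf (ih (interior_mem_exteriorPower _ hω) ?_)
    -- there are no forms of degree `d + 1`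
    have hm : ExteriorAlgebra.ι ℂ m * vol = 0 := by
      have h1 : ExteriorAlgebra.ι ℂ m * vol ∈
          wedgePow (⊤ : Submodule ℂ (ℂ ⊗[ℤ] X)) (Module.finrank ℂ (ℂ ⊗[ℤ] X) + 1) := by
        rw [← mul_one (wedgePow _ _), wedgePow_succ_mul, mul_one, wedgePow_top]
        exact Submodule.mul_mem_mul ⟨m, trivial, rfl⟩ hvol
      rw [wedgePow_eq_bot _ (by rw [finrank_top]; exact Nat.lt_succ_self _)] at h1
      exact h1
    rw [← ι_mul_contraction_vol p m hm, h, mul_zero]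

/-- The space `⋀^(k - dim U) W ∧ ⋀^top U`; it is zero unless `k - dim U` is a natural number. -/
noncomputable def wedgeForms {V : Type} [AddCommGroup V] [Module ℂ V] (W U : Submodule ℂ V)
    (k : ℚ) : Submodule ℂ (ExteriorAlgebra ℂ V) :=
  ⨆ (j : ℕ) (_ : (j : ℚ) + Module.finrank ℂ U = k),
    wedgePow W j * wedgePow U (Module.finrank ℂ U)

lemma wedgeForms_eq {V : Type} [AddCommGroup V] [Module ℂ V] (W U : Submodule ℂ V) {k : ℚ} {j : ℕ}
    (h : (j : ℚ) + Module.finrank ℂ U = k) :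
    wedgeForms W U k = wedgePow W j * wedgePow U (Module.finrank ℂ U) := by
  refine le_antisymm (iSup₂_le fun i hi => ?_) ?_
  · have : i = j := by exact_mod_cast add_right_cancel (hi.trans h.symm)
    rw [this]
  · exact le_iSup₂ (f := fun (j : ℕ) (_ : (j : ℚ) + Module.finrank ℂ U = k) =>
      wedgePow W j * wedgePow U (Module.finrank ℂ U)) j h

lemma wedgeForms_eq_bot {V : Type} [AddCommGroup V] [Module ℂ V] (W U : Submodule ℂ V) {k : ℚ}
    (h : ¬∃ j : ℕ, (j : ℚ) + Module.finrank ℂ U = k) : wedgeForms W U k = ⊥ :=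
  iSup₂_eq_bot.2 fun j hj => absurd ⟨j, hj⟩ h

instance {V : Type} [AddCommGroup V] [Module ℂ V] [Module.Finite ℂ V] (W U : Submodule ℂ V)
    (k : ℚ) : Module.Finite ℂ (wedgeForms W U k) := by
  have h (W : Submodule ℂ V) (n : ℕ) : (wedgePow W n).FG :=
    ((IsNoetherian.noetherian W).map _).pow n
  by_cases hk : ∃ j : ℕ, (j : ℚ) + Module.finrank ℂ U = k
  · obtain ⟨j, hj⟩ := hk
    rw [wedgeForms_eq W U hj]
    exact Module.Finite.iff_fg.2 ((h _ _).mul (h _ _))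
  · rw [wedgeForms_eq_bot W U hk]
    infer_instance

lemma contraction_mem_wedgeForms [Module.Finite ℤ X] (U W : Submodule ℂ (ℂ ⊗[ℤ] Y))
    (U' W' : Submodule ℂ (ℂ ⊗[ℤ] X)) (hUW : U ≤ W) (hUW' : U' ≤ W')
    (hU : ∀ u ∈ U, ∀ w ∈ W', pairing ℂ p w u = 0) (hU' : ∀ u ∈ U', ∀ w ∈ W, pairing ℂ p u w = 0)
    (hr : Module.finrank ℂ U + Module.finrank ℂ W' = Module.finrank ℂ (ℂ ⊗[ℤ] X))
    {vol : ExteriorAlgebra ℂ (ℂ ⊗[ℤ] X)}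
    (hvol : vol ∈ ⋀[ℂ]^(Module.finrank ℂ (ℂ ⊗[ℤ] X)) (ℂ ⊗[ℤ] X)) (k : ℚ)
    {ω : ExteriorAlgebra ℂ (ℂ ⊗[ℤ] Y)} (hω : ω ∈ wedgeForms W U k) :
    contraction p ω vol ∈ wedgeForms W' U' (Module.finrank ℂ (ℂ ⊗[ℤ] X) - k) := by
  by_cases hk : ∃ j : ℕ, (j : ℚ) + Module.finrank ℂ U = k
  · obtain ⟨j, hj⟩ := hk
    rw [wedgeForms_eq W U hj] at hω
    obtain ⟨h1, h2⟩ := contraction_vol_mem p U W U' W' hUW hUW' hU hU' hr hvol j hω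
    rcases lt_or_ge (Module.finrank ℂ W' - Module.finrank ℂ U') j with h | h
    -- here the truncated difference of degrees is not the true one, but both sides vanish
    · rw [h2 h]
      exact zero_mem _
    · have hle : Module.finrank ℂ U' ≤ Module.finrank ℂ W' := Submodule.finrank_mono hUW'
      have e : ((Module.finrank ℂ W' - Module.finrank ℂ U' - j : ℕ) : ℚ) + Module.finrank ℂ U' =
          Module.finrank ℂ (ℂ ⊗[ℤ] X) - k := by
        rw [Nat.cast_sub h, Nat.cast_sub hle, ← hr, ← hj]
        push_cast
        ring
      rwa [wedgeForms_eq W' U' e]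
  · rw [wedgeForms_eq_bot W U hk] at hω
    rw [(Submodule.mem_bot ℂ).1 hω, map_zero, LinearMap.zero_apply]
    exact zero_mem _

lemma eq_zero_of_mem_wedgeForms [Module.Free ℤ Y] [Module.Finite ℤ Y] [Module.Finite ℤ X]
    [p.IsPerfPair] {vol : ExteriorAlgebra ℂ (ℂ ⊗[ℤ] X)}
    (hvol : vol ∈ ⋀[ℂ]^(Module.finrank ℂ (ℂ ⊗[ℤ] X)) (ℂ ⊗[ℤ] X)) (hvol0 : vol ≠ 0)
    (U W : Submodule ℂ (ℂ ⊗[ℤ] Y)) (k : ℚ) {ω : ExteriorAlgebra ℂ (ℂ ⊗[ℤ] Y)}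
    (hω : ω ∈ wedgeForms W U k) (h : contraction p ω vol = 0) : ω = 0 := by
  by_cases hk : ∃ j : ℕ, (j : ℚ) + Module.finrank ℂ U = k
  · obtain ⟨j, hj⟩ := hk
    rw [wedgeForms_eq W U hj] at hω
    refine eq_zero_of_contraction_vol_eq_zero p hvol hvol0 (j + Module.finrank ℂ U) ?_ h
    rw [← wedgePow_top, wedgePow, pow_add]
    exact mul_le_mul' (wedgePow_mono le_top _) (wedgePow_mono le_top _) hω
  · rw [wedgeForms_eq_bot W U hk] at hω
    exact (Submodule.mem_bot ℂ).1 hω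

lemma finrank_tensor_eq [Module.Free ℤ X] [Module.Finite ℤ X] [Module.Free ℤ Y]
    [Module.Finite ℤ Y] [p.IsPerfPair] :
    Module.finrank ℂ (ℂ ⊗[ℤ] X) = Module.finrank ℂ (ℂ ⊗[ℤ] Y) := by
  rw [(LinearEquiv.ofBijective _ (pairing_bijective p ℂ)).finrank_eq, Subspace.dual_finrank_eq]

lemma exists_vol_ne_zero (V : Type) [AddCommGroup V] [Module ℂ V] [Module.Finite ℂ V] :
    ∃ vol ∈ ⋀[ℂ]^(Module.finrank ℂ V) V, vol ≠ 0 := by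
  refine Submodule.exists_mem_ne_zero_of_ne_bot fun h => ?_
  have h1 := exteriorPower.finrank_eq ℂ (M := V) (Module.finrank ℂ V)
  rw [h, finrank_bot, Nat.choose_self] at h1
  exact zero_ne_one h1

/-- Contraction with a volume form is an isomorphism
`⋀^(k - dim U) W ∧ ⋀^top U ≅ ⋀^(d - k - dim U') W' ∧ ⋀^top U'`, if `W'` is the annihilator of `U` and
`W` the annihilator of `U'`.  There are injective maps in both directions, so surjectivity is a
matter of dimensions. -/
lemma exists_contraction_eq [Module.Free ℤ X] [Module.Finite ℤ X] [Module.Free ℤ Y]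
    [Module.Finite ℤ Y] [p.IsPerfPair] (U W : Submodule ℂ (ℂ ⊗[ℤ] Y))
    (U' W' : Submodule ℂ (ℂ ⊗[ℤ] X)) (hUW : U ≤ W) (hUW' : U' ≤ W')
    (hU : ∀ u ∈ U, ∀ w ∈ W', pairing ℂ p w u = 0) (hU' : ∀ u ∈ U', ∀ w ∈ W, pairing ℂ p u w = 0)
    (hr : Module.finrank ℂ U + Module.finrank ℂ W' = Module.finrank ℂ (ℂ ⊗[ℤ] X))
    (hr' : Module.finrank ℂ U' + Module.finrank ℂ W = Module.finrank ℂ (ℂ ⊗[ℤ] Y))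
    {vol : ExteriorAlgebra ℂ (ℂ ⊗[ℤ] X)}
    (hvol : vol ∈ ⋀[ℂ]^(Module.finrank ℂ (ℂ ⊗[ℤ] X)) (ℂ ⊗[ℤ] X)) (hvol0 : vol ≠ 0) (k : ℚ)
    {η : ExteriorAlgebra ℂ (ℂ ⊗[ℤ] X)}
    (hη : η ∈ wedgeForms W' U' (Module.finrank ℂ (ℂ ⊗[ℤ] X) - k)) :
    ∃ ω ∈ wedgeForms W U k, contraction p ω vol = η := by
  obtain ⟨vol', hvol', hvol0'⟩ := exists_vol_ne_zero (ℂ ⊗[ℤ] Y)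
  let f : wedgeForms W U k →ₗ[ℂ] wedgeForms W' U' (Module.finrank ℂ (ℂ ⊗[ℤ] X) - k) :=
    ((LinearMap.applyₗ vol ∘ₗ (contraction p).toLinearMap) ∘ₗ Submodule.subtype _).codRestrict _
      fun ω => contraction_mem_wedgeForms p U W U' W' hUW hUW' hU hU' hr hvol k ω.2
  let g : wedgeForms W' U' (Module.finrank ℂ (ℂ ⊗[ℤ] X) - k) →ₗ[ℂ] wedgeForms W U k :=
    ((LinearMap.applyₗ vol' ∘ₗ (contraction p.flip).toLinearMap) ∘ₗ
      Submodule.subtype _).codRestrict _ fun ω => by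
      have h := contraction_mem_wedgeForms p.flip U' W' U W hUW' hUW
        (fun u hu w hw => by rw [pairing_flip]; exact hU' u hu w hw)
        (fun u hu w hw => by rw [pairing_flip]; exact hU u hu w hw) hr' hvol' _ ω.2
      rw [← finrank_tensor_eq p, sub_sub_cancel] at h
      exact h
  have hf : Function.Injective f := by
    rw [injective_iff_map_eq_zero]
    exact fun ω h => Subtype.ext
      (eq_zero_of_mem_wedgeForms p hvol hvol0 U W k ω.2 (congrArg Subtype.val h))
  have hg : Function.Injective g := by
    rw [injective_iff_map_eq_zero]
    exact fun ω h => Subtype.ext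
      (eq_zero_of_mem_wedgeForms p.flip hvol' hvol0' U' W' _ ω.2 (congrArg Subtype.val h))
  have hd := (LinearMap.finrank_le_finrank_of_injective hf).antisymm
    (LinearMap.finrank_le_finrank_of_injective hg)
  obtain ⟨ω, hω⟩ := ((LinearMap.injective_iff_surjective_of_finrank_eq_finrank hd).1 hf) ⟨η, hη⟩
  exact ⟨ω, ω.2, congrArg Subtype.val hω⟩

/-- The annihilator of `U` with respect to the perfect pairing has complementary dimension. -/
lemma finrank_add_finrank_annihilator [Module.Free ℤ X] [Module.Finite ℤ X] [Module.Free ℤ Y]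
    [Module.Finite ℤ Y] [p.IsPerfPair] (U : Submodule ℂ (ℂ ⊗[ℤ] Y)) (W' : Submodule ℂ (ℂ ⊗[ℤ] X))
    (h : ∀ w, w ∈ W' ↔ ∀ u ∈ U, pairing ℂ p w u = 0) :
    Module.finrank ℂ U + Module.finrank ℂ W' = Module.finrank ℂ (ℂ ⊗[ℤ] X) := by
  have h1 : W' = (U.map (pairing ℂ p.flip)).dualCoannihilator := by
    ext w
    rw [h, Submodule.mem_dualCoannihilator]
    simp [pairing_flip]
  rw [h1, ← Subspace.finrank_add_finrank_dualCoannihilator_eq (U.map (pairing ℂ p.flip)),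
    (Submodule.equivMapOfInjective _ (pairing_bijective p.flip ℂ).1 U).finrank_eq]

end Contraction

/-! ### Simplicial cones and their simplices -/

section Cones

variable {L : Type} [AddCommGroup L]

namespace StackyFan

variable (S : StackyFan L)

lemma linearIndependent_toReal {c : Finset L} (hc : c ∈ S.cones) :
    LinearIndependent ℝ fun ρ : c => toReal L (ρ : L) :=
  Module.Flat.linearIndependent_one_tmul (S.linearIndependent c hc)

/-- As the rays of a cone are linearly independent, a linear function on the cone can take any values
at them. -/
lemma exists_dual_eq {c : Finset L} (hc : c ∈ S.cones) (a : L → ℝ) :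
    ∃ f : Module.Dual ℝ (ℝ ⊗[ℤ] L), ∀ ρ ∈ c, f (toReal L ρ) = a ρ := by
  let b := Module.Basis.span (S.linearIndependent_toReal hc)
  obtain ⟨g, hg⟩ := LinearMap.exists_extend (b.constr ℝ fun ρ : c => a ρ)
  refine ⟨g, fun ρ hρ => ?_⟩
  have h1 := LinearMap.congr_fun hg (b ⟨ρ, hρ⟩)
  rw [Module.Basis.constr_basis, LinearMap.comp_apply] at h1
  rw [← h1]
  congr 1
  exact (congrArg Subtype.val
    (Module.Basis.span_apply (S.linearIndependent_toReal hc) ⟨ρ, hρ⟩)).symm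

/-- The functional dual to a ray of a simplicial cone: it takes the value `1` at the scaled ray
generator, and vanishes on the other rays. -/
lemma exists_dual_single {c : Finset L} (hc : c ∈ S.cones) {ρ : L} (hρ : ρ ∈ c) :
    ∃ f : Module.Dual ℝ (ℝ ⊗[ℤ] L), f (toReal L ((S.β ρ : ℕ) • ρ)) = 1 ∧
      ∀ σ ∈ c, σ ≠ ρ → f (toReal L ((S.β σ : ℕ) • σ)) = 0 ∧ f (toReal L σ) = 0 := by
  classical
  obtain ⟨f, hf⟩ := S.exists_dual_eq hc fun σ => if σ = ρ then ((S.β ρ : ℕ) : ℝ)⁻¹ else 0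
  refine ⟨f, ?_, fun σ hσ hne => ?_⟩
  · rw [map_nsmul, map_nsmul, hf ρ hρ, if_pos rfl, nsmul_eq_mul,
      mul_inv_cancel₀ (Nat.cast_ne_zero.2 (S.β ρ).ne_zero)]
  · rw [map_nsmul, map_nsmul, hf σ hσ, if_neg hne, smul_zero]
    exact ⟨rfl, rfl⟩

lemma toReal_mem_coneOver {s : Set L} {ρ : L} (hρ : ρ ∈ s) : toReal L ρ ∈ coneOver s :=
  Submodule.subset_span ⟨ρ, hρ, rfl⟩

lemma nonneg_of_mem_coneOver {s : Set L} (f : Module.Dual ℝ (ℝ ⊗[ℤ] L))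
    (hf : ∀ ρ ∈ s, 0 ≤ f (toReal L ρ)) {v : ℝ ⊗[ℤ] L} (hv : v ∈ coneOver s) : 0 ≤ f v := by
  induction hv using Submodule.span_induction with
  | mem v hv =>
    obtain ⟨ρ, hρ, rfl⟩ := hv
    exact hf ρ hρ
  | zero => rw [map_zero]
  | add v w _ _ hv hw => rw [map_add]; exact add_nonneg hv hw
  | smul a v _ hv =>
    rw [show f (a • v) = (a : ℝ) • f v from map_smul f (a : ℝ) v]
    exact mul_nonneg a.2 hv

lemma gens_mem_coneOver {s : Set L} {ρ : L} (hρ : ρ ∈ s) :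
    toReal L ((S.β ρ : ℕ) • ρ) ∈ coneOver s := by
  rw [map_nsmul]
  exact nsmul_mem (toReal_mem_coneOver hρ) _

/-- A ray of the fan that lies in a cone of the fan is a ray of that cone. -/
lemma mem_of_gens_mem_coneOver {c c' : Finset L} (hc : c ∈ S.cones) (hc' : c' ∈ S.cones) {ρ : L}
    (hρ : ρ ∈ c') (h : toReal L ((S.β ρ : ℕ) • ρ) ∈ coneOver (c : Set L)) : ρ ∈ c := by
  by_contra hn
  have h1 : toReal L ((S.β ρ : ℕ) • ρ) ∈ coneOver ((c : Set L) ∩ (c' : Set L)) := by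
    rw [← SetLike.mem_coe, ← S.inter_eq c hc c' hc']
    exact ⟨h, S.gens_mem_coneOver hρ⟩
  obtain ⟨f, hf1, hf2⟩ := S.exists_dual_single hc' hρ
  have h2 := nonneg_of_mem_coneOver (-f) (fun σ hσ => by
    rw [LinearMap.neg_apply, (hf2 σ hσ.2 fun h => hn (h ▸ hσ.1)).2, neg_zero]) h1
  rw [LinearMap.neg_apply, hf1] at h2
  linarith

lemma gens_ne_zero {c : Finset L} (hc : c ∈ S.cones) {ρ : L} (hρ : ρ ∈ c) :
    toReal L ((S.β ρ : ℕ) • ρ) ≠ 0 := by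
  obtain ⟨f, hf, -⟩ := S.exists_dual_single hc hρ
  intro h
  rw [h, map_zero] at hf
  exact zero_ne_one hf

lemma simplex_subset_coneOver (c : Finset L) : S.simplex c ⊆ coneOver (c : Set L) := by
  refine convexHull_min ?_ (coneOver (c : Set L)).toConvexCone.convex
  rintro _ (rfl | ⟨_, ⟨ρ, hρ, rfl⟩, rfl⟩)
  · exact Submodule.zero_mem _
  · exact S.gens_mem_coneOver hρ

lemma coneOver_subset_support {c : Finset L} (hc : c ∈ S.cones) {v : ℝ ⊗[ℤ] L}
    (hv : v ∈ coneOver (c : Set L)) : v ∈ S.support :=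
  Set.mem_biUnion hc hv

lemma zero_mem_simplex (c : Finset L) : 0 ∈ S.simplex c :=
  subset_convexHull ℝ _ (Set.mem_insert _ _)

lemma gens_mem_simplex {c : Finset L} {ρ : L} (hρ : ρ ∈ c) :
    toReal L ((S.β ρ : ℕ) • ρ) ∈ S.simplex c :=
  subset_convexHull ℝ _ (Set.mem_insert_of_mem _ ⟨_, ⟨ρ, hρ, rfl⟩, rfl⟩)

lemma simplex_mono {c c' : Finset L} (h : c ⊆ c') : S.simplex c ⊆ S.simplex c' :=
  convexHull_mono (Set.insert_subset_insert (Set.image_mono (Set.image_mono (by exact_mod_cast h))))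

lemma simplex_subset_iff {c c' : Finset L} (hc : c ∈ S.cones) (hc' : c' ∈ S.cones) :
    S.simplex c ⊆ S.simplex c' ↔ c ⊆ c' :=
  ⟨fun h _ hρ => S.mem_of_gens_mem_coneOver hc' hc hρ
    (S.simplex_subset_coneOver c' (h (S.gens_mem_simplex hρ))), S.simplex_mono⟩

lemma simplex_injOn {c c' : Finset L} (hc : c ∈ S.cones) (hc' : c' ∈ S.cones)
    (h : S.simplex c = S.simplex c') : c = c' :=
  ((S.simplex_subset_iff hc hc').1 h.subset).antisymm
    ((S.simplex_subset_iff hc' hc).1 h.superset)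

/-- The nonzero vertices of `Δ_c` are the scaled ray generators of `c`. -/
lemma extremePoints_simplex {c : Finset L} (hc : c ∈ S.cones) :
    (S.simplex c).extremePoints ℝ \ {0} = toReal L '' S.gens c := by
  apply subset_antisymm
  · rintro v ⟨hv, h0⟩
    exact (extremePoints_convexHull_subset hv).resolve_left h0
  · rintro _ ⟨_, ⟨ρ, hρ, rfl⟩, rfl⟩
    refine ⟨⟨S.gens_mem_simplex hρ, ?_⟩, S.gens_ne_zero hc hρ⟩
    obtain ⟨f, hf1, hf2⟩ := S.exists_dual_single hc hρ
    have hval : ∀ w ∈ insert 0 (toReal L '' S.gens c),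
        -1 ≤ (-f) w ∧ ((-f) w = -1 → w = toReal L ((S.β ρ : ℕ) • ρ)) := by
      rintro _ (rfl | ⟨_, ⟨σ, hσ, rfl⟩, rfl⟩)
      · simp
      · by_cases h : σ = ρ
        · subst h
          exact ⟨by rw [LinearMap.neg_apply]; exact (congrArg Neg.neg hf1).ge, fun _ => rfl⟩
        · have := (hf2 σ hσ h).1
          rw [LinearMap.neg_apply]
          simp only at this ⊢
          rw [this]
          simp
    have hle : ∀ w ∈ S.simplex c, -1 ≤ (-f) w := fun w hw =>
      convexHull_min (fun w hw => (hval w hw).1) (convex_halfSpace_ge (-f).isLinear _) hw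
    intro v hv w hw hmem
    obtain ⟨a, b, ha, hb, hab, h⟩ := hmem
    have e1 := hle v hv
    have e2 := hle w hw
    have e3 := congrArg (-f) h
    simp only [map_add, map_smul, smul_eq_mul, LinearMap.neg_apply] at e1 e2 e3
    rw [show f (toReal L ((S.β ρ : ℕ) • ρ)) = 1 from hf1] at e3
    have e4 : (-f) v = -1 := by
      rw [LinearMap.neg_apply]
      nlinarith
    have := mem_convexHull_inter _ (-f) (-1) (fun w hw => (hval w hw).1) v hv e4
    have h5 : {w ∈ insert 0 (toReal L '' S.gens c) | (-f) w = -1} ⊆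
        {toReal L ((S.β ρ : ℕ) • ρ)} := fun w hw => (hval w hw.1).2 hw.2
    have h6 := convexHull_mono (𝕜 := ℝ) h5 this
    rwa [convexHull_singleton] at h6

lemma exists_maximal {c : Finset L} (hc : c ∈ S.cones) :
    ∃ c', c ⊆ c' ∧ Maximal (· ∈ S.cones) c' :=
  S.finite.exists_le_maximal hc

lemma rays_finite : S.rays.Finite :=
  S.finite.biUnion fun c _ => (c.finite_toSet.image _)

lemma rays_subset_support {n : L} (hn : n ∈ S.rays) : toReal L n ∈ S.support := by
  simp only [rays, Set.mem_iUnion] at hn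
  obtain ⟨c, hc, ρ, hρ, rfl⟩ := hn
  exact S.coneOver_subset_support hc (S.gens_mem_coneOver hρ)

lemma zero_mem_support : 0 ∈ S.support :=
  S.coneOver_subset_support S.zero_mem (Submodule.zero_mem _)

lemma gens_mem_rays {c : Finset L} (hc : c ∈ S.cones) {ρ : L} (hρ : ρ ∈ c) :
    (S.β ρ : ℕ) • ρ ∈ S.rays :=
  Set.mem_biUnion hc ⟨ρ, hρ, rfl⟩

variable {S} in
lemma StrictlyConvex.map_zero {φ : ℝ ⊗[ℤ] L → ℝ} (hφ : S.StrictlyConvex φ) : φ 0 = 0 := by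
  obtain ⟨c, -, hc⟩ := S.exists_maximal S.zero_mem
  obtain ⟨l, hl⟩ := hφ c hc
  rw [← ((hl 0 S.zero_mem_support).2.2 (Submodule.zero_mem _)), LinearMap.map_zero]

end StackyFan

end Cones

/-! ### The cells of the regular subdivision at the origin -/

section Cells

variable {X Y : Type} [AddCommGroup X] [AddCommGroup Y] (p : X →ₗ[ℤ] Y →ₗ[ℤ] ℤ)
  (S : StackyFan X) (S' : StackyFan Y) {ψ : ℝ ⊗[ℤ] Y → ℝ}

variable {S'} in
/-- If a cell of the regular subdivision contains the origin, then the tropical polynomial attains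
its value at the origin: otherwise the origin would be a convex combination of points at which a
function that is bounded below by a linear one is negative. -/
lemma zero_mem_minimizers (hψ : S'.StrictlyConvex ψ) {u : ℝ ⊗[ℤ] X}
    (h : 0 ∈ convexHull ℝ
      (toReal Y '' minimizers p (insert 0 S'.rays) (fun m => ψ (toReal Y m)) u)) :
    0 ∈ minimizers p (insert 0 S'.rays) (fun m => ψ (toReal Y m)) u := by
  obtain ⟨m, hm⟩ : (minimizers p (insert 0 S'.rays) (fun m => ψ (toReal Y m)) u).Nonempty := by
    simpa using (convexHull_nonempty_iff (𝕜 := ℝ)).1 ⟨0, h⟩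
  obtain ⟨c, -, hc⟩ := S'.exists_maximal S'.zero_mem
  obtain ⟨l, hl⟩ := hψ c hc
  have hm0 := hm.2 0 (Set.mem_insert _ _)
  have hr : 0 ≤ pairing ℝ p u (toReal Y m) + ψ (toReal Y m) := by
    have h1 : ∀ v ∈ toReal Y '' minimizers p (insert 0 S'.rays) (fun m => ψ (toReal Y m)) u,
        (pairing ℝ p u + l) v ≤ pairing ℝ p u (toReal Y m) + ψ (toReal Y m) := by
      rintro _ ⟨k, hk, rfl⟩
      have h2 : toReal Y k ∈ S'.support := by
        rcases hk.1 with rfl | hk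
        · rw [map_zero]; exact S'.zero_mem_support
        · exact S'.rays_subset_support hk
      have h3 := (hl _ h2).1
      have h4 := hk.2 m hm.1
      rw [LinearMap.add_apply]
      linarith
    have h5 := convexHull_min h1 (convex_halfSpace_le (pairing ℝ p u + l).isLinear _) h
    have h6 : (pairing ℝ p u + l) 0 ≤ pairing ℝ p u (toReal Y m) + ψ (toReal Y m) := h5
    rwa [map_zero] at h6
  refine ⟨Set.mem_insert _ _, fun k hk => ?_⟩
  have := hm.2 k hk
  simp only [map_zero, hψ.map_zero] at hm0 ⊢
  linarith

variable {S'} in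
/-- The cells of the regular subdivision that contain the origin are simplices `Δ_c`.  The mean of
the minimizers lies in some `Δ_c` by convexity; comparing with the linear function that supports `ψ`
along `c` shows that all the minimizers lie in `c`. -/
lemma exists_eq_simplex (hconv : S'.IsConvex) (hψ : S'.StrictlyConvex ψ) {τ : Set (ℝ ⊗[ℤ] Y)}
    (hτ : τ ∈ subdivision p (insert 0 S'.rays) fun m => ψ (toReal Y m)) (h0 : 0 ∈ τ) :
    ∃ c ∈ S'.cones, τ = S'.simplex c := by
  classical
  obtain ⟨u, rfl⟩ := hτ
  set T := minimizers p (insert 0 S'.rays) (fun m => ψ (toReal Y m)) u with hT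
  have hT0 : 0 ∈ T := zero_mem_minimizers p hψ h0
  have hTA : T ⊆ insert 0 S'.rays := fun m hm => hm.1
  have hge : ∀ m ∈ insert 0 S'.rays, 0 ≤ pairing ℝ p u (toReal Y m) + ψ (toReal Y m) := by
    intro m hm
    simpa [hψ.map_zero] using hT0.2 m hm
  have hTz : ∀ m ∈ T, pairing ℝ p u (toReal Y m) + ψ (toReal Y m) = 0 := by
    intro m hm
    refine le_antisymm ?_ (hge m hm.1)
    simpa [hψ.map_zero] using hm.2 0 hT0.1
  have hTs : ∀ m ∈ T, toReal Y m ∈ S'.support := by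
    intro m hm
    rcases hTA hm with rfl | hm
    · rw [map_zero]; exact S'.zero_mem_support
    · exact S'.rays_subset_support hm
  have hfin : T.Finite := (S'.rays_finite.insert 0).subset hTA
  set F : Finset Y := hfin.toFinset with hF
  have hFT : ∀ m, m ∈ F ↔ m ∈ T := fun m => hfin.mem_toFinset
  have hFne : F.Nonempty := ⟨0, (hFT 0).2 hT0⟩
  set w : ℝ := (F.card : ℝ)⁻¹ with hw
  have hwpos : 0 < w := inv_pos.2 (Nat.cast_pos.2 hFne.card_pos)
  -- the mean of the minimizers
  set x : ℝ ⊗[ℤ] Y := ∑ m ∈ F, w • toReal Y m with hx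
  have hxmem : x ∈ ⋃ c ∈ S'.cones, S'.simplex c := by
    refine hconv.sum_mem (fun _ _ => hwpos.le) ?_ fun m hm => ?_
    · rw [Finset.sum_const, nsmul_eq_mul, hw,
        mul_inv_cancel₀ (Nat.cast_ne_zero.2 hFne.card_pos.ne')]
    · rcases hTA ((hFT m).1 hm) with rfl | hm
      · rw [map_zero]
        exact Set.mem_biUnion S'.zero_mem (S'.zero_mem_simplex _)
      · simp only [StackyFan.rays, Set.mem_iUnion] at hm
        obtain ⟨c, hc, ρ, hρ, rfl⟩ := hm
        exact Set.mem_biUnion hc (S'.gens_mem_simplex hρ)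
  simp only [Set.mem_iUnion] at hxmem
  obtain ⟨c₀, hc₀, hxc₀⟩ := hxmem
  obtain ⟨c, hle, hc⟩ := S'.exists_maximal hc₀
  have hxc : x ∈ S'.simplex c := S'.simplex_mono hle hxc₀
  obtain ⟨l, hl⟩ := hψ c hc
  -- at the mean, `⟨u, ·⟩ + l` is nonnegative, because it agrees with `⟨u, ·⟩ + ψ` on `c`; but it is
  -- nonpositive at every minimizer, so it vanishes at the minimizers, and these lie in `c`
  have h1 : 0 ≤ (pairing ℝ p u + l) x := by
    refine convexHull_min (s := insert 0 (toReal Y '' S'.gens c)) ?_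
      (convex_halfSpace_ge (pairing ℝ p u + l).isLinear 0) hxc
    rintro _ (rfl | ⟨_, ⟨ρ, hρ, rfl⟩, rfl⟩)
    · simp
    · have h2 := S'.gens_mem_coneOver (s := (c : Set Y)) hρ
      have h3 := (hl _ (S'.coneOver_subset_support hc.1 h2)).2.2 h2
      have h4 := hge _ (Set.mem_insert_of_mem _ (S'.gens_mem_rays hc.1 hρ))
      simp only [Set.mem_ofPred_eq, LinearMap.add_apply]
      rw [h3]
      exact h4
  have hterm : ∀ m ∈ F, (pairing ℝ p u + l) (w • toReal Y m) ≤ 0 := by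
    intro m hm
    rw [map_smul, smul_eq_mul, LinearMap.add_apply]
    have h2 := (hl _ (hTs m ((hFT m).1 hm))).1
    have h3 := hTz m ((hFT m).1 hm)
    exact mul_nonpos_of_nonneg_of_nonpos hwpos.le (by linarith)
  have hzero : ∀ m ∈ F, (pairing ℝ p u + l) (w • toReal Y m) = 0 := by
    refine (Finset.sum_eq_zero_iff_of_nonpos hterm).1 ?_
    rw [← map_sum]
    exact le_antisymm (by rw [map_sum]; exact Finset.sum_nonpos hterm) h1
  have hmem : ∀ m ∈ T, toReal Y m ∈ coneOver (c : Set Y) := by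
    intro m hm
    have h2 := hzero m ((hFT m).2 hm)
    rw [map_smul, smul_eq_mul, LinearMap.add_apply] at h2
    have h3 := (mul_eq_zero.1 h2).resolve_left hwpos.ne'
    exact (hl _ (hTs m hm)).2.1 (by linarith [hTz m hm])
  refine ⟨c.filter fun ρ => (S'.β ρ : ℕ) • ρ ∈ T,
    S'.face_mem c hc.1 _ (Finset.filter_subset _ _), ?_⟩
  unfold StackyFan.simplex
  congr 1
  ext v
  constructor
  · rintro ⟨m, hm, rfl⟩
    rcases hTA hm with rfl | hm'
    · rw [map_zero]; exact Set.mem_insert _ _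
    · simp only [StackyFan.rays, Set.mem_iUnion] at hm'
      obtain ⟨c', hc', ρ, hρ, rfl⟩ := hm'
      refine Set.mem_insert_of_mem _ ⟨_, ⟨ρ, ?_, rfl⟩, rfl⟩
      exact Finset.mem_coe.2 (Finset.mem_filter.2
        ⟨S'.mem_of_gens_mem_coneOver hc.1 hc' hρ (hmem _ hm), hm⟩)
  · rintro (rfl | ⟨_, ⟨ρ, hρ, rfl⟩, rfl⟩)
    · exact ⟨0, hT0, map_zero _⟩
    · exact ⟨_, (Finset.mem_filter.1 (Finset.mem_coe.1 hρ)).2, rfl⟩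

variable {S'} in
/-- Every simplex `Δ_c` is a cell of the regular subdivision: perturb the linear function that
supports `ψ` along a maximal cone containing `c`, so as to make it smaller on the other rays. -/
lemma simplex_mem_subdivision [Module.Free ℤ Y] [Module.Finite ℤ Y] [p.IsPerfPair]
    (hψ : S'.StrictlyConvex ψ) {c : Finset Y} (hc : c ∈ S'.cones) :
    S'.simplex c ∈ subdivision p (insert 0 S'.rays) fun m => ψ (toReal Y m) := by
  classical
  obtain ⟨c', hle, hc'⟩ := S'.exists_maximal hc
  obtain ⟨l, hl⟩ := hψ c' hc'
  obtain ⟨f, hf⟩ := S'.exists_dual_eq hc'.1 fun ρ => if ρ ∈ c then 0 else 1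
  -- a perturbation that is small enough to keep `l` below `ψ` at the rays outside of `c'`
  obtain ⟨ε, hε, hεb⟩ : ∃ ε : ℝ, 0 < ε ∧ ∀ m ∈ S'.rays, toReal Y m ∉ coneOver (c' : Set Y) →
      0 < ψ (toReal Y m) - l (toReal Y m) + ε * f (toReal Y m) := by
    have hfin := S'.rays_finite
    have key : ∀ m ∈ S'.rays, ∀ᶠ ε : ℝ in nhdsWithin 0 (Set.Ioi 0),
        toReal Y m ∉ coneOver (c' : Set Y) →
          0 < ψ (toReal Y m) - l (toReal Y m) + ε * f (toReal Y m) := by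
      intro m hm
      by_cases hmc : toReal Y m ∈ coneOver (c' : Set Y)
      · exact Filter.Eventually.of_forall fun _ h => absurd hmc h
      · have h1 := hl _ (S'.rays_subset_support hm)
        have h2 : 0 < ψ (toReal Y m) - l (toReal Y m) + 0 * f (toReal Y m) := by
          have := lt_of_le_of_ne h1.1 (mt h1.2.1 hmc)
          linarith
        have h3 : Continuous fun ε : ℝ => ψ (toReal Y m) - l (toReal Y m) + ε * f (toReal Y m) := by
          fun_prop
        exact ((h3.tendsto 0).eventually (lt_mem_nhds h2)).filter_mono nhdsWithin_le_nhds |>.mono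
          fun _ h _ => h
    have hall := (Filter.eventually_all_finite hfin).2 key
    obtain ⟨ε, h1, h2⟩ := (hall.and self_mem_nhdsWithin).exists
    exact ⟨ε, h2, h1⟩
  obtain ⟨u, hu⟩ := pairing_surjective p ℝ (ε • f - l)
  have hval : ∀ v, pairing ℝ p u v = ε * f v - l v := fun v => by
    rw [hu, LinearMap.sub_apply, LinearMap.smul_apply, smul_eq_mul]
  have hfβ : ∀ ρ, f (toReal Y ((S'.β ρ : ℕ) • ρ)) = (S'.β ρ : ℕ) * f (toReal Y ρ) := fun ρ => by
    rw [map_nsmul, map_nsmul, nsmul_eq_mul]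
  have hβ : ∀ ρ, (0 : ℝ) < (S'.β ρ : ℕ) := fun ρ => Nat.cast_pos.2 (S'.β ρ).pos
  have hz0 : pairing ℝ p u (toReal Y 0) + ψ (toReal Y 0) = 0 := by simp [hψ.map_zero]
  have hpos : ∀ m ∈ S'.rays, 0 ≤ pairing ℝ p u (toReal Y m) + ψ (toReal Y m) ∧
      (pairing ℝ p u (toReal Y m) + ψ (toReal Y m) = 0 ↔ m ∈ S'.gens c) := by
    intro m hm
    rw [hval]
    by_cases hmc : toReal Y m ∈ coneOver (c' : Set Y)
    · have h1 := (hl _ (S'.coneOver_subset_support hc'.1 hmc)).2.2 hmc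
      simp only [StackyFan.rays, Set.mem_iUnion] at hm
      obtain ⟨c'', hc'', ρ, hρ, rfl⟩ := hm
      have hρ' := S'.mem_of_gens_mem_coneOver hc'.1 hc'' hρ hmc
      simp only at h1 ⊢
      rw [h1, hfβ, hf ρ hρ']
      by_cases hρc : ρ ∈ c
      · simp only [hρc, if_true]
        exact ⟨by linarith, fun _ => ⟨ρ, hρc, rfl⟩, fun _ => by ring⟩
      · simp only [hρc, if_false]
        have := mul_pos hε (hβ ρ)
        refine ⟨by linarith, fun h => by linarith, ?_⟩
        rintro ⟨σ, hσ, he⟩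
        refine absurd (S'.mem_of_gens_mem_coneOver hc hc'' hρ ?_) hρc
        have he' : (S'.β σ : ℕ) • σ = (S'.β ρ : ℕ) • ρ := he
        rw [← he']
        exact S'.gens_mem_coneOver hσ
    · have h1 := hεb m hm hmc
      refine ⟨by linarith, fun h => by linarith, ?_⟩
      rintro ⟨σ, hσ, rfl⟩
      exact absurd (S'.gens_mem_coneOver (s := (c' : Set Y)) (hle hσ)) hmc
  refine ⟨u, ?_⟩
  unfold StackyFan.simplex
  congr 1
  have hmin : ∀ m, m ∈ minimizers p (insert 0 S'.rays) (fun m => ψ (toReal Y m)) u ↔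
      m = 0 ∨ m ∈ S'.gens c := by
    have hall : ∀ k ∈ insert 0 S'.rays, 0 ≤ pairing ℝ p u (toReal Y k) + ψ (toReal Y k) := by
      rintro k (rfl | hk)
      · exact hz0.ge
      · exact (hpos k hk).1
    intro m
    constructor
    · rintro ⟨rfl | hm, hmin⟩
      · exact Or.inl rfl
      · have h1 := hmin 0 (Set.mem_insert _ _)
        simp only [hz0] at h1
        exact Or.inr ((hpos m hm).2.1 (h1.antisymm (hpos m hm).1))
    · rintro (rfl | hm)
      · exact ⟨Set.mem_insert _ _, fun k hk => by simp only [hz0]; exact hall k hk⟩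
      · have hm' : m ∈ S'.rays := Set.mem_biUnion hc hm
        exact ⟨Set.mem_insert_of_mem _ hm', fun k hk => by
          simp only [(hpos m hm').2.2 hm]; exact hall k hk⟩
  ext v
  constructor
  · rintro (rfl | ⟨m, hm, rfl⟩)
    · exact ⟨0, (hmin 0).2 (Or.inl rfl), map_zero _⟩
    · exact ⟨m, (hmin m).2 (Or.inr hm), rfl⟩
  · rintro ⟨m, hm, rfl⟩
    rcases (hmin m).1 hm with rfl | hm
    · rw [map_zero]; exact Set.mem_insert _ _
    · exact Set.mem_insert_of_mem _ ⟨m, hm, rfl⟩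

variable {p S S'} in
/-- A cone orthogonal to `c'` lies in the normal cone of the minimal face containing `Δ_c'`. -/
lemma coneOver_subset_normalCone
    (hnonneg : ∀ m ∈ S.support, ∀ n ∈ S'.support, 0 ≤ pairing ℝ p m n) {c : Finset X}
    (hc : c ∈ S.cones) {c' : Finset Y} (hc' : c' ∈ S'.cones) (h : ∀ ρ ∈ c, ∀ σ ∈ c', p ρ σ = 0) :
    (coneOver (c : Set X) : Set (ℝ ⊗[ℤ] X)) ⊆
      normalCone p (convexHull ℝ (toReal Y '' insert 0 S'.rays))
        (minimalFace (convexHull ℝ (toReal Y '' insert 0 S'.rays)) (S'.simplex c')) := by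
  intro u hu
  have hge : ∀ w ∈ convexHull ℝ (toReal Y '' insert 0 S'.rays), 0 ≤ pairing ℝ p u w := by
    intro w hw
    refine convexHull_min ?_ (convex_halfSpace_ge (pairing ℝ p u).isLinear 0) hw
    rintro _ ⟨m, rfl | hm, rfl⟩
    · simp
    · exact hnonneg u (S.coneOver_subset_support hc hu) _ (S'.rays_subset_support hm)
  have hz : ∀ w ∈ S'.simplex c', pairing ℝ p u w = 0 := by
    have h1 : ∀ v ∈ coneOver (c' : Set Y), pairing ℝ p u v = 0 := by
      have h2 : ∀ ρ ∈ c, ∀ σ ∈ c', pairing ℝ p (toReal X ρ) (toReal Y σ) = 0 := by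
        intro ρ hρ σ hσ
        refine (pairing_tmul ℝ p 1 1 ρ σ).trans ?_
        rw [h ρ hρ σ hσ]
        simp
      intro v hv
      have h3 : ∀ s : ℝ, s * pairing ℝ p u v ≥ 0 := by
        intro s
        refine StackyFan.nonneg_of_mem_coneOver (s • pairing ℝ p u) (fun σ hσ => ?_) hv
        refine StackyFan.nonneg_of_mem_coneOver (s • (pairing ℝ p).flip (toReal Y σ))
          (fun ρ hρ => ?_) hu
        simp [h2 ρ hρ σ hσ]
      linarith [h3 1, h3 (-1)]
    exact fun w hw => h1 w (S'.simplex_subset_coneOver c' hw)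
  have h0 : (0 : ℝ ⊗[ℤ] Y) ∈ convexHull ℝ (toReal Y '' insert 0 S'.rays) :=
    subset_convexHull ℝ _ ⟨0, Set.mem_insert _ _, map_zero _⟩
  have hsub : S'.simplex c' ⊆ convexHull ℝ (toReal Y '' insert 0 S'.rays) := by
    refine convexHull_mono ?_
    rintro _ (rfl | ⟨m, hm, rfl⟩)
    · exact ⟨0, Set.mem_insert _ _, map_zero _⟩
    · exact ⟨m, Set.mem_insert_of_mem _ (Set.mem_biUnion hc' hm), rfl⟩
  intro v hv w hw
  have hface : v ∈ {v ∈ convexHull ℝ (toReal Y '' insert 0 S'.rays) |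
      ∀ w ∈ convexHull ℝ (toReal Y '' insert 0 S'.rays), pairing ℝ p u v ≤ pairing ℝ p u w} :=
    hv _ ⟨⟨pairing ℝ p u, rfl⟩, fun z hz' => ⟨hsub hz', fun w hw => by
      rw [hz z hz']; exact hge w hw⟩⟩
  exact hface.2 w hw

end Cells

/-! ### The duality of tropical complexes -/

section DualCells

variable {X Y : Type} [AddCommGroup X] [AddCommGroup Y] {p : X →ₗ[ℤ] Y →ₗ[ℤ] ℤ}
  {S : StackyFan X} {S' : StackyFan Y} {φ : ℝ ⊗[ℤ] X → ℝ} {ψ : ℝ ⊗[ℤ] Y → ℝ}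

lemma IsClarkeDual.flip (h : IsClarkeDual p S S') : IsClarkeDual p.flip S' S where
  quasiprojective_left := h.quasiprojective_right
  quasiprojective_right := h.quasiprojective_left
  nonneg n hn m hm := by
    rw [pairing_flip]
    exact h.nonneg m hm n hn
  convex_left := h.convex_right
  convex_right := h.convex_left

/-- The cell `(c, Δ_c')` of the tropical complex, for orthogonal cones `c` and `c'`. -/
noncomputable def cellOfCones [Module.Free ℤ Y] [Module.Finite ℤ Y] [p.IsPerfPair]
    (hSS' : IsClarkeDual p S S') (hψ : S'.StrictlyConvex ψ) {c : Finset X} (hc : c ∈ S.cones)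
    {c' : Finset Y} (hc' : c' ∈ S'.cones) (h : ∀ ρ ∈ c, ∀ σ ∈ c', p ρ σ = 0) : Trop p S S' ψ where
  cone := c
  cone_mem := hc
  simplex := S'.simplex c'
  simplex_mem := simplex_mem_subdivision p hψ hc'
  zero_mem := S'.zero_mem_simplex c'
  cone_subset := coneOver_subset_normalCone hSS'.nonneg hc hc' h

lemma TropCell.pairing_eq_zero {A : Set Y} {ν : Y → ℝ} (x : TropCell p S A ν) {ρ : X}
    (hρ : ρ ∈ x.cone) {v : ℝ ⊗[ℤ] Y} (hv : v ∈ x.simplex) : pairing ℝ p (toReal X ρ) v = 0 := by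
  have h : realToComplex Y v ∈ x.perp := x.lin_le_perp (Submodule.subset_span ⟨v, hv, rfl⟩)
  simp only [TropCell.perp, Submodule.mem_iInf, LinearMap.mem_ker] at h
  have h1 := h ρ hρ
  rw [pairing_realToComplex] at h1
  exact_mod_cast h1

lemma TropCell.apply_eq_zero (x : Trop p S S' ψ) {c' : Finset Y}
    (h : x.simplex = S'.simplex c') {ρ : X} (hρ : ρ ∈ x.cone) {σ : Y} (hσ : σ ∈ c') :
    p ρ σ = 0 := by
  have h1 := x.pairing_eq_zero hρ (h ▸ S'.gens_mem_simplex hσ)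
  rw [map_nsmul, map_nsmul, smul_eq_zero] at h1
  have h2 := h1.resolve_left (S'.β σ).ne_zero
  rw [show toReal X ρ = 1 ⊗ₜ ρ from rfl, show toReal Y σ = 1 ⊗ₜ σ from rfl, pairing_tmul] at h2
  simpa using h2

lemma TropCell.exists_simplex_eq (hSS' : IsClarkeDual p S S') (hψ : S'.StrictlyConvex ψ)
    (x : Trop p S S' ψ) : ∃ c' ∈ S'.cones, x.simplex = S'.simplex c' :=
  exists_eq_simplex p hSS'.convex_right hψ x.simplex_mem x.zero_mem

lemma realToComplex_toReal (σ : Y) : realToComplex Y (toReal Y σ) = 1 ⊗ₜ σ := by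
  rw [show toReal Y σ = 1 ⊗ₜ σ from rfl, realToComplex, AlgebraTensorModule.map_tmul]
  simp

lemma realToComplex_mem_span {s : Set Y} {v : ℝ ⊗[ℤ] Y} (hv : v ∈ coneOver s) :
    realToComplex Y v ∈ Submodule.span ℂ ((fun σ : Y => (1 : ℂ) ⊗ₜ[ℤ] σ) '' s) := by
  induction hv using Submodule.span_induction with
  | mem v hv =>
    obtain ⟨σ, hc, rfl⟩ := hv
    exact Submodule.subset_span ⟨σ, hc, (realToComplex_toReal σ).symm⟩
  | zero => rw [map_zero]; exact zero_mem _
  | add v w _ _ hv hw => rw [map_add]; exact add_mem hv hw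
  | smul a v _ hv =>
    rw [show realToComplex Y (a • v) = ((a : ℝ) : ℂ) • realToComplex Y v from
      map_smul (realToComplex Y) (a : ℝ) v]
    exact Submodule.smul_mem _ _ hv

lemma TropCell.vertices_eq (x : Trop p S S' ψ) {c' : Finset Y} (hc' : c' ∈ S'.cones)
    (h : x.simplex = S'.simplex c') : x.vertices = toReal Y '' S'.gens c' := by
  rw [TropCell.vertices, h, S'.extremePoints_simplex hc']

lemma TropCell.lin_eq (x : Trop p S S' ψ) {c' : Finset Y} (h : x.simplex = S'.simplex c') :
    x.lin = Submodule.span ℂ ((fun σ : Y => (1 : ℂ) ⊗ₜ[ℤ] σ) '' (c' : Set Y)) := by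
  apply le_antisymm
  · rw [TropCell.lin, Submodule.span_le, h]
    rintro _ ⟨v, hv, rfl⟩
    exact realToComplex_mem_span (S'.simplex_subset_coneOver c' hv)
  · rw [Submodule.span_le]
    rintro _ ⟨σ, hc, rfl⟩
    have h1 : realToComplex Y (toReal Y ((S'.β σ : ℕ) • σ)) ∈ x.lin :=
      Submodule.subset_span ⟨_, h ▸ S'.gens_mem_simplex hc, rfl⟩
    rw [map_nsmul, map_nsmul, realToComplex_toReal, ← Nat.cast_smul_eq_nsmul ℂ] at h1
    exact (Submodule.smul_mem_iff _ (Nat.cast_ne_zero.2 (S'.β σ).ne_zero)).1 h1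

/-- The annihilator of `L(Δ_c')` is the space `c'^⊥` of a cell `y = (c', τ)`. -/
lemma TropCell.mem_perp_iff (x : Trop p S S' ψ) (y : Trop p.flip S' S φ)
    (h : x.simplex = S'.simplex y.cone) (w : ℂ ⊗[ℤ] X) :
    w ∈ y.perp ↔ ∀ u ∈ x.lin, pairing ℂ p w u = 0 := by
  rw [x.lin_eq h]
  simp only [TropCell.perp, Submodule.mem_iInf, LinearMap.mem_ker, pairing_flip,
    LinearMap.flip_apply]
  constructor
  · intro hw u hu
    induction hu using Submodule.span_induction with
    | mem u hu =>
      obtain ⟨σ, hσ, rfl⟩ := hu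
      exact hw σ hσ
    | zero => rw [map_zero]
    | add u v _ _ hu hv => rw [map_add, hu, hv, add_zero]
    | smul a u _ hu => rw [map_smul, hu, smul_zero]
  · exact fun hw σ hσ => hw _ (Submodule.subset_span ⟨σ, hσ, rfl⟩)

variable [Module.Free ℤ X] [Module.Finite ℤ X] [p.IsPerfPair]

/-- The dual cell: the cell `(c', Δ_c)`, for a cell `(c, Δ_c')`. -/
noncomputable def dualCell (hSS' : IsClarkeDual p S S') (hφ : S.StrictlyConvex φ)
    (hψ : S'.StrictlyConvex ψ) (x : Trop p S S' ψ) : Trop p.flip S' S φ :=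
  cellOfCones hSS'.flip hφ (TropCell.exists_simplex_eq hSS' hψ x).choose_spec.1 x.cone_mem
    fun _ hσ _ hρ => x.apply_eq_zero (TropCell.exists_simplex_eq hSS' hψ x).choose_spec.2 hρ hσ

lemma simplex_eq_dualCell (hSS' : IsClarkeDual p S S') (hφ : S.StrictlyConvex φ)
    (hψ : S'.StrictlyConvex ψ) (x : Trop p S S' ψ) :
    x.simplex = S'.simplex (dualCell hSS' hφ hψ x).cone :=
  (TropCell.exists_simplex_eq hSS' hψ x).choose_spec.2

variable [Module.Free ℤ Y] [Module.Finite ℤ Y]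

/-- Passing to the dual cell is an isomorphism of posets. -/
noncomputable def dualIso (hSS' : IsClarkeDual p S S') (hφ : S.StrictlyConvex φ)
    (hψ : S'.StrictlyConvex ψ) : Trop p S S' ψ ≃o Trop p.flip S' S φ :=
  RelIso.ofSurjective
    (OrderEmbedding.ofMapLEIff (dualCell hSS' hφ hψ) fun x y => by
      have h1 : (dualCell hSS' hφ hψ y).simplex ⊆ (dualCell hSS' hφ hψ x).simplex ↔
          y.cone ⊆ x.cone := S.simplex_subset_iff y.cone_mem x.cone_mem
      have h2 : y.simplex ⊆ x.simplex ↔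
          (dualCell hSS' hφ hψ y).cone ⊆ (dualCell hSS' hφ hψ x).cone := by
        rw [simplex_eq_dualCell hSS' hφ hψ x, simplex_eq_dualCell hSS' hφ hψ y]
        exact S'.simplex_subset_iff (TropCell.cone_mem _) (TropCell.cone_mem _)
      exact (and_congr h2.symm h1).trans and_comm)
    fun y => by
      obtain ⟨c, hc, hyc⟩ := TropCell.exists_simplex_eq hSS'.flip hφ y
      refine ⟨cellOfCones hSS' hψ hc y.cone_mem fun ρ hρ σ hσ => y.apply_eq_zero hyc hσ hρ, ?_⟩
      refine TropCell.ext ?_ hyc.symm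
      exact (S'.simplex_injOn y.cone_mem (TropCell.cone_mem _)
        (simplex_eq_dualCell hSS' hφ hψ (cellOfCones hSS' hψ hc y.cone_mem _))).symm

lemma dualIso_simplex (hSS' : IsClarkeDual p S S') (hφ : S.StrictlyConvex φ)
    (hψ : S'.StrictlyConvex ψ) (x : Trop p S S' ψ) :
    (dualIso hSS' hφ hψ x).simplex = S.simplex x.cone := rfl

lemma simplex_eq_dualIso (hSS' : IsClarkeDual p S S') (hφ : S.StrictlyConvex φ)
    (hψ : S'.StrictlyConvex ψ) (x : Trop p S S' ψ) :
    x.simplex = S'.simplex (dualIso hSS' hφ hψ x).cone := simplex_eq_dualCell hSS' hφ hψ x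

end DualCells

/-! ### Box points and twisted sectors -/

section BoxPoints

variable {L : Type} [AddCommGroup L] (S : StackyFan L)

namespace StackyFan

/-- The coefficients of a point of a simplicial cone in terms of the scaled ray generators are
determined by the point. -/
lemma coeff_eq {c : Finset L} (hc : c ∈ S.cones) {a a' : ℝ ⊗[ℤ] L →₀ ℚ}
    (ha : (a.support : Set (ℝ ⊗[ℤ] L)) ⊆ toReal L '' S.gens c)
    (ha' : (a'.support : Set (ℝ ⊗[ℤ] L)) ⊆ toReal L '' S.gens c)
    (h : (a.sum fun v t => (t : ℝ) • v) = a'.sum fun v t => (t : ℝ) • v) : a = a' := by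
  have key : ∀ {ρ : L}, ρ ∈ c → ∃ f : Module.Dual ℝ (ℝ ⊗[ℤ] L), ∀ a : ℝ ⊗[ℤ] L →₀ ℚ,
      (a.support : Set (ℝ ⊗[ℤ] L)) ⊆ toReal L '' S.gens c →
        f (a.sum fun v t => (t : ℝ) • v) = a (toReal L ((S.β ρ : ℕ) • ρ)) := by
    intro ρ hρ
    obtain ⟨f, hf1, hf2⟩ := S.exists_dual_single hc hρ
    refine ⟨f, fun a ha => ?_⟩
    rw [Finsupp.sum, map_sum, Finset.sum_eq_single (toReal L ((S.β ρ : ℕ) • ρ))]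
    · rw [map_smul, hf1, smul_eq_mul, mul_one]
    · intro v hv hne
      obtain ⟨_, ⟨σ, hσ, rfl⟩, rfl⟩ := ha hv
      have : σ ≠ ρ := fun h => hne (h ▸ rfl)
      rw [map_smul, (hf2 σ hσ this).1, smul_zero]
    · intro h0
      rw [Finsupp.notMem_support_iff.1 h0, Rat.cast_zero, zero_smul, map_zero]
  ext v
  by_cases hv : v ∈ toReal L '' S.gens c
  · obtain ⟨_, ⟨ρ, hρ, rfl⟩, rfl⟩ := hv
    obtain ⟨f, hf⟩ := key hρ
    have h1 := congrArg f h
    rw [hf a ha, hf a' ha'] at h1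
    exact_mod_cast h1
  · rw [Finsupp.notMem_support_iff.1 fun h => hv (ha h),
      Finsupp.notMem_support_iff.1 fun h => hv (ha' h)]

lemma image_gens_injOn {c c' : Finset L} (hc : c ∈ S.cones) (hc' : c' ∈ S.cones)
    (h : toReal L '' S.gens c = toReal L '' S.gens c') : c = c' := by
  refine S.simplex_injOn hc hc' ?_
  unfold simplex
  rw [h]

lemma gens_mono {c c' : Finset L} (h : c ⊆ c') :
    toReal L '' S.gens c ⊆ toReal L '' S.gens c' :=
  Set.image_mono (Set.image_mono (by exact_mod_cast h))

lemma box_injOn {c : Finset L} (hc : c ∈ S.cones) {g g' : L × ℚ}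
    (hg : g ∈ box (toReal L '' S.gens c)) (hg' : g' ∈ box (toReal L '' S.gens c))
    (h : g.1 = g'.1) : g = g' := by
  obtain ⟨a, ha, -, hs, ht⟩ := hg
  obtain ⟨a', ha', -, hs', ht'⟩ := hg'
  have : a = a' := S.coeff_eq hc ha ha' (by rw [hs, hs', h])
  exact Prod.ext h (by rw [← ht, ← ht', this])

/-- Every element of `Box(c)` lies in `Box°` of a face of `c`. -/
lemma exists_face_boxInterior {c : Finset L} {g : L × ℚ}
    (hg : g ∈ box (toReal L '' S.gens c)) :
    ∃ c' ⊆ c, g ∈ boxInterior (toReal L '' S.gens c') := by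
  classical
  obtain ⟨a, ha, h⟩ := hg
  refine ⟨c.filter fun ρ => toReal L ((S.β ρ : ℕ) • ρ) ∈ a.support, Finset.filter_subset _ _, a,
    ?_, h⟩
  ext v
  constructor
  · intro hv
    obtain ⟨_, ⟨ρ, hρ, rfl⟩, rfl⟩ := ha hv
    exact ⟨_, ⟨ρ, Finset.mem_coe.2 (Finset.mem_filter.2 ⟨hρ, hv⟩), rfl⟩, rfl⟩
  · rintro ⟨_, ⟨ρ, hρ, rfl⟩, rfl⟩
    exact (Finset.mem_filter.1 (Finset.mem_coe.1 hρ)).2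

/-- A box element of a cone lies in `Box°` of only one of its faces. -/
lemma Sector.eq_of_elt_eq {S : StackyFan L} {s t : S.Sector} {c : Finset L} (hc : c ∈ S.cones)
    (hs : s.cone ⊆ c) (ht : t.cone ⊆ c) (h : s.elt = t.elt) : s = t := by
  obtain ⟨c₁, hc₁, g, hg⟩ := s
  obtain ⟨c₂, hc₂, g', hg'⟩ := t
  obtain rfl : g = g' := h
  suffices c₁ = c₂ by subst this; rfl
  have hs : c₁ ⊆ c := hs
  have ht : c₂ ⊆ c := ht
  obtain ⟨a, ha, -, hs', -⟩ := hg
  obtain ⟨a', ha', -, ht', -⟩ := hg'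
  have : a = a' := S.coeff_eq hc (ha.subset.trans (S.gens_mono hs))
    (ha'.subset.trans (S.gens_mono ht)) (by rw [hs', ht'])
  exact S.image_gens_injOn hc₁ hc₂ (by rw [← ha, ← ha', this])

/-- Box points have bounded coordinates, and their ages are determined by them. -/
lemma box_finite [Module.Free ℤ L] [Module.Finite ℤ L] {c : Finset L} (hc : c ∈ S.cones) :
    (box (toReal L '' S.gens c)).Finite := by
  let b := Module.Free.chooseBasis ℤ L
  have hfin : (toReal L '' S.gens c).Finite := (c.finite_toSet.image _).image _
  let f (i : Module.Free.ChooseBasisIndex ℤ L) : Module.Dual ℝ (ℝ ⊗[ℤ] L) :=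
    (b.baseChange ℝ).coord i
  have hf : ∀ i (g : L), f i (toReal L g) = (b.repr g i : ℤ) := by
    intro i g
    rw [show toReal L g = 1 ⊗ₜ g from rfl]
    simp [f]
  let B (i : Module.Free.ChooseBasisIndex ℤ L) : ℝ := ∑ v ∈ hfin.toFinset, |f i v|
  have hbound : ∀ g ∈ box (toReal L '' S.gens c), ∀ i, |((b.repr g.1 i : ℤ) : ℝ)| ≤ B i := by
    rintro g ⟨a, ha, ha1, hs, -⟩ i
    rw [← hf, ← hs, Finsupp.sum, map_sum]
    refine (Finset.abs_sum_le_sum_abs _ _).trans ?_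
    refine (Finset.sum_le_sum (g := fun v => |f i v|) fun v _ => ?_).trans
      (Finset.sum_le_sum_of_subset_of_nonneg (fun v hv => hfin.mem_toFinset.2 (ha hv))
        fun v _ _ => abs_nonneg _)
    rw [map_smul, smul_eq_mul, abs_mul]
    have h1 : (0 : ℝ) ≤ a v := by exact_mod_cast (ha1 v).1
    have h2 : (a v : ℝ) ≤ 1 := by exact_mod_cast (ha1 v).2.le
    rw [abs_of_nonneg h1]
    exact mul_le_of_le_one_left (abs_nonneg _) h2
  have hicc : (Set.Icc (fun i => ⌊-B i⌋) fun i => ⌈B i⌉).Finite := Set.finite_Icc _ _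
  refine Set.Finite.of_injOn (f := fun g => (fun i => b.repr g.1 i)) (fun g hg => ?_) ?_ hicc
  · refine ⟨fun i => ?_, fun i => ?_⟩
    · have := (abs_le.1 (hbound g hg i)).1
      exact_mod_cast (Int.floor_le _).trans this
    · have := (abs_le.1 (hbound g hg i)).2
      exact_mod_cast this.trans (Int.le_ceil _)
  · intro g hg g' hg' h
    exact S.box_injOn hc hg hg' (b.repr.injective (Finsupp.ext fun i => congrFun h i))

instance [Module.Free ℤ L] [Module.Finite ℤ L] : Finite S.Sector := by
  have : Finite S.cones := S.finite
  have (c : S.cones) : Finite (boxInterior (toReal L '' S.gens (c : Finset L))) :=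
    (S.box_finite c.2).subset (boxInterior_subset_box _)
  let F : S.Sector → Σ c : S.cones, boxInterior (toReal L '' S.gens (c : Finset L)) :=
    fun s => ⟨⟨s.cone, s.cone_mem⟩, ⟨s.elt, s.elt_mem⟩⟩
  refine Finite.of_injective F fun s t h => ?_
  have h1 : s.cone = t.cone := congrArg (fun z => (z.1 : Finset L)) h
  have h2 : s.elt = t.elt := congrArg (fun z => (z.2 : L × ℚ)) h
  exact Sector.eq_of_elt_eq s.cone_mem subset_rfl h1.superset h2

end StackyFan

end BoxPoints

/-! ### Decomposition into twisted sectors -/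

section Sectors

variable {X Y : Type} [AddCommGroup X] [AddCommGroup Y] {p : X →ₗ[ℤ] Y →ₗ[ℤ] ℤ}
  {S : StackyFan X} {A : Set Y} {ν : Y → ℝ} [Module.Finite ℤ Y]

/-- A section of `Jorb` is determined by its components in the twisted sectors, since every box
element of the cone `c` lies in `Box°` of a face. -/
lemma eq_zero_of_sectorProj_eq_zero (lam mu : ℚ) (mu' : S.Sector → ℚ)
    (h : ∀ s, mu' s + s.age = mu) (x : TropCell p S A ν) (v : (Jorb p S A ν lam mu).obj x)
    (hv : ∀ (s : S.Sector) (hs : s.cone ⊆ x.cone),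
      (sectorProj p S A ν s lam mu (mu' s) (h s)).app ⟨x, hs⟩ v = 0) : v = 0 := by
  refine Subtype.ext (Finsupp.ext fun g => ?_)
  by_cases hg : g.1 ∈ box x.gens
  · obtain ⟨c', hc', hgc'⟩ := S.exists_face_boxInterior hg
    let s : S.Sector := ⟨c', S.face_mem _ x.cone_mem _ hc', g.1, hgc'⟩
    exact DFunLike.congr_fun (congrArg Subtype.val (hv s hc')) g.2
  · exact (v.2 g).2 fun h => hg h.1

/-- The components of a section of `Jorb` in the twisted sectors can be prescribed, since the sets
`Box°` of the faces of a cone are disjoint. -/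
lemma exists_sectorProj_eq [Module.Free ℤ X] [Module.Finite ℤ X] (lam mu : ℚ) (mu' : S.Sector → ℚ)
    (h : ∀ s, mu' s + s.age = mu) (x : TropCell p S A ν)
    (w : ∀ (s : S.Sector) (hs : s.cone ⊆ x.cone),
      (pullback (Stratum.incl p S A ν s.cone) (J p S A ν (lam - s.age) (mu' s))).obj ⟨x, hs⟩) :
    ∃ v : (Jorb p S A ν lam mu).obj x, ∀ (s : S.Sector) (hs : s.cone ⊆ x.cone),
      (sectorProj p S A ν s lam mu (mu' s) (h s)).app ⟨x, hs⟩ v = w s hs := by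
  classical
  have := Fintype.ofFinite S.Sector
  let E (g : (X × ℚ) × (Y × ℚ)) := x.forms (lam + g.2.2 - g.1.2)
  let T : Set ((X × ℚ) × (Y × ℚ)) :=
    {g | g.1 ∈ box x.gens ∧ g.2 ∈ box x.vertices ∧ g.1.2 + g.2.2 = mu}
  let v (s : S.Sector) : (X × ℚ) × (Y × ℚ) →₀ ExteriorAlgebra ℂ (ℂ ⊗[ℤ] Y) :=
    if hs : s.cone ⊆ x.cone then (Subtype.val (w s hs)).mapDomain (Prod.mk s.elt) else 0
  have hv1 : ∀ s (hs : s.cone ⊆ x.cone) b, v s (s.elt, b) = Subtype.val (w s hs) b := by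
    intro s hs b
    simp only [v, dif_pos hs]
    exact Finsupp.mapDomain_apply (Prod.mk_right_injective _) _ _
  have hv2 : ∀ s g, g.1 ≠ s.elt → v s g = 0 := by
    intro s g hg
    simp only [v]
    split_ifs with hs
    · refine Finsupp.mapDomain_of_notMem_range _ _ ?_
      rintro ⟨b, rfl⟩
      exact hg rfl
    · rfl
  have hv3 : ∀ s, ¬s.cone ⊆ x.cone → v s = 0 := fun s hs => dif_neg hs
  have hvmem : ∀ s, v s ∈ maskedSum T E := by
    intro s
    by_cases hs : s.cone ⊆ x.cone
    · rintro ⟨g, b⟩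
      by_cases hg : g = s.elt
      · subst hg
        rw [hv1 s hs]
        obtain ⟨h1, h2⟩ := (w s hs).2 b
        by_cases hb : b ∈ box x.vertices ∧ b.2 = mu' s
        · refine ⟨?_, fun hT => absurd ⟨?_, hb.1, ?_⟩ hT⟩
          · have e : lam + b.2 - s.elt.2 = lam - s.age + mu' s := by
              rw [hb.2, StackyFan.Sector.age]; ring
            simp only [E, e]
            exact h1
          · exact box_mono (S.gens_mono hs) (boxInterior_subset_box _ s.elt_mem)
          · rw [hb.2, add_comm]
            exact h s
        · rw [h2 hb]
          exact ⟨zero_mem _, fun _ => rfl⟩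
      · rw [hv2 s (g, b) hg]
        exact ⟨zero_mem _, fun _ => rfl⟩
    · rw [hv3 s hs]
      exact zero_mem _
  refine ⟨⟨∑ s, v s, Submodule.sum_mem _ fun s _ => hvmem s⟩, fun t ht => ?_⟩
  refine Subtype.ext (Finsupp.ext fun b => ?_)
  refine Eq.trans ?_ (hv1 t ht b)
  refine (Finsupp.finsetSum_apply _ _ _).trans (Finset.sum_eq_single t ?_ ?_)
  · intro s _ hst
    by_cases hs : s.cone ⊆ x.cone
    · exact hv2 s _ fun he => hst
        (StackyFan.Sector.eq_of_elt_eq x.cone_mem hs ht he.symm)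
    · rw [hv3 s hs]; rfl
  · exact fun h => absurd (Finset.mem_univ t) h

/-- The cohomology of the orbifold tropical Jacobian sheaf is the direct sum of the contributions of
the twisted sectors, because `Box(c)` is the disjoint union of the sets `Box°` of the faces
of `c`. -/
lemma sector_bijective [Module.Free ℤ X] [Module.Finite ℤ X] (lam mu : ℚ) (mu' : S.Sector → ℚ)
    (h : ∀ s, mu' s + s.age = mu) (n : ℕ) :
    Function.Bijective fun (x : H (Jorb p S A ν lam mu) n) (s : S.Sector) =>
      H.map (sectorProj p S A ν s lam mu (mu' s) (h s))
        (H.pullback (Stratum.incl p S A ν s.cone) x) :=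
  cohomology_bijective_of_strata (fun (s : S.Sector) (x : TropCell p S A ν) => s.cone ⊆ x.cone)
    (fun _ _ _ hxy hs => hs.trans (show _ ∧ _ from hxy).1) (Jorb p S A ν lam mu)
    (fun s => pullback (Stratum.incl p S A ν s.cone) (J p S A ν (lam - s.age) (mu' s)))
    (fun s => sectorProj p S A ν s lam mu (mu' s) (h s))
    (eq_zero_of_sectorProj_eq_zero lam mu mu' h) (exists_sectorProj_eq lam mu mu' h) n

end Sectors

/-! ### The isomorphism of orbifold Jacobian sheaves -/

section DualSheaf

variable {X Y : Type} [AddCommGroup X] [AddCommGroup Y] {p : X →ₗ[ℤ] Y →ₗ[ℤ] ℤ}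
  {S : StackyFan X} {S' : StackyFan Y} {φ : ℝ ⊗[ℤ] X → ℝ} {ψ : ℝ ⊗[ℤ] Y → ℝ}
  [Module.Free ℤ X] [Module.Finite ℤ X] [Module.Free ℤ Y] [Module.Finite ℤ Y] [p.IsPerfPair]
  (hSS' : IsClarkeDual p S S') (hφ : S.StrictlyConvex φ) (hψ : S'.StrictlyConvex ψ)

lemma dualIso_gens (x : Trop p S S' ψ) : (dualIso hSS' hφ hψ x).gens = x.vertices :=
  (x.vertices_eq (TropCell.cone_mem _) (simplex_eq_dualIso hSS' hφ hψ x)).symm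

lemma dualIso_vertices (x : Trop p S S' ψ) : (dualIso hSS' hφ hψ x).vertices = x.gens :=
  TropCell.vertices_eq _ x.cone_mem (dualIso_simplex hSS' hφ hψ x)

lemma mem_dualIso_perp_iff (x : Trop p S S' ψ) (w : ℂ ⊗[ℤ] X) :
    w ∈ (dualIso hSS' hφ hψ x).perp ↔ ∀ u ∈ x.lin, pairing ℂ p w u = 0 :=
  x.mem_perp_iff (dualIso hSS' hφ hψ x) (simplex_eq_dualIso hSS' hφ hψ x) w

lemma mem_perp_iff_dualIso (x : Trop p S S' ψ) (w : ℂ ⊗[ℤ] Y) :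
    w ∈ x.perp ↔ ∀ u ∈ (dualIso hSS' hφ hψ x).lin, pairing ℂ p.flip w u = 0 :=
  (dualIso hSS' hφ hψ x).mem_perp_iff (p := p.flip) x (dualIso_simplex hSS' hφ hψ x) w

variable {d : ℕ} (hd : Module.finrank ℤ X = d) {vol : ExteriorAlgebra ℂ (ℂ ⊗[ℤ] X)}
  (hvol : vol ∈ ⋀[ℂ]^d (ℂ ⊗[ℤ] X)) (hvol0 : vol ≠ 0)

include hd hvol in
lemma contraction_mem_forms (x : Trop p S S' ψ) (k : ℚ) {ω : ExteriorAlgebra ℂ (ℂ ⊗[ℤ] Y)}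
    (hω : ω ∈ x.forms k) : contraction p ω vol ∈ (dualIso hSS' hφ hψ x).forms (d - k) := by
  have hd' : Module.finrank ℂ (ℂ ⊗[ℤ] X) = d := by rw [Module.finrank_baseChange, hd]
  have h := contraction_mem_wedgeForms p x.lin x.perp (dualIso hSS' hφ hψ x).lin
    (dualIso hSS' hφ hψ x).perp x.lin_le_perp (TropCell.lin_le_perp _)
    (fun u hu w hw => (mem_dualIso_perp_iff hSS' hφ hψ x w).1 hw u hu)
    (fun u hu w hw => by
      have := (mem_perp_iff_dualIso hSS' hφ hψ x w).1 hw u hu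
      rwa [pairing_flip] at this)
    (finrank_add_finrank_annihilator p _ _ (mem_dualIso_perp_iff hSS' hφ hψ x))
    (vol := vol) (by rwa [hd']) k hω
  rwa [hd'] at h

include hd hvol hvol0 in
lemma exists_mem_forms_contraction_eq (x : Trop p S S' ψ) (k : ℚ)
    {η : ExteriorAlgebra ℂ (ℂ ⊗[ℤ] X)} (hη : η ∈ (dualIso hSS' hφ hψ x).forms (d - k)) :
    ∃ ω ∈ x.forms k, contraction p ω vol = η := by
  have hd' : Module.finrank ℂ (ℂ ⊗[ℤ] X) = d := by rw [Module.finrank_baseChange, hd]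
  refine exists_contraction_eq p x.lin x.perp (dualIso hSS' hφ hψ x).lin
    (dualIso hSS' hφ hψ x).perp x.lin_le_perp (TropCell.lin_le_perp _)
    (fun u hu w hw => (mem_dualIso_perp_iff hSS' hφ hψ x w).1 hw u hu)
    (fun u hu w hw => ?_)
    (finrank_add_finrank_annihilator p _ _ (mem_dualIso_perp_iff hSS' hφ hψ x))
    (finrank_add_finrank_annihilator p.flip _ _ (mem_perp_iff_dualIso hSS' hφ hψ x))
    (vol := vol) (by rwa [hd']) hvol0 k (by rwa [hd'])
  have := (mem_perp_iff_dualIso hSS' hφ hψ x w).1 hw u hu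
  rwa [pairing_flip] at this

include hd hvol hvol0 in
lemma eq_zero_of_mem_forms (x : Trop p S S' ψ) (k : ℚ) {ω : ExteriorAlgebra ℂ (ℂ ⊗[ℤ] Y)}
    (hω : ω ∈ x.forms k) (h : contraction p ω vol = 0) : ω = 0 := by
  have hd' : Module.finrank ℂ (ℂ ⊗[ℤ] X) = d := by rw [Module.finrank_baseChange, hd]
  exact eq_zero_of_mem_wedgeForms p (by rwa [hd']) hvol0 x.lin x.perp k hω h

lemma contractSwap_apply {X Y : Type} [AddCommGroup X] [AddCommGroup Y] (p : X →ₗ[ℤ] Y →ₗ[ℤ] ℤ)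
    (vol : ExteriorAlgebra ℂ (ℂ ⊗[ℤ] X))
    (f : (X × ℚ) × (Y × ℚ) →₀ ExteriorAlgebra ℂ (ℂ ⊗[ℤ] Y)) (g : (Y × ℚ) × (X × ℚ)) :
    contractSwap p vol f g = contraction p (f g.swap) vol :=
  (Finsupp.mapDomain_apply Prod.swap_injective
    (Finsupp.mapRange.linearMap (LinearMap.applyₗ vol ∘ₗ (contraction p).toLinearMap) f)
    g.swap).trans rfl

/-- The index set of the direct sum that defines the sections of `Jorb`. -/
abbrev TropCell.boxPairs {A : Set Y} {ν : Y → ℝ} (x : TropCell p S A ν) (mu : ℚ) :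
    Set ((X × ℚ) × (Y × ℚ)) :=
  {g | g.1 ∈ box x.gens ∧ g.2 ∈ box x.vertices ∧ g.1.2 + g.2.2 = mu}

lemma mem_boxPairs_dualIso (x : Trop p S S' ψ) (mu : ℚ) (g : (Y × ℚ) × (X × ℚ)) :
    g ∈ (dualIso hSS' hφ hψ x).boxPairs mu ↔ g.swap ∈ x.boxPairs mu := by
  simp only [TropCell.boxPairs, dualIso_gens, dualIso_vertices, Set.mem_ofPred_eq, Prod.fst_swap,
    Prod.snd_swap, add_comm g.1.2]
  tauto

/-- The summands of the sections of `Jorb`. -/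
noncomputable abbrev TropCell.boxForms {A : Set Y} {ν : Y → ℝ} (x : TropCell p S A ν) (lam : ℚ)
    (g : (X × ℚ) × (Y × ℚ)) : Submodule ℂ (ExteriorAlgebra ℂ (ℂ ⊗[ℤ] Y)) :=
  x.forms (lam + g.2.2 - g.1.2)

include hd hvol in
lemma contractSwap_mem (lam mu : ℚ) (x : Trop p S S' ψ)
    {f : (X × ℚ) × (Y × ℚ) →₀ ExteriorAlgebra ℂ (ℂ ⊗[ℤ] Y)}
    (hf : f ∈ maskedSum (x.boxPairs mu) (x.boxForms lam)) :
    contractSwap p vol f ∈ maskedSum ((dualIso hSS' hφ hψ x).boxPairs mu)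
      ((dualIso hSS' hφ hψ x).boxForms (d - lam)) := by
  intro g
  rw [contractSwap_apply]
  constructor
  · have h := contraction_mem_forms hSS' hφ hψ hd hvol x _ (hf g.swap).1
    rwa [show (d : ℚ) - (lam + g.swap.2.2 - g.swap.1.2) = d - lam + g.2.2 - g.1.2 by
      rw [Prod.fst_swap, Prod.snd_swap]; ring] at h
  · intro hg
    rw [(hf g.swap).2 (mt (mem_boxPairs_dualIso hSS' hφ hψ x mu g).2 hg), map_zero,
      LinearMap.zero_apply]

/-- Contraction with the volume form and exchange of the box factors, on the sections over a
cell. -/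
noncomputable def dualSections (lam mu : ℚ) (x : Trop p S S' ψ) :
    maskedSum (x.boxPairs mu) (x.boxForms lam) →ₗ[ℂ]
      maskedSum ((dualIso hSS' hφ hψ x).boxPairs mu)
        ((dualIso hSS' hφ hψ x).boxForms (d - lam)) :=
  (contractSwap p vol).restrict fun _ hf => contractSwap_mem hSS' hφ hψ hd hvol lam mu x hf

include hvol0 in
lemma dualSections_bijective (lam mu : ℚ) (x : Trop p S S' ψ) :
    Function.Bijective (dualSections hSS' hφ hψ hd hvol lam mu x) := by
  constructor
  · rw [injective_iff_map_eq_zero]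
    intro f hf
    refine Subtype.ext (Finsupp.ext fun g => ?_)
    refine eq_zero_of_mem_forms hd hvol hvol0 x _ (f.2 g).1 ?_
    exact (contractSwap_apply p vol f.1 g.swap).symm.trans
      (DFunLike.congr_fun (congrArg Subtype.val hf) g.swap)
  · intro η
    have hex : ∀ g : (X × ℚ) × (Y × ℚ), ∃ ω ∈ x.boxForms lam g,
        contraction p ω vol = η.1 g.swap := by
      intro g
      refine exists_mem_forms_contraction_eq hSS' hφ hψ hd hvol hvol0 x _ ?_
      have h := (η.2 g.swap).1
      rwa [show (d : ℚ) - (lam + g.2.2 - g.1.2) = d - lam + g.swap.2.2 - g.swap.1.2 by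
        rw [Prod.fst_swap, Prod.snd_swap]; ring]
    choose ω hω hωη using hex
    have hzero : ∀ g, η.1 g.swap = 0 → ω g = 0 := fun g hg =>
      eq_zero_of_mem_forms hd hvol hvol0 x _ (hω g) ((hωη g).trans hg)
    have hfin : (Function.support ω).Finite := by
      refine (η.1.hasFiniteSupport.preimage
        (Prod.swap_injective (α := X × ℚ) (β := Y × ℚ)).injOn).subset fun g hg => ?_
      exact fun h => hg (hzero g h)
    refine ⟨⟨Finsupp.ofSupportFinite ω hfin, fun g => ⟨hω g, fun hg => ?_⟩⟩, ?_⟩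
    · exact hzero g ((η.2 g.swap).2 fun h => hg ((mem_boxPairs_dualIso hSS' hφ hψ x mu _).1 h))
    · exact Subtype.ext (Finsupp.ext fun g =>
        (contractSwap_apply p vol _ g).trans (hωη g.swap))

/-- Contraction with the volume form, together with the exchange of the box factors, as an
isomorphism of sheaves over the isomorphism of posets `dualIso`. -/
noncomputable def dualSheafIso (lam mu : ℚ) :
    TropJorb p S S' ψ lam mu ≅
      pullback (dualIso hSS' hφ hψ : Trop p S S' ψ →o Trop p.flip S' S φ)
        (TropJorb p.flip S' S φ (d - lam) mu) :=
  NatIso.ofComponents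
    (fun x => (LinearEquiv.ofBijective (dualSections hSS' hφ hψ hd hvol lam mu x)
      (dualSections_bijective hSS' hφ hψ hd hvol hvol0 lam mu x)).toModuleIso) (by
    intro x y l
    have hl : x ≤ y := leOfHom l
    have hl' : dualIso hSS' hφ hψ x ≤ dualIso hSS' hφ hψ y := (dualIso hSS' hφ hψ).monotone hl
    refine ModuleCat.hom_ext (LinearMap.ext fun (f : maskedSum (x.boxPairs mu) (x.boxForms lam)) =>
      Subtype.ext (Finsupp.ext fun g => ?_))
    let f' : maskedSum (y.boxPairs mu) (y.boxForms lam) :=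
      maskedMap (fun _ => TropCell.forms_mono hl _) f
    have h1 : (dualSections hSS' hφ hψ hd hvol lam mu y f').1 g = contraction p (f'.1 g.swap) vol :=
      contractSwap_apply p vol _ g
    have h2 : (dualSections hSS' hφ hψ hd hvol lam mu x f).1 g = contraction p (f.1 g.swap) vol :=
      contractSwap_apply p vol _ g
    have hE : ∀ g, (dualIso hSS' hφ hψ x).boxForms (d - lam) g ≤
        (dualIso hSS' hφ hψ y).boxForms (d - lam) g := fun _ => TropCell.forms_mono hl' _
    let f'' : maskedSum ((dualIso hSS' hφ hψ y).boxPairs mu)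
        ((dualIso hSS' hφ hψ y).boxForms (d - lam)) :=
      maskedMap hE (dualSections hSS' hφ hψ hd hvol lam mu x f)
    change (dualSections hSS' hφ hψ hd hvol lam mu y f').1 g = f''.1 g
    rw [h1]
    by_cases hg : g ∈ (dualIso hSS' hφ hψ y).boxPairs mu
    · have e1 : f''.1 g = _ := maskedMap_of_mem hE _ hg
      have e2 : f'.1 g.swap = f.1 g.swap :=
        maskedMap_of_mem _ f ((mem_boxPairs_dualIso hSS' hφ hψ y mu g).1 hg)
      rw [e1, h2, e2]
    · have e1 : f''.1 g = 0 := maskedMap_of_notMem hE _ hg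
      have e2 : f'.1 g.swap = 0 :=
        maskedMap_of_notMem _ f (mt (mem_boxPairs_dualIso hSS' hφ hψ y mu g).2 hg)
      rw [e1, e2, map_zero, LinearMap.zero_apply])

end DualSheaf

/-! ### The isomorphism of orbifold Hodge spaces -/

section DirectSums

open DirectSum

/-- A family of linear maps `∏ i, A i n → ∏ j, B j n`, with finite index sets for `i` and `j`,
assembles to a linear map of direct sums. -/
lemma exists_directSum_map {I J : Type} [Finite I] [Finite J] {A : I → ℕ → Type}
    {B : J → ℕ → Type} [∀ i n, AddCommGroup (A i n)] [∀ i n, Module ℂ (A i n)]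
    [∀ j n, AddCommGroup (B j n)] [∀ j n, Module ℂ (B j n)]
    (κ : ∀ n, (∀ i, A i n) →ₗ[ℂ] ∀ j, B j n) :
    ∃ Φ : (⨁ i, ⨁ n, A i n) →ₗ[ℂ] ⨁ j, ⨁ n, B j n,
      ∀ z j n, (Φ z) j n = κ n (fun i => z i n) j := by
  classical
  have := Fintype.ofFinite J
  let Φ : (⨁ i, ⨁ n, A i n) →ₗ[ℂ] ⨁ j, ⨁ n, B j n :=
    toModule ℂ I _ fun i => toModule ℂ ℕ _ fun n =>
      ∑ j, lof ℂ J (fun j => ⨁ n, B j n) j ∘ₗ lof ℂ ℕ (B j) n ∘ₗ LinearMap.proj j ∘ₗ κ n ∘ₗ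
        LinearMap.single ℂ (fun i => A i n) i
  refine ⟨Φ, fun z j m => ?_⟩
  let l : (⨁ i, ⨁ n, A i n) →ₗ[ℂ] B j m :=
    component ℂ ℕ (B j) m ∘ₗ component ℂ J (fun j => ⨁ n, B j n) j ∘ₗ Φ
  let r : (⨁ i, ⨁ n, A i n) →ₗ[ℂ] B j m :=
    LinearMap.proj j ∘ₗ κ m ∘ₗ
      LinearMap.pi fun i => component ℂ ℕ (A i) m ∘ₗ component ℂ I (fun i => ⨁ n, A i n) i
  suffices h : l = r from LinearMap.congr_fun h z
  refine linearMap_ext ℂ fun i => linearMap_ext ℂ fun n => LinearMap.ext fun v => ?_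
  have h1 : l (lof ℂ I (fun i => ⨁ n, A i n) i (lof ℂ ℕ (A i) n v)) =
      lof ℂ ℕ (B j) n (κ n (Pi.single i v) j) m := by
    simp only [l, Φ, LinearMap.comp_apply, toModule_lof, LinearMap.sum_apply, map_sum]
    rw [Finset.sum_eq_single j]
    · rw [component.lof_self]
      rfl
    · intro j' _ hj
      rw [component.of, dif_neg hj, map_zero]
    · exact fun h => absurd (Finset.mem_univ j) h
  have h2 : r (lof ℂ I (fun i => ⨁ n, A i n) i (lof ℂ ℕ (A i) n v)) =
      κ m (Pi.single i (lof ℂ ℕ (A i) n v m)) j := by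
    have : (fun i' => (lof ℂ I (fun i => ⨁ n, A i n) i (lof ℂ ℕ (A i) n v)) i' m) =
        Pi.single i (lof ℂ ℕ (A i) n v m) := by
      funext i'
      by_cases h : i' = i
      · subst h
        rw [Pi.single_eq_same, lof_eq_of, of_eq_same]
      · rw [Pi.single_eq_of_ne h, lof_eq_of, of_eq_of_ne _ _ _ h, DirectSum.zero_apply]
    exact congrFun (congrArg _ this) j
  refine h1.trans (Eq.trans ?_ h2.symm)
  by_cases h : m = n
  · subst h
    rw [lof_eq_of, lof_eq_of, of_eq_same, of_eq_same]
  · rw [lof_eq_of, lof_eq_of, of_eq_of_ne _ _ _ h, of_eq_of_ne _ _ _ h, Pi.single_zero, map_zero,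
      Pi.zero_apply]

lemma exists_directSum_equiv {I J : Type} [Finite I] [Finite J] {A : I → ℕ → Type}
    {B : J → ℕ → Type} [∀ i n, AddCommGroup (A i n)] [∀ i n, Module ℂ (A i n)]
    [∀ j n, AddCommGroup (B j n)] [∀ j n, Module ℂ (B j n)]
    (κ : ∀ n, (∀ i, A i n) ≃ₗ[ℂ] ∀ j, B j n) :
    ∃ Φ : (⨁ i, ⨁ n, A i n) ≃ₗ[ℂ] ⨁ j, ⨁ n, B j n,
      ∀ z j n, (Φ z) j n = κ n (fun i => z i n) j := by
  obtain ⟨Φ, hΦ⟩ := exists_directSum_map fun n => (κ n).toLinearMap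
  obtain ⟨Ψ, hΨ⟩ := exists_directSum_map fun n => (κ n).symm.toLinearMap
  refine ⟨LinearEquiv.ofLinearMap Φ Ψ (LinearMap.ext fun z => ?_) (LinearMap.ext fun z => ?_), hΦ⟩
  · refine DFinsupp.ext fun j => DFinsupp.ext fun n => ?_
    refine (hΦ (Ψ z) j n).trans ?_
    rw [funext fun i => hΨ z i n]
    exact congrFun ((κ n).apply_symm_apply _) j
  · refine DFinsupp.ext fun i => DFinsupp.ext fun n => ?_
    refine (hΨ (Φ z) i n).trans ?_
    rw [funext fun j => hΦ z j n]
    exact congrFun ((κ n).symm_apply_apply _) i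

end DirectSums

section HodgeSpaces

variable {P Q : Type} [PartialOrder P] [PartialOrder Q]

instance (i : Q →o P) : (pullbackFunctor i).Linear ℂ where
  map_smul _ _ := rfl

/-- The map on cohomology induced by a morphism of sheaves, as a linear map. -/
noncomputable def H.mapₗ {F G : PosetSheaf P} (f : F ⟶ G) (n : ℕ) : H F n →ₗ[ℂ] H G n where
  toFun := H.map f
  map_add' x y := Abelian.Ext.add_comp x y _ _
  map_smul' a x := Abelian.Ext.smul_comp x _ _ a

/-- The inverse image on cohomology, as a linear map. -/
noncomputable def H.pullbackₗ (i : Q →o P) (F : PosetSheaf P) (n : ℕ) :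
    H F n →ₗ[ℂ] H (ClarkeDuality.pullback i F) n :=
  (pullbackFunctor i).mapExtLinearMap ℂ (constSheaf P) F n

lemma H.map_bijective {F G : PosetSheaf P} (f : F ≅ G) (n : ℕ) :
    Function.Bijective (H.map f.hom : H F n → H G n) := by
  refine Function.bijective_iff_has_inverse.2 ⟨H.map f.inv, fun x => ?_, fun x => ?_⟩ <;>
  · unfold H.map
    rw [Abelian.Ext.comp_assoc_of_third_deg_zero, Abelian.Ext.mk₀_comp_mk₀]
    simp

/-- The isomorphism between the cohomology of `Jorb` and the product of the contributions of the
twisted sectors. -/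
noncomputable def sectorEquiv {X Y : Type} [AddCommGroup X] [AddCommGroup Y]
    {p : X →ₗ[ℤ] Y →ₗ[ℤ] ℤ} {S : StackyFan X} {A : Set Y} {ν : Y → ℝ} [Module.Finite ℤ Y]
    [Module.Free ℤ X] [Module.Finite ℤ X] (lam mu : ℚ) (n : ℕ) :
    H (Jorb p S A ν lam (mu - n)) n ≃ₗ[ℂ] ∀ s : S.Sector,
      H (pullback (Stratum.incl p S A ν s.cone) (J p S A ν (lam - s.age) (mu - s.age - n))) n :=
  LinearEquiv.ofBijective
    (LinearMap.pi fun s =>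
      H.mapₗ (sectorProj p S A ν s lam (mu - n) (mu - s.age - n) (by ring)) n ∘ₗ
        H.pullbackₗ (Stratum.incl p S A ν s.cone) _ n)
    (sector_bijective lam (mu - n) (fun s => mu - s.age - n) (fun s => by ring) n)

lemma corresponds_iff {X Y : Type} [AddCommGroup X] [AddCommGroup Y]
    {p : X →ₗ[ℤ] Y →ₗ[ℤ] ℤ} {S : StackyFan X} {A : Set Y} {ν : Y → ℝ} [Module.Finite ℤ Y]
    [Module.Free ℤ X] [Module.Finite ℤ X] {lam mu : ℚ} (z : OrbHodge p S A ν lam mu)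
    (x : ∀ n : ℕ, H (Jorb p S A ν lam (mu - n)) n) :
    Corresponds z x ↔ ∀ n, (fun s => z s n) = sectorEquiv lam mu n (x n) :=
  ⟨fun h n => funext fun s => h s n, fun h s n => congrFun (h n) s⟩

/-- Isomorphisms of the cohomologies of the orbifold Jacobian sheaves induce a unique isomorphism
of the orbifold Hodge spaces. -/
lemma existsUnique_orbHodge_equiv {X Y X' Y' : Type} [AddCommGroup X] [AddCommGroup Y]
    [AddCommGroup X'] [AddCommGroup Y'] {p : X →ₗ[ℤ] Y →ₗ[ℤ] ℤ} {S : StackyFan X} {A : Set Y}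
    {ν : Y → ℝ} {p' : X' →ₗ[ℤ] Y' →ₗ[ℤ] ℤ} {S' : StackyFan X'} {A' : Set Y'} {ν' : Y' → ℝ}
    [Module.Finite ℤ Y] [Module.Free ℤ X] [Module.Finite ℤ X]
    [Module.Finite ℤ Y'] [Module.Free ℤ X'] [Module.Finite ℤ X'] (lam lam' mu : ℚ)
    (θ : ∀ n : ℕ, H (Jorb p S A ν lam (mu - n)) n ≃ₗ[ℂ] H (Jorb p' S' A' ν' lam' (mu - n)) n) :
    ∃! Φ : OrbHodge p S A ν lam mu ≃ₗ[ℂ] OrbHodge p' S' A' ν' lam' mu,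
      ∀ z x, Corresponds z x → Corresponds (Φ z) fun n => θ n (x n) := by
  obtain ⟨Φ, hΦ⟩ := exists_directSum_equiv fun n =>
    (sectorEquiv (p := p) (S := S) (A := A) (ν := ν) lam mu n).symm ≪≫ₗ θ n ≪≫ₗ
      sectorEquiv (p := p') (S := S') (A := A') (ν := ν') lam' mu n
  refine ⟨Φ, fun z x hzx => ?_, fun Φ' hΦ' => ?_⟩
  · rw [corresponds_iff] at hzx ⊢
    intro n
    funext s
    refine (hΦ z s n).trans ?_
    rw [hzx n, LinearEquiv.trans_apply, LinearEquiv.trans_apply, LinearEquiv.symm_apply_apply]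
  · refine LinearEquiv.ext fun z => DFinsupp.ext fun s => DFinsupp.ext fun n => ?_
    have h := (corresponds_iff _ _).1 (hΦ' z
      (fun n => (sectorEquiv lam mu n).symm fun s => z s n) ((corresponds_iff _ _).2 fun n =>
        (LinearEquiv.apply_symm_apply _ _).symm)) n
    exact (congrFun h s).trans (hΦ z s n).symm

end HodgeSpaces

end ClarkeDuality

theorem theoremt (d : ℕ) {M N : Type} [AddCommGroup M] [Module.Free ℤ M] [Module.Finite ℤ M]
    [AddCommGroup N] [Module.Free ℤ N] [Module.Finite ℤ N]
    (p : M →ₗ[ℤ] N →ₗ[ℤ] ℤ) [p.IsPerfPair] (hd : Module.finrank ℤ M = d)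
    (S : StackyFan M) (S' : StackyFan N) (hSS' : IsClarkeDual p S S')
    (φ : ℝ ⊗[ℤ] M → ℝ) (hφ : S.StrictlyConvex φ)
    (hφZ : ∀ m ∈ S.rays, ∃ k : ℤ, φ (toReal M m) = k)
    (φ' : ℝ ⊗[ℤ] N → ℝ) (hφ' : S'.StrictlyConvex φ')
    (hφZ' : ∀ n ∈ S'.rays, ∃ k : ℤ, φ' (toReal N n) = k)
    (vol : ExteriorAlgebra ℂ (ℂ ⊗[ℤ] M)) (hvol : vol ∈ ⋀[ℂ]^d (ℂ ⊗[ℤ] M)) (hvol0 : vol ≠ 0) :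
    ∃ e : Trop p S S' φ' ≃o Trop p.flip S' S φ,
      (∀ x, (e x).simplex = S.simplex x.cone ∧ x.simplex = S'.simplex (e x).cone) ∧
      ∃ D : ∀ lam mu : ℚ, TropJorb p S S' φ' lam mu ≅
          pullback (e : Trop p S S' φ' →o Trop p.flip S' S φ)
            (TropJorb p.flip S' S φ (d - lam) mu),
        (∀ (lam mu : ℚ) (x : Trop p S S' φ') (v : (TropJorb p S S' φ' lam mu).obj x),
          Subtype.val ((D lam mu).hom.app x v) = contractSwap p vol (Subtype.val v)) ∧
        ∀ lam mu : ℚ,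
          ∃! Φ : TropOrbHodge p S S' φ' lam mu ≃ₗ[ℂ] TropOrbHodge p.flip S' S φ (d - lam) mu,
            ∀ z x y, Corresponds z x →
              (∀ n : ℕ, H.map (D lam (mu - n)).hom (x n) =
                H.pullback (e : Trop p S S' φ' →o Trop p.flip S' S φ) (y n)) →
              Corresponds (Φ z) y := by
  let e := dualIso hSS' hφ hφ'
  let D (lam mu : ℚ) := dualSheafIso hSS' hφ hφ' hd hvol hvol0 lam mu
  refine ⟨e, fun x => ⟨dualIso_simplex hSS' hφ hφ' x, simplex_eq_dualIso hSS' hφ hφ' x⟩, D,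
    fun _ _ _ _ => rfl, fun lam mu => ?_⟩
  let α (n : ℕ) : H (TropJorb p S S' φ' lam (mu - n)) n ≃ₗ[ℂ] _ :=
    LinearEquiv.ofBijective (H.mapₗ (D lam (mu - n)).hom n) (H.map_bijective (D lam (mu - n)) n)
  let γ (n : ℕ) : H (TropJorb p.flip S' S φ (d - lam) (mu - n)) n ≃ₗ[ℂ] _ :=
    LinearEquiv.ofBijective (H.pullbackₗ (e : Trop p S S' φ' →o Trop p.flip S' S φ) _ n)
      (H.pullback_bijective e _ n)
  obtain ⟨Φ, hΦ, huniq⟩ := existsUnique_orbHodge_equiv lam (d - lam) mu fun n => α n ≪≫ₗ (γ n).symm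
  refine ⟨Φ, fun z x y hzx hxy => ?_, fun Φ' hΦ' => huniq Φ' fun z x hzx => ?_⟩
  · have hy : y = fun n => (α n ≪≫ₗ (γ n).symm) (x n) :=
      funext fun n => ((γ n).symm_apply_eq.2 (hxy n)).symm
    rw [hy]
    exact hΦ z x hzx
  · exact hΦ' z x _ hzx fun n => ((γ n).apply_symm_apply (α n (x n))).symm
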